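/- **Setting.** Let $G$ be a tree on a finite set $V$ of $n\ge 1$ workers, $\tau_{ij}$ the number of hops between $i$ and $j$, and $\tau_{\max}=\max_{i,j}\tau_{ij}$. Worker $i$ has a data distribution $\mathcal D_i$ and a sample loss $F_i(x,\xi)$, $x\in\mathbb R^d$; put $f_i(x)=\mathbb E_{\xi\sim\mathcal D_i}F_i(x,\xi)$ and $f=\frac1n\sum_i f_i$, and let $x^\star$ be a minimizer of $f$. RelaySGD with step size $\gamma>0$ sets $x_i^{(s)}=x^{(0)}$ for all times $s\le 0$ and, for $t\ge 0$, $$x_i^{(t+1)}=\frac1n\sum_{j}\Big(x_j^{(t-\tau_{ij})}-\gamma\nabla F_j\big(x_j^{(t-\tau_{ij})};\xi_j^{(t-\tau_{ij})}\big)\Big),$$ where all samples $\xi_j^{(s)}$ ($s\in\mathbb Z$) are independent and $\xi_j^{(s)}\sim\mathcal D_j$. The augmented mixing matrix $W$ has rows and columns indexed by $(\tau,i)$, $0\le\tau\le\tau_{\max}$, $i\in V$, with $$W_{(\tau,i),(\tau',j)}=\begin{cases}\frac1n&\tau=0,\ \tau'=\tau_{ij},\\ 1& i=j,\ \tau=\tau'+1,\\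 0&\text{otherwise.}\end{cases}$$ Let $\pi$ be the left eigenvector of $W$ for the eigenvalue $1$ with $\pi^\top\mathbf 1=1$, $\pi_0$ the common value of its entries with $\tau=0$, $Y^{(t)}$ the matrix with rows $x_i^{(t-\tau)}$, and $\bar x^{(t)}=\pi^\top Y^{(t)}$. Let $p=\frac12(1-|\lambda_2(W)|)$, where $|\lambda_2(W)|$ is the second largest eigenvalue modulus of $W$ ($0$ if $n=1$), and let $m\ge1$ be an integer such that $\|W^mX-\mathbf 1\pi^\top X\|^2\le(1-p)^{2m}\|X-\mathbf 1\pi^\top X\|^2$ for all real matrices $X$. Put $\rho=p/m$ and $C=(\tau_{\max}+1)^{3/2}/\rho$. **Theorem.** The vector $\pi$ exists and is unique, $p>0$, and such an $m$ exists. There is a universal constant $K$ such that the following holds for every such $m$. Assume that, for every $i$ and almost every $\xi\sim\mathcal D_i$, $F_i(\cdot,\xi)$ is differentiable with $L$-Lipschitz gradient, that $\mathbb E_{\xi\sim\mathcal D_i}\|\nabla F_i(x,\xi)-\nabla f_i(x)\|^2\le\bar\sigma^2$ for all $i$ and $x$ (with $L,\bar\sigma\ge0$), and let $\epsilon>0$,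 $R_0^2=\|x^{(0)}-x^\star\|^2$, $F_0=f(x^{(0)})-f(x^\star)$. * *Convex.* If every $f_i$ is $\mu$-convex with some $\mu\ge0$, i.e. $f_i(x)-f_i(y)+\frac\mu2\|x-y\|^2\le\langle\nabla f_i(x),x-y\rangle$ for all $x,y$, then for a suitable $\gamma>0$, $$\frac1{T+1}\sum_{t=0}^T\big(\mathbb E f(\bar x^{(t)})-f(x^\star)\big)\le\epsilon\quad\text{whenever}\quad T+1\ge K\Big(\frac{\bar\sigma^2}{n\epsilon^2}+\frac{C\sqrt L\,\bar\sigma}{\epsilon^{3/2}}+\frac{CL}{\epsilon}\Big)R_0^2 .$$ * *Non-convex.* Without convexity, for a suitable $\gamma>0$, $$\frac1{T+1}\sum_{t=0}^T\mathbb E\|\nabla f(\bar x^{(t)})\|^2\le\epsilon\quad\text{whenever}\quad T+1\ge K\Big(\frac{\bar\sigma^2}{n\epsilon^2}+\frac{C\bar\sigma}{\epsilon^{3/2}}+\frac{C}{\epsilon}\Big)LF_0 .$$ * *Strongly convex.* If every $f_i$ is $\mu$-convex with $\mu>0$, put $N=\frac{\bar\sigma^2}{\mu n\epsilon}+\frac{C\sqrt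 L\,\bar\sigma}{\mu\sqrt\epsilon}$, $w_t=(1-\frac{\mu\gamma n\pi_0}2)^{-(t+1)}$ and $W_T=\sum_{t=0}^Tw_t$. Then for a suitable $\gamma>0$ with $\frac{\mu\gamma n\pi_0}{2}<1$, $$\frac1{W_T}\sum_{t=0}^Tw_t\big(\mathbb E f(\bar x^{(t)})-f(x^\star)\big)+\mu\,\mathbb E\|\bar x^{(T+1)}-x^\star\|^2\le\epsilon$$ whenever $$T+1\ge K\Big(N\log\big(1+\tfrac{\mu NR_0^2}{\epsilon}\big)+\frac{CL}{\mu}\log\big(1+\tfrac{CLR_0^2}{\epsilon}\big)\Big).$$ The step size is constant in time and independent of $T$. All expectations above are finite, and no bound involves the heterogeneity of the data. -/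

import Mathlib

open MeasureTheory ProbabilityTheory
open scoped NNReal Gradient InnerProductSpace

noncomputable section

namespace RelaySGD

/-! ### The augmented mixing matrix -/

/-- Row and column indices `(τ, i)` of the augmented system: a delay `τ ∈ {0, …, τ_max}` and a
worker `i`.  The number of hops between two workers is `G.dist`, and `τ_max = G.diam`. -/
abbrev Idx {V : Type*} (G : SimpleGraph V) : Type _ := Fin (G.diam + 1) × V

/-- The mixing matrix `W` of the augmented graph. -/
def mixingMatrix {V : Type*} [Fintype V] [DecidableEq V] (G : SimpleGraph V) :
    Matrix (Idx G) (Idx G) ℝ := fun a b =>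
  if (a.1 : ℕ) = 0 ∧ (b.1 : ℕ) = G.dist a.2 b.2 then 1 / (Fintype.card V : ℝ)
  else if a.2 = b.2 ∧ (a.1 : ℕ) = (b.1 : ℕ) + 1 then 1
  else 0

/-- `π` is the left eigenvector of `W` for the eigenvalue `1`, normalised by `πᵀ 1 = 1`. -/
def IsStationary {ι : Type*} [Fintype ι] (W : Matrix ι ι ℝ) (π : ι → ℝ) : Prop :=
  Matrix.vecMul π W = π ∧ ∑ k, π k = 1

/-- `|λ₂(W)|`: the largest modulus among the complex eigenvalues of `W`, counted with algebraic
multiplicity, after one copy of the leading eigenvalue `λ₁ = 1` has been removed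
(and `0` if nothing is left). -/
def lambdaTwo {ι : Type*} [Fintype ι] [DecidableEq ι] (W : Matrix ι ι ℝ) : ℝ≥0 :=
  (((W.map (algebraMap ℝ ℂ)).charpoly.roots.erase 1).map (fun z => ‖z‖₊)).sup

/-- `p = (1 - |λ₂(W)|) / 2`. -/
def gap {ι : Type*} [Fintype ι] [DecidableEq ι] (W : Matrix ι ι ℝ) : ℝ :=
  (1 - (lambdaTwo W : ℝ)) / 2

/-- The squared Frobenius norm. -/
def frobSq {ι κ : Type*} [Fintype ι] [Fintype κ] (A : Matrix ι κ ℝ) : ℝ :=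
  ∑ i, ∑ k, A i k ^ 2

/-- The matrix `1 πᵀ`. -/
def onesPi {ι : Type*} (π : ι → ℝ) : Matrix ι ι ℝ := Matrix.vecMulVec (fun _ => 1) π

/-- `m` is a positive number of steps after which the consensus distance has contracted:
`‖W^m X - 1πᵀX‖² ≤ (1 - p)^{2m} ‖X - 1πᵀX‖²` for all matrices `X`. -/
def IsMixingTime {ι : Type*} [Fintype ι] [DecidableEq ι] (W : Matrix ι ι ℝ) (π : ι → ℝ)
    (m : ℕ) : Prop :=
  0 < m ∧ ∀ (d : ℕ) (X : Matrix ι (Fin d) ℝ),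
    frobSq (W ^ m * X - onesPi π * X) ≤ (1 - gap W) ^ (2 * m) * frobSq (X - onesPi π * X)

/-- The effective spectral gap `ρ = p / m`. -/
def effGap {ι : Type*} [Fintype ι] [DecidableEq ι] (W : Matrix ι ι ℝ) (m : ℕ) : ℝ :=
  gap W / m

/-- The constant `C = (τ_max + 1)^{3/2} / ρ`. -/
def relayConst {V : Type*} [Fintype V] [DecidableEq V] (G : SimpleGraph V) (m : ℕ) : ℝ :=
  ((G.diam : ℝ) + 1) ^ (3 / 2 : ℝ) / effGap (mixingMatrix G) m

/-! ### The optimization problem and its assumptions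

`Ξ i` is the data space of worker `i`, `D i` the distribution of its data, `F i x ξ` its loss. -/

/-- The local objective `f_i(x) = E_{ξ ∼ D_i} F_i(x, ξ)`. -/
def localObj {V : Type*} {d : ℕ} {Ξ : V → Type*} [∀ i, MeasurableSpace (Ξ i)]
    (D : ∀ i, Measure (Ξ i)) (F : ∀ i, EuclideanSpace ℝ (Fin d) → Ξ i → ℝ) (i : V)
    (x : EuclideanSpace ℝ (Fin d)) : ℝ :=
  ∫ ξ, F i x ξ ∂(D i)

/-- The objective `f = (1/n) ∑ f_i`. -/
def obj {V : Type*} [Fintype V] {d : ℕ} {Ξ : V → Type*} [∀ i, MeasurableSpace (Ξ i)]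
    (D : ∀ i, Measure (Ξ i)) (F : ∀ i, EuclideanSpace ℝ (Fin d) → Ξ i → ℝ)
    (x : EuclideanSpace ℝ (Fin d)) : ℝ :=
  (1 / (Fintype.card V : ℝ)) * ∑ i, localObj D F i x

/-- Almost every sample loss is differentiable with an `L`-Lipschitz gradient. -/
def LSmooth {V : Type*} {d : ℕ} {Ξ : V → Type*} [∀ i, MeasurableSpace (Ξ i)]
    (D : ∀ i, Measure (Ξ i)) (F : ∀ i, EuclideanSpace ℝ (Fin d) → Ξ i → ℝ) (L : ℝ) : Prop :=
  0 ≤ L ∧ ∀ i, ∀ᵐ ξ ∂(D i), Differentiable ℝ (fun x => F i x ξ) ∧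
    ∀ x y, ‖∇ (fun z => F i z ξ) x - ∇ (fun z => F i z ξ) y‖ ≤ L * ‖x - y‖

/-- The stochastic gradients have variance at most `σ²`, uniformly in the point and the worker. -/
def BoundedNoise {V : Type*} {d : ℕ} {Ξ : V → Type*} [∀ i, MeasurableSpace (Ξ i)]
    (D : ∀ i, Measure (Ξ i)) (F : ∀ i, EuclideanSpace ℝ (Fin d) → Ξ i → ℝ) (σ : ℝ) : Prop :=
  0 ≤ σ ∧ ∀ i x,
    Integrable (fun ξ => ‖∇ (fun z => F i z ξ) x - ∇ (localObj D F i) x‖ ^ 2) (D i) ∧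
    ∫ ξ, ‖∇ (fun z => F i z ξ) x - ∇ (localObj D F i) x‖ ^ 2 ∂(D i) ≤ σ ^ 2

/-- Every local objective is `μ`-(strongly) convex. -/
def MuConvex {V : Type*} {d : ℕ} {Ξ : V → Type*} [∀ i, MeasurableSpace (Ξ i)]
    (D : ∀ i, Measure (Ξ i)) (F : ∀ i, EuclideanSpace ℝ (Fin d) → Ξ i → ℝ) (μ : ℝ) : Prop :=
  ∀ i x y, localObj D F i x - localObj D F i y + μ / 2 * ‖x - y‖ ^ 2
    ≤ ⟪∇ (localObj D F i) x, x - y⟫_ℝ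

/-! ### The algorithm -/

/-- The model `x_i^{(s)}` of worker `i` at time `s ∈ ℤ`, for the sample sequence `ξ`.  It is
`x^{(0)}` for all `s ≤ 0`, and
`x_i^{(s)} = (1/n) ∑_j (x_j^{(r)} - γ ∇F_j(x_j^{(r)}; ξ_j^{(r)}))`, `r = s - 1 - τ_ij`,
for `s ≥ 1`. -/
def model {V : Type*} [Fintype V] {d : ℕ} {Ξ : V → Type*} (G : SimpleGraph V)
    (F : ∀ i, EuclideanSpace ℝ (Fin d) → Ξ i → ℝ) (x₀ : EuclideanSpace ℝ (Fin d)) (γ : ℝ)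
    (ξ : ∀ i, ℤ → Ξ i) (s : ℤ) (i : V) : EuclideanSpace ℝ (Fin d) :=
  if _h : 0 < s then
    (1 / (Fintype.card V : ℝ)) • ∑ j,
      (model G F x₀ γ ξ (s - 1 - (G.dist i j : ℤ)) j
        - γ • ∇ (fun z => F j z (ξ j (s - 1 - (G.dist i j : ℤ))))
            (model G F x₀ γ ξ (s - 1 - (G.dist i j : ℤ)) j))
  else x₀
termination_by s.toNat
decreasing_by all_goals omega

/-- The rows `x_i^{(t-τ)}` of the stacked matrix `Y^{(t)}`. -/
def stacked {V : Type*} [Fintype V] {d : ℕ} {Ξ : V → Type*} (G : SimpleGraph V)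
    (F : ∀ i, EuclideanSpace ℝ (Fin d) → Ξ i → ℝ) (x₀ : EuclideanSpace ℝ (Fin d)) (γ : ℝ)
    (ξ : ∀ i, ℤ → Ξ i) (t : ℕ) (a : Idx G) : EuclideanSpace ℝ (Fin d) :=
  model G F x₀ γ ξ ((t : ℤ) - ((a.1 : ℕ) : ℤ)) a.2

/-- The average `x̄^{(t)} = πᵀ Y^{(t)}`. -/
def xbar {V : Type*} [Fintype V] {d : ℕ} {Ξ : V → Type*} (G : SimpleGraph V) (π : Idx G → ℝ)
    (F : ∀ i, EuclideanSpace ℝ (Fin d) → Ξ i → ℝ) (x₀ : EuclideanSpace ℝ (Fin d)) (γ : ℝ)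
    (ξ : ∀ i, ℤ → Ξ i) (t : ℕ) : EuclideanSpace ℝ (Fin d) :=
  ∑ a, π a • stacked G F x₀ γ ξ t a

/-- `ξ i s` is the sample that worker `i` draws at time `s`: all samples are independent, and
those of worker `i` have law `D i`. -/
def IsSampling {V : Type*} {Ω : Type*} [MeasurableSpace Ω] (P : Measure Ω)
    {Ξ : V → Type*} [∀ i, MeasurableSpace (Ξ i)] (D : ∀ i, Measure (Ξ i))
    (ξ : ∀ i, ℤ → Ω → Ξ i) : Prop :=
  (∀ i s, Measurable (ξ i s)) ∧ (∀ i s, P.map (ξ i s) = D i) ∧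
    iIndepFun (fun (q : V × ℤ) => ξ q.1 q.2) P

/-- The mass `n π₀` that `π` gives to the `n` entries of delay `0` (each of which is `π₀`). -/
def headMass {V : Type*} [Fintype V] {G : SimpleGraph V} (π : Idx G → ℝ) : ℝ :=
  ∑ i, π (0, i)

/-- The weights `w_t = (1 - μγnπ₀/2)^{-(t+1)}`. -/
def weight {V : Type*} [Fintype V] {G : SimpleGraph V} (π : Idx G → ℝ) (μ γ : ℝ) (t : ℕ) : ℝ :=
  ((1 - μ * γ * headMass π / 2) ^ (t + 1))⁻¹

end RelaySGD

end

/-! Stacking the delayed models turns RelaySGD into a linear recursion Y ↦ WY - γ·(arrivals). The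
arrivals sit in the rows of delay 0, and each of them averages one stochastic gradient from every
worker. The proof follows the π-average x̄, a virtual iterate z close to it, and the consensus
distance ψ, the sum of the squared distances of the rows of Y from x̄.

The average: since πᵀW = πᵀ and π is constant on delay 0, x̄ performs gradient descent with
effective step η = γnπ₀, the gradients being taken at delayed local models (`wmean_succ`). Delayed
noise is correlated with the models it meets on arrival. Therefore z is credited with the noise of
time t at time t, while the exact gradients stay delayed (`NoisyRelay.virtIter_succ`). That noise is
orthogonal to z and to all current models, which yields the variance σ²/n. The difference x̄ - z
consists of two windows of mutually orthogonal noise and has second moment of order η²τ_max σ²/n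
(`NoisyRelay.integral_norm_sq_avgIter_sub_virtIter_le`).

The consensus: a maximum principle shows that all eigenvalues of W - 1πᵀ lie inside the unit disc
(`norm_eigenvalue_lt_one`), and Gelfand's formula then produces m (`exists_mixingTime`). Over m
steps ψ contracts by 1 - p up to the arrivals (`consensus_add_le`), because powers of W expand sums
of squares by at most τ_max + 1. An arrival equals ∇f(x̄) up to a Lipschitz error controlled by ψ
and up to noise: the workers' gradients are averaged before they enter, so no heterogeneity appears
(`sum_norm_sq_arrive_le`). Summation bounds Σ wψ by a multiple of nQ Σ w(E‖∇f(x̄)‖² + σ²), with Q of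
order γ²(τ_max+1)/ρ² (`NoisyRelay.weighted_consensus_le`). As nπ₀ ≥ 1/(τ_max+1), Q is at most of
order η²C²; this is where the exponent 3/2 in C comes from.

Conclusion: the one-step inequalities for z (`convex_step`, `smooth_step`) lose only multiples of
ψ/n and ‖x̄ - z‖². When ηLC is small, the gradient part of the summed consensus is absorbed by the
descent (`NoisyRelay.convex_sum_le`, `NoisyRelay.smooth_sum_le`). Taking 1/η proportional to
`invStep` makes every noise term a small fraction of ε, and the lower bound on T beats the initial
error. Losses that are smooth only for almost every sample are first replaced by regular ones
(`exists_isRegular`) with almost surely the same iterates. -/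

noncomputable section

namespace RelaySGD

/-! ### The mixing matrix acting on vector-valued families -/

/-- The product of a real matrix with a column of vectors. -/
def act {ι E : Type*} [Fintype ι] [AddCommGroup E] [Module ℝ E] (M : Matrix ι ι ℝ) (Y : ι → E) :
    ι → E := fun a => ∑ b, M a b • Y b

section Act

variable {ι E : Type*} [Fintype ι] [AddCommGroup E] [Module ℝ E]

theorem act_sub (M : Matrix ι ι ℝ) (Y Z : ι → E) : act M (Y - Z) = act M Y - act M Z := by
  ext a; simp [act, smul_sub, Finset.sum_sub_distrib]

theorem act_smul (M : Matrix ι ι ℝ) (c : ℝ) (Y : ι → E) : act M (c • Y) = c • act M Y := by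
  ext a; simp [act, Finset.smul_sum, smul_comm c]

theorem act_sum {κ : Type*} (M : Matrix ι ι ℝ) (s : Finset κ) (Y : κ → ι → E) :
    act M (∑ k ∈ s, Y k) = ∑ k ∈ s, act M (Y k) := by
  ext a
  simp only [act, Finset.sum_apply, Finset.smul_sum]
  exact Finset.sum_comm

theorem sub_act (M N : Matrix ι ι ℝ) (Y : ι → E) : act (M - N) Y = act M Y - act N Y := by
  ext a; simp [act, sub_smul, Finset.sum_sub_distrib]

theorem act_mul (M N : Matrix ι ι ℝ) (Y : ι → E) : act (M * N) Y = act M (act N Y) := by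
  ext a
  simp only [act, Matrix.mul_apply, Finset.sum_smul, Finset.smul_sum, mul_smul]
  exact Finset.sum_comm

theorem act_one [DecidableEq ι] (Y : ι → E) : act 1 Y = Y := by
  ext a; simp [act, Matrix.one_apply]

theorem act_onesPi (π : ι → ℝ) (Y : ι → E) (a : ι) : act (onesPi π) Y a = ∑ b, π b • Y b := by
  simp [act, onesPi, Matrix.vecMulVec_apply]

end Act

/-! ### Rows of the mixing matrix and its powers -/

section Graph

variable {V : Type*} [Fintype V] [DecidableEq V] {G : SimpleGraph V}

omit [DecidableEq V] in
theorem dist_le_diam (hG : G.Connected) (i j : V) : G.dist i j ≤ G.diam := by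
  have := hG.nonempty
  exact SimpleGraph.dist_le_diam (SimpleGraph.connected_iff_ediam_ne_top.mp hG)

/-- The entry `(d(i,j), j)` from which worker `i` collects the model of worker `j`. -/
def src (hG : G.Connected) (i j : V) : Idx G :=
  (⟨G.dist i j, Nat.lt_succ_of_le (dist_le_diam hG i j)⟩, j)

variable {E : Type*} [AddCommGroup E] [Module ℝ E]

theorem act_mixing_zero (hG : G.Connected) (Y : Idx G → E) (i : V) :
    act (mixingMatrix G) Y (0, i) = (1 / (Fintype.card V : ℝ)) • ∑ j, Y (src hG i j) := by
  simp only [act, Fintype.sum_prod_type_right, Finset.smul_sum]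
  refine Finset.sum_congr rfl fun j _ => ?_
  rw [Finset.sum_eq_single (src hG i j).1]
  · simp [mixingMatrix, src]
  · intro τ _ hτ
    have : ¬ ((τ : ℕ) = G.dist i j) := fun h => hτ (Fin.ext h)
    simp [mixingMatrix, this]
  · simp

theorem act_mixing_succ (Y : Idx G → E) (τ : Fin G.diam) (i : V) :
    act (mixingMatrix G) Y (τ.succ, i) = Y (τ.castSucc, i) := by
  simp only [act]
  rw [Finset.sum_eq_single (τ.castSucc, i)]
  · simp [mixingMatrix]
  · rintro ⟨σ, j⟩ _ h
    have : ¬ (i = j ∧ (τ : ℕ) + 1 = (σ : ℕ) + 1) := by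
      rintro ⟨rfl, h'⟩
      exact h (Prod.ext (Fin.ext (by simpa using h'.symm)) rfl)
    have h2 : mixingMatrix G (τ.succ, i) (σ, j) = 0 := by
      simp only [mixingMatrix, Fin.val_succ]
      rw [if_neg (by simp), if_neg this]
    rw [h2, zero_smul]
  · simp

theorem mixing_nonneg (a b : Idx G) : 0 ≤ mixingMatrix G a b := by
  unfold mixingMatrix; split_ifs <;> positivity

theorem mixing_pow_nonneg (k : ℕ) (a b : Idx G) : 0 ≤ (mixingMatrix G ^ k) a b := by
  induction k generalizing a b with
  | zero => rw [pow_zero, Matrix.one_apply]; split_ifs <;> norm_num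
  | succ k ih =>
    rw [pow_succ, Matrix.mul_apply]
    exact Finset.sum_nonneg fun c _ => mul_nonneg (ih a c) (mixing_nonneg c b)

theorem act_mixing_const (hG : G.Connected) (x : E) :
    act (mixingMatrix G) (fun _ => x) = fun _ => x := by
  have := hG.nonempty
  ext ⟨τ, i⟩
  refine Fin.cases ?_ (fun τ => ?_) τ
  · rw [act_mixing_zero hG]
    simp [← Nat.cast_smul_eq_nsmul ℝ, smul_smul]
  · rw [act_mixing_succ]

theorem act_mixing_pow_const (hG : G.Connected) (k : ℕ) (x : E) :
    act (mixingMatrix G ^ k) (fun _ => x) = fun _ => x := by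
  induction k with
  | zero => rw [pow_zero, act_one]
  | succ k ih => rw [pow_succ, act_mul, act_mixing_const hG, ih]

theorem mixing_pow_row_sum (hG : G.Connected) (k : ℕ) (a : Idx G) :
    ∑ b, (mixingMatrix G ^ k) a b = 1 := by
  simpa [act] using congrFun (act_mixing_pow_const hG k (1 : ℝ)) a

/-! ### The stationary vector -/

/-- The number of workers at distance at least `τ` from `j`. -/
def farCount (G : SimpleGraph V) (τ : ℕ) (j : V) : ℝ := ∑ i, if τ ≤ G.dist i j then (1 : ℝ) else 0

/-- Column (τ, j) of W is read by the workers at distance τ from j, in their rows of delay 0, and by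
the shift row (τ+1, j), which does not exist for the largest delay. -/
theorem vecMul_mixing (π : Idx G → ℝ) (τ : Fin (G.diam + 1)) (j : V) :
    Matrix.vecMul π (mixingMatrix G) (τ, j)
      = (1 / (Fintype.card V : ℝ)) * (∑ i, if (τ : ℕ) = G.dist i j then π (0, i) else 0)
        + if h : (τ : ℕ) + 1 < G.diam + 1 then π (⟨τ + 1, h⟩, j) else 0 := by
  have h0 : Matrix.vecMul π (mixingMatrix G) (τ, j) = ∑ a, π a * mixingMatrix G a (τ, j) := rfl
  rw [h0, Fintype.sum_prod_type, Fin.sum_univ_succ]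
  congr 1
  · rw [Finset.mul_sum]
    refine Finset.sum_congr rfl fun i _ => ?_
    by_cases h : (τ : ℕ) = G.dist i j <;> simp [mixingMatrix, h]; ring
  · split_ifs with h
    · rw [Finset.sum_eq_single ⟨τ, Nat.lt_of_succ_lt_succ h⟩, Finset.sum_eq_single j]
      · have : mixingMatrix G (Fin.succ ⟨τ, Nat.lt_of_succ_lt_succ h⟩, j) (τ, j) = 1 := by
          simp [mixingMatrix]
        rw [this, mul_one]; rfl
      · intro i _ hi
        simp [mixingMatrix, hi]
      · simp
      · intro σ _ hσ
        refine Finset.sum_eq_zero fun i _ => ?_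
        have : (σ : ℕ) ≠ τ := fun h => hσ (Fin.ext h)
        simp [mixingMatrix, this]
      · simp
    · refine Finset.sum_eq_zero fun σ _ => Finset.sum_eq_zero fun i _ => ?_
      have : (σ : ℕ) ≠ τ := by have := σ.2; omega
      simp [mixingMatrix, this]

omit [DecidableEq V] in
theorem farCount_rec (τ : ℕ) (j : V) :
    farCount G τ j = (∑ i, if τ = G.dist i j then (1 : ℝ) else 0) + farCount G (τ + 1) j := by
  unfold farCount
  rw [← Finset.sum_add_distrib]
  refine Finset.sum_congr rfl fun i _ => ?_
  rcases lt_trichotomy τ (G.dist i j) with h | h | h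
  · simp [h.le, h.ne, Nat.succ_le_of_lt h]
  · simp [h]
  · simp [h.ne', not_le.mpr h, show ¬ (τ + 1 ≤ G.dist i j) by omega]

omit [DecidableEq V] in
theorem farCount_eq_zero (hG : G.Connected) {τ : ℕ} (h : G.diam < τ) (j : V) :
    farCount G τ j = 0 := by
  refine Finset.sum_eq_zero fun i _ => if_neg ?_
  have := dist_le_diam hG i j
  omega

omit [DecidableEq V] in
theorem farCount_zero (j : V) : farCount G 0 j = Fintype.card V := by simp [farCount]

omit [DecidableEq V] in
theorem farCount_nonneg (τ : ℕ) (j : V) : 0 ≤ farCount G τ j :=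
  Finset.sum_nonneg fun _ _ => by split_ifs <;> norm_num

omit [DecidableEq V] in
theorem farCount_le (τ : ℕ) (j : V) : farCount G τ j ≤ Fintype.card V := by
  rw [← farCount_zero (G := G) j]
  refine Finset.sum_le_sum fun _ _ => ?_
  split_ifs <;> simp_all

/-- Stationarity expresses π(τ, j) through π(τ+1, j) and the delay-0 entries at distance τ from j.
Solving from the largest delay downwards collects the delay-0 entries at distance at least τ. For τ
= 0 this condition is vacuous, so all delay-0 entries agree, and the remaining sum merely counts
workers. -/
theorem stationary_apply (hG : G.Connected) {π : Idx G → ℝ}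
    (hπ : Matrix.vecMul π (mixingMatrix G) = π) (τ : Fin (G.diam + 1)) (j : V) :
    π (τ, j) = headMass π / (Fintype.card V : ℝ) ^ 2 * farCount G τ j := by
  have := hG.nonempty
  have hn : (Fintype.card V : ℝ) ≠ 0 := by positivity
  have key : ∀ k : ℕ, ∀ τ : Fin (G.diam + 1), G.diam - (τ : ℕ) = k → ∀ j,
      π (τ, j) = (1 / (Fintype.card V : ℝ)) * ∑ i, if (τ : ℕ) ≤ G.dist i j then π (0, i) else 0 := by
    intro k
    induction k with
    | zero =>
      intro τ hτ j
      rw [← congrFun hπ, vecMul_mixing, dif_neg (by omega), add_zero]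
      congr 1
      refine Finset.sum_congr rfl fun i _ => ?_
      have := dist_le_diam hG i j
      have := τ.2
      exact if_congr (by omega) rfl rfl
    | succ k ih =>
      intro τ hτ j
      rw [← congrFun hπ, vecMul_mixing, dif_pos (by omega), ih ⟨τ + 1, by omega⟩ (by simp; omega),
        ← mul_add, ← Finset.sum_add_distrib]
      congr 1
      refine Finset.sum_congr rfl fun i _ => ?_
      rcases lt_trichotomy (τ : ℕ) (G.dist i j) with h | h | h
      · simp [h.le, h.ne, Nat.succ_le_of_lt h]
      · simp [h]
      · simp [h.ne', not_le.mpr h, show ¬ ((τ : ℕ) + 1 ≤ G.dist i j) by omega]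
  have h0 : ∀ i, π (0, i) = (1 / (Fintype.card V : ℝ)) * headMass π := fun i => by
    rw [key _ 0 rfl i]; simp [headMass]
  rw [key _ τ rfl j, farCount, Finset.mul_sum, Finset.mul_sum]
  refine Finset.sum_congr rfl fun i _ => ?_
  rw [h0 i]
  split_ifs
  · field_simp
  · simp

omit [DecidableEq V] in
theorem sum_farCount_pos (hG : G.Connected) : 0 < ∑ a : Idx G, farCount G a.1 a.2 := by
  obtain ⟨i⟩ := hG.nonempty
  refine Finset.sum_pos' (fun a _ => farCount_nonneg _ _) ⟨(0, i), Finset.mem_univ _, ?_⟩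
  have : Nonempty V := ⟨i⟩
  simp only [Fin.val_zero, farCount_zero]
  positivity

/-- By `stationary_apply` one scalar is left free, and the normalisation fixes it. Conversely
`farCount` solves the stationarity equations by `farCount_rec`. -/
theorem existsUnique_stationary (hG : G.Connected) :
    ∃! π : Idx G → ℝ, IsStationary (mixingMatrix G) π := by
  have := hG.nonempty
  have hn : (Fintype.card V : ℝ) ≠ 0 := by positivity
  set S := ∑ a : Idx G, farCount G a.1 a.2 with hS
  have hSpos : 0 < S := sum_farCount_pos hG
  refine ⟨fun a => farCount G a.1 a.2 / S, ⟨?_, ?_⟩, ?_⟩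
  · ext ⟨τ, j⟩
    rw [vecMul_mixing]
    simp only [Fin.val_zero, farCount_zero]
    rw [farCount_rec (τ : ℕ) j, add_div]
    congr 1
    · rw [Finset.mul_sum, Finset.sum_div]
      refine Finset.sum_congr rfl fun i _ => ?_
      split_ifs
      · field_simp
      · simp
    · split_ifs with h
      · rfl
      · rw [farCount_eq_zero hG (by omega)]; simp
  · rw [← Finset.sum_div]
    exact div_self hSpos.ne'
  · rintro π ⟨h1, h2⟩
    have h3 := stationary_apply hG h1
    have h4 : headMass π / (Fintype.card V : ℝ) ^ 2 * S = 1 := by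
      rw [← h2, hS, Finset.mul_sum]
      exact Finset.sum_congr rfl fun a _ => (h3 a.1 a.2).symm
    ext ⟨τ, j⟩
    rw [h3 τ j, eq_div_iff hSpos.ne', mul_right_comm, h4, one_mul]

section Stationary

variable {π : Idx G → ℝ} (hG : G.Connected) (hπ : IsStationary (mixingMatrix G) π)
include hG hπ

theorem headMass_mul_sum :
    headMass π / (Fintype.card V : ℝ) ^ 2 * ∑ a : Idx G, farCount G a.1 a.2 = 1 := by
  rw [← hπ.2, Finset.mul_sum]
  exact Finset.sum_congr rfl fun a _ => (stationary_apply hG hπ.1 a.1 a.2).symm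

theorem headMass_pos : 0 < headMass π := by
  have := hG.nonempty
  have h := headMass_mul_sum hG hπ
  have h2 := sum_farCount_pos hG
  by_contra hc
  have : headMass π / (Fintype.card V : ℝ) ^ 2 ≤ 0 :=
    div_nonpos_of_nonpos_of_nonneg (not_lt.mp hc) (by positivity)
  nlinarith

theorem stationary_nonneg (a : Idx G) : 0 ≤ π a := by
  rw [stationary_apply hG hπ.1 a.1 a.2]
  have := headMass_pos hG hπ
  have := farCount_nonneg (G := G) a.1 a.2
  positivity

theorem stationary_zero (i : V) : π (0, i) = headMass π / Fintype.card V := by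
  have := hG.nonempty
  rw [stationary_apply hG hπ.1]
  simp only [Fin.val_zero, farCount_zero]
  field_simp

theorem stationary_le (a : Idx G) : π a ≤ headMass π / Fintype.card V := by
  have := hG.nonempty
  have h1 := headMass_pos hG hπ
  rw [stationary_apply hG hπ.1 a.1 a.2]
  calc _ ≤ headMass π / (Fintype.card V : ℝ) ^ 2 * Fintype.card V := by
        gcongr; exact farCount_le _ _
    _ = _ := by field_simp

theorem headMass_le_one : headMass π ≤ 1 := by
  rw [← hπ.2, Fintype.sum_prod_type]
  exact Finset.single_le_sum (f := fun τ => ∑ j, π (τ, j))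
    (fun τ _ => Finset.sum_nonneg fun j _ => stationary_nonneg hG hπ (τ, j)) (Finset.mem_univ 0)

/-- None of the n(τ_max+1) entries of π exceeds π₀, and they add up to 1. This allows γ to be
bounded by (τ_max+1) times the effective step γnπ₀. -/
theorem one_le_headMass_mul : 1 ≤ headMass π * ((G.diam : ℝ) + 1) := by
  have := hG.nonempty
  calc (1 : ℝ) = ∑ a, π a := hπ.2.symm
    _ ≤ ∑ _a : Idx G, headMass π / Fintype.card V :=
        Finset.sum_le_sum fun a _ => stationary_le hG hπ a
    _ = _ := by
        simp [Fintype.card_prod]; field_simp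

theorem sum_stationary_act {E : Type*} [AddCommGroup E] [Module ℝ E] (Y : Idx G → E) :
    ∑ a, π a • act (mixingMatrix G) Y a = ∑ a, π a • Y a := by
  simp only [act, Finset.smul_sum, smul_smul]
  rw [Finset.sum_comm]
  refine Finset.sum_congr rfl fun b _ => ?_
  rw [← Finset.sum_smul]
  congr 1
  exact congrFun hπ.1 b

theorem sum_stationary_act_pow {E : Type*} [AddCommGroup E] [Module ℝ E] (k : ℕ) (Y : Idx G → E) :
    ∑ a, π a • act (mixingMatrix G ^ k) Y a = ∑ a, π a • Y a := by
  induction k generalizing Y with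
  | zero => rw [pow_zero, act_one]
  | succ k ih => rw [pow_succ, act_mul, ih, sum_stationary_act hG hπ]

/-- Powers of the mixing matrix increase the sum of a nonnegative vector at most by `τ_max + 1`. -/
theorem sum_act_pow_le (k : ℕ) {h : Idx G → ℝ} (hh : ∀ a, 0 ≤ h a) :
    ∑ a, act (mixingMatrix G ^ k) h a ≤ ((G.diam : ℝ) + 1) * ∑ a, h a := by
  have := hG.nonempty
  have hn : (0 : ℝ) < Fintype.card V := by positivity
  have hM := headMass_pos hG hπ
  have hact : ∀ k a, 0 ≤ act (mixingMatrix G ^ k) h a := fun k a =>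
    Finset.sum_nonneg fun b _ => smul_nonneg (mixing_pow_nonneg k a b) (hh b)
  -- On delay 0 the vector π is constant and takes its maximum, so invariance of the π-weighted sum
  -- controls the unweighted sum over delay 0.
  have zero : ∀ k, ∑ i, act (mixingMatrix G ^ k) h (0, i) ≤ ∑ a, h a := by
    intro k
    have h1 : headMass π / Fintype.card V * ∑ i, act (mixingMatrix G ^ k) h (0, i)
        ≤ headMass π / Fintype.card V * ∑ a, h a := by
      calc _ = ∑ i, π (0, i) • act (mixingMatrix G ^ k) h (0, i) := by
            rw [Finset.mul_sum]
            exact Finset.sum_congr rfl fun i _ => by rw [stationary_zero hG hπ, smul_eq_mul]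
        _ ≤ ∑ a, π a • act (mixingMatrix G ^ k) h a := by
            rw [Fintype.sum_prod_type]
            exact Finset.single_le_sum (f := fun τ => ∑ j, π (τ, j) • act (mixingMatrix G ^ k) h (τ, j))
              (fun τ _ => Finset.sum_nonneg fun j _ =>
                smul_nonneg (stationary_nonneg hG hπ (τ, j)) (hact k _)) (Finset.mem_univ 0)
        _ = ∑ a, π a • h a := sum_stationary_act_pow hG hπ k h
        _ ≤ _ := by
            rw [Finset.mul_sum]
            exact Finset.sum_le_sum fun a _ =>
              mul_le_mul_of_nonneg_right (stationary_le hG hπ a) (hh a)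
    exact le_of_mul_le_mul_left h1 (by positivity)
  -- The rows of a positive delay are rows of the preceding delay one step earlier, so every delay
  -- inherits the bound, and there are τ_max + 1 delays.
  have main : ∀ k, ∀ τ : Fin (G.diam + 1),
      ∑ i, act (mixingMatrix G ^ k) h (τ, i) ≤ ∑ a, h a := by
    intro k
    induction k with
    | zero =>
      intro τ
      rw [pow_zero, act_one, Fintype.sum_prod_type]
      exact Finset.single_le_sum (f := fun τ => ∑ j, h (τ, j))
        (fun τ _ => Finset.sum_nonneg fun j _ => hh _) (Finset.mem_univ τ)
    | succ k ih =>
      intro τ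
      refine Fin.cases (zero _) (fun τ => ?_) τ
      rw [pow_succ', act_mul]
      simp only [act_mixing_succ]
      exact ih _
  rw [Fintype.sum_prod_type]
  calc _ ≤ ∑ _τ : Fin (G.diam + 1), ∑ a, h a := Finset.sum_le_sum fun τ _ => main k τ
    _ = _ := by simp

end Stationary

end Graph

/-! ### The spectrum of the mixing matrix -/

theorem multiset_sup_lt {s : Multiset ℝ≥0} {c : ℝ≥0} (hc : 0 < c) (h : ∀ x ∈ s, x < c) :
    s.sup < c := by
  induction s using Multiset.induction with
  | empty => simpa using hc
  | cons a s ih =>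
    rw [Multiset.sup_cons, sup_lt_iff]
    exact ⟨h a (by simp), ih fun x hx => h x (by simp [hx])⟩

section Charpoly

variable {ι K : Type*} [Fintype ι] [DecidableEq ι] [Field K]

theorem det_one_add_smul_vecMulVec {R : Type*} [CommRing R] (c : R) (u : ι → R)
    (hu : ∑ k, u k = 1) :
    (1 + c • Matrix.vecMulVec (fun _ => (1 : R)) u).det = 1 + c := by
  have h := Matrix.det_one_add_replicateCol_mul_replicateRow (ι := Unit) (fun _ : ι => c) u
  have h2 : Matrix.replicateCol Unit (fun _ : ι => c) * Matrix.replicateRow Unit u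
      = c • Matrix.vecMulVec (fun _ => (1 : R)) u := by
    ext i j; simp [Matrix.mul_apply, Matrix.vecMulVec_apply]
  rw [← h2, h]
  simp [dotProduct, ← Finset.sum_mul, hu]

/-- Deflation of the leading eigenvalue `1` of a matrix with unit row sums. -/
theorem charpoly_mul_X (W : Matrix ι ι K) (u : ι → K) (hW : ∀ a, ∑ b, W a b = 1)
    (hu : ∑ k, u k = 1) :
    W.charpoly * Polynomial.X
      = (W - Matrix.vecMulVec (fun _ => 1) u).charpoly * (Polynomial.X - Polynomial.C 1) := by
  set A := W.charmatrix with hA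
  set u' : ι → Polynomial K := fun k => Polynomial.C (u k)
  set Q : Matrix ι ι (Polynomial K) := Matrix.vecMulVec (fun _ => 1) u' with hQ
  have hu' : ∑ k, u' k = 1 := by
    simp only [u', ← map_sum, hu, map_one]
  have hQQ : Q * Q = Q := by
    ext a b
    simp [Q, Matrix.mul_apply, Matrix.vecMulVec_apply, ← Finset.sum_mul, hu']
  have hAQ : A * Q = (Polynomial.X - 1 : Polynomial K) • Q := by
    ext1 a b
    have : ∑ c, A a c = Polynomial.X - 1 := by
      simp only [hA, Matrix.charmatrix_apply, Finset.sum_sub_distrib, Matrix.diagonal_apply,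
        Finset.sum_ite_eq, Finset.mem_univ, if_true, ← map_sum, hW, map_one]
    simp [Q, Matrix.mul_apply, Matrix.vecMulVec_apply, ← Finset.sum_mul, this]
  have hB : (W - Matrix.vecMulVec (fun _ => 1) u).charmatrix = A + Q := by
    ext1 a b
    simp [hA, Q, u', Matrix.charmatrix_apply, Matrix.vecMulVec_apply]
    ring
  -- Because AQ = (X-1)Q and Q² = Q, both products equal A + (X-1)²Q. The two auxiliary factors have
  -- determinants X - 1 and X.
  have hmul : (A + Q) * (1 + (Polynomial.X - 2 : Polynomial K) • Q)
      = A * (1 + (Polynomial.X - 1 : Polynomial K) • Q) := by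
    simp only [mul_add, add_mul, mul_one, Matrix.mul_smul, hQQ, hAQ]
    module
  have hdet := congrArg Matrix.det hmul
  rw [Matrix.det_mul, Matrix.det_mul, det_one_add_smul_vecMulVec _ _ hu',
    det_one_add_smul_vecMulVec _ _ hu', ← hB] at hdet
  simp only [Matrix.charpoly, map_one]
  rw [← hA]
  linear_combination -hdet

/-- Deflation trades exactly one root 1 for a root 0, algebraic multiplicities included. This
identifies `lambdaTwo` with the largest eigenvalue modulus of the deflated matrix. -/
theorem roots_deflate (W : Matrix ι ι K) (u : ι → K) (hW : ∀ a, ∑ b, W a b = 1)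
    (hu : ∑ k, u k = 1) [DecidableEq K] :
    (W - Matrix.vecMulVec (fun _ => 1) u).charpoly.roots = W.charpoly.roots.erase 1 + {0} := by
  have h := congrArg Polynomial.roots (charpoly_mul_X W u hW hu)
  rw [Polynomial.roots_mul (mul_ne_zero (Matrix.charpoly_monic _).ne_zero Polynomial.X_ne_zero),
    Polynomial.roots_mul (mul_ne_zero (Matrix.charpoly_monic _).ne_zero
      (Polynomial.X_sub_C_ne_zero _)), Polynomial.roots_X, Polynomial.roots_X_sub_C] at h
  have h1 : (1 : K) ∈ W.charpoly.roots := by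
    have : (1 : K) ∈ W.charpoly.roots + {0} := by rw [h]; simp
    simpa using this
  have h2 := congrArg (fun s => Multiset.erase s 1) h
  simp only [Multiset.erase_add_left_pos _ h1] at h2
  rw [h2, Multiset.erase_add_right_pos _ (by simp)]
  simp

end Charpoly

/-- Equality case of the triangle inequality: as the mean of the y_j is u, expanding the squares
gives ∑‖y_j - u‖² = ∑(‖y_j‖² - ‖u‖²) ≤ 0. -/
theorem eq_of_norm_le_of_sum_eq {ι E : Type*} [Fintype ι] [NormedAddCommGroup E]
    [InnerProductSpace ℝ E] {y : ι → E} {u : E} (hy : ∀ j, ‖y j‖ ≤ ‖u‖)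
    (hs : ∑ j, y j = (Fintype.card ι : ℝ) • u) (j : ι) : y j = u := by
  have h : ∑ j, ‖y j - u‖ ^ 2 ≤ 0 := by
    have : ∑ j, ‖y j - u‖ ^ 2 = ∑ j, (‖y j‖ ^ 2 - ‖u‖ ^ 2) := by
      simp only [norm_sub_sq_real, Finset.sum_add_distrib, Finset.sum_sub_distrib,
        ← Finset.mul_sum, ← sum_inner, hs, inner_smul_left, real_inner_self_eq_norm_sq]
      simp
      ring
    rw [this]
    refine Finset.sum_nonpos fun j _ => ?_
    have := hy j
    have := norm_nonneg (y j)
    nlinarith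
  have h2 := (Finset.sum_eq_zero_iff_of_nonneg (fun j _ => sq_nonneg ‖y j - u‖)).1
    (le_antisymm h (Finset.sum_nonneg fun _ _ => sq_nonneg _)) j (Finset.mem_univ j)
  exact sub_eq_zero.1 (norm_eq_zero.1 (pow_eq_zero_iff (two_ne_zero)|>.1 h2))

/-! ### The spectral gap and the existence of a mixing time -/

section Graph

variable {V : Type*} [Fintype V] [DecidableEq V] {G : SimpleGraph V}
  {π : Idx G → ℝ} (hG : G.Connected) (hπ : IsStationary (mixingMatrix G) π)
include hG hπ

/-- Maximum principle. If |z| ≥ 1, then πᵀv = 0 and v is an eigenvector of W itself. The shift rows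
make |v| largest at delay 0. At a worker i₀ attaining the maximum, z·v(0, i₀) is a mean of entries
of no larger modulus, hence equals all of them. One of these entries is v(0, i₀), so z = 1. Then v
is constant along delays and across workers, and πᵀv = 0 forces v = 0. -/
theorem norm_eigenvalue_lt_one {z : ℂ} {v : Idx G → ℂ} (hv : v ≠ 0)
    (h : act (mixingMatrix G - onesPi π) v = z • v) : ‖z‖ < 1 := by
  by_contra hz
  rw [not_lt] at hz
  have hz0 : z ≠ 0 := by rintro rfl; norm_num at hz
  have hπv : ∑ a, π a • v a = 0 := by
    have h1 : ∑ a, π a • act (mixingMatrix G - onesPi π) v a = 0 := by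
      rw [sub_act]
      simp only [Pi.sub_apply, smul_sub, Finset.sum_sub_distrib, sum_stationary_act hG hπ,
        act_onesPi, ← Finset.sum_smul, hπ.2, one_smul, sub_self]
    rw [h] at h1
    have h2 : z * ∑ a, π a • v a = 0 := by
      rw [← h1, Finset.mul_sum]
      exact Finset.sum_congr rfl fun a _ => by simp [mul_left_comm]
    exact (mul_eq_zero.1 h2).resolve_left hz0
  have hW : act (mixingMatrix G) v = z • v := by
    rw [← h, sub_act]
    ext a
    rw [Pi.sub_apply, act_onesPi, hπv, sub_zero]
  have hsucc : ∀ (τ : Fin G.diam) i, v (τ.castSucc, i) = z * v (τ.succ, i) := fun τ i => by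
    rw [← act_mixing_succ v, hW]; rfl
  have hnonempty := hG.nonempty
  have hle0 : ∀ τ i, ‖v (τ, i)‖ ≤ ‖v (0, i)‖ := by
    intro τ i
    induction τ using Fin.induction with
    | zero => exact le_rfl
    | succ τ ih =>
      rw [hsucc, norm_mul] at ih
      have := norm_nonneg (v (τ.succ, i))
      nlinarith
  obtain ⟨i₀, hi₀⟩ := Finite.exists_max fun i => ‖v (0, i)‖
  have hmax : ∀ a, ‖v a‖ ≤ ‖v (0, i₀)‖ := fun a => (hle0 a.1 a.2).trans (hi₀ a.2)
  have hne : v (0, i₀) ≠ 0 := by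
    intro h0
    refine hv (funext fun a => ?_)
    have := hmax a
    rw [h0, norm_zero] at this
    exact norm_le_zero_iff.1 this
  have hall : ∀ j, v (src hG i₀ j) = z * v (0, i₀) := by
    refine eq_of_norm_le_of_sum_eq (fun j => ?_) ?_
    · rw [norm_mul]
      have := hmax (src hG i₀ j)
      have := norm_nonneg (v (0, i₀))
      nlinarith
    · have h1 : act (mixingMatrix G) v (0, i₀) = z * v (0, i₀) := by rw [hW]; rfl
      rw [← h1, act_mixing_zero hG, smul_smul, mul_one_div_cancel (by positivity), one_smul]
  have hz1 : z = 1 := by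
    have h1 := hall i₀
    have h2 : src hG i₀ i₀ = (0, i₀) := by simp [src]
    rw [h2] at h1
    exact (mul_right_cancel₀ hne (by rw [one_mul]; exact h1)).symm
  have hcol : ∀ τ i, v (τ, i) = v (0, i) := by
    intro τ i
    induction τ using Fin.induction with
    | zero => rfl
    | succ τ ih => rw [← ih, hsucc, hz1, one_mul]
  have hconst : ∀ a, v a = v (0, i₀) := by
    intro a
    have h1 := hall a.2
    rw [hz1, one_mul] at h1
    rw [← h1]
    exact (hcol a.1 a.2).trans (hcol _ a.2).symm
  rw [Finset.sum_congr rfl fun a _ => by rw [hconst a], ← Finset.sum_smul, hπ.2, one_smul] at hπv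
  exact hne hπv

/-- The deflated mixing matrix over `ℂ`. -/
theorem map_sub_onesPi :
    (mixingMatrix G - onesPi π).map (algebraMap ℝ ℂ)
      = (mixingMatrix G).map (algebraMap ℝ ℂ)
        - Matrix.vecMulVec (fun _ => 1) (fun k => algebraMap ℝ ℂ (π k)) := by
  ext a b
  simp [onesPi, Matrix.vecMulVec_apply]

theorem roots_deflated_mixing :
    ((mixingMatrix G - onesPi π).map (algebraMap ℝ ℂ)).charpoly.roots
      = ((mixingMatrix G).map (algebraMap ℝ ℂ)).charpoly.roots.erase 1 + {0} := by
  rw [map_sub_onesPi hG hπ]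
  refine roots_deflate _ _ (fun a => ?_) ?_
  · have := mixing_pow_row_sum hG 1 a
    rw [pow_one] at this
    simp only [Matrix.map_apply, ← map_sum, this, map_one]
  · rw [← map_sum, hπ.2, map_one]

theorem norm_root_lt_one {z : ℂ}
    (hz : z ∈ ((mixingMatrix G - onesPi π).map (algebraMap ℝ ℂ)).charpoly.roots) : ‖z‖ < 1 := by
  rw [Polynomial.mem_roots (Matrix.charpoly_monic _).ne_zero, Polynomial.IsRoot,
    Matrix.eval_charpoly, ← Matrix.exists_mulVec_eq_zero_iff] at hz
  obtain ⟨v, hv, h⟩ := hz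
  refine norm_eigenvalue_lt_one hG hπ hv ?_
  rw [Matrix.sub_mulVec, sub_eq_zero] at h
  ext1 a
  have h1 := congrFun h a
  simp only [Matrix.scalar_apply, Matrix.mulVec_diagonal] at h1
  rw [Pi.smul_apply, smul_eq_mul, h1]
  simp [act, Matrix.mulVec, dotProduct]

theorem lambdaTwo_lt_one : lambdaTwo (mixingMatrix G) < 1 := by
  refine multiset_sup_lt zero_lt_one fun r hr => ?_
  obtain ⟨z, hz, rfl⟩ := Multiset.mem_map.1 hr
  have : ‖z‖ < 1 := norm_root_lt_one hG hπ (by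
    rw [roots_deflated_mixing hG hπ]; exact Multiset.mem_add.2 (Or.inl hz))
  exact_mod_cast this

theorem gap_pos : 0 < gap (mixingMatrix G) := by
  have h : (lambdaTwo (mixingMatrix G) : ℝ) < 1 := by exact_mod_cast lambdaTwo_lt_one hG hπ
  unfold gap
  linarith

theorem nnnorm_root_le {z : ℂ}
    (hz : z ∈ ((mixingMatrix G - onesPi π).map (algebraMap ℝ ℂ)).charpoly.roots) :
    ‖z‖₊ ≤ lambdaTwo (mixingMatrix G) := by
  rw [roots_deflated_mixing hG hπ, Multiset.mem_add] at hz
  rcases hz with hz | hz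
  · exact Multiset.le_sup (Multiset.mem_map_of_mem _ hz)
  · rw [Multiset.mem_singleton.1 hz]; simp

theorem mixing_mul_onesPi : mixingMatrix G * onesPi π = onesPi π := by
  ext a b
  have := mixing_pow_row_sum hG 1 a
  rw [pow_one] at this
  simp [Matrix.mul_apply, onesPi, Matrix.vecMulVec_apply, ← Finset.sum_mul, this]

theorem mixing_pow_mul_onesPi (k : ℕ) : mixingMatrix G ^ k * onesPi π = onesPi π := by
  induction k with
  | zero => simp
  | succ k ih => rw [pow_succ, mul_assoc, mixing_mul_onesPi hG hπ, ih]

theorem onesPi_mul_mixing : onesPi π * mixingMatrix G = onesPi π := by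
  ext a b
  have := congrFun hπ.1 b
  simpa [Matrix.mul_apply, onesPi, Matrix.vecMulVec_apply, Matrix.vecMul, dotProduct] using this

theorem onesPi_mul_mixing_pow (k : ℕ) : onesPi π * mixingMatrix G ^ k = onesPi π := by
  induction k with
  | zero => simp
  | succ k ih => rw [pow_succ, ← mul_assoc, ih, onesPi_mul_mixing hG hπ]

theorem onesPi_mul_self : onesPi π * onesPi π = onesPi π := by
  ext a b
  simp [Matrix.mul_apply, onesPi, Matrix.vecMulVec_apply, ← Finset.sum_mul, hπ.2]

theorem deflated_pow (k : ℕ) :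
    (mixingMatrix G - onesPi π) ^ (k + 1) = mixingMatrix G ^ (k + 1) - onesPi π := by
  induction k with
  | zero => simp
  | succ k ih =>
    rw [pow_succ, ih, sub_mul, mul_sub, mul_sub, mixing_pow_mul_onesPi hG hπ,
      onesPi_mul_mixing hG hπ, onesPi_mul_self hG hπ, ← pow_succ]
    simp

omit hG hπ [DecidableEq V] in
theorem frobSq_mul_le {ι κ : Type*} [Fintype ι] [Fintype κ] (A : Matrix ι ι ℝ) (X : Matrix ι κ ℝ)
    {c : ℝ} (hA : ∀ a, ∑ b, |A a b| ≤ c) :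
    frobSq (A * X) ≤ Fintype.card ι * c ^ 2 * frobSq X := by
  have h1 : ∀ a k, (A * X) a k ^ 2 ≤ c ^ 2 * ∑ b, X b k ^ 2 := by
    intro a k
    rw [Matrix.mul_apply]
    refine (Finset.sum_mul_sq_le_sq_mul_sq _ _ _).trans ?_
    refine mul_le_mul_of_nonneg_right ?_ (Finset.sum_nonneg fun _ _ => sq_nonneg _)
    calc ∑ b, A a b ^ 2 = ∑ b, |A a b| ^ 2 := by simp
      _ ≤ (∑ b, |A a b|) ^ 2 := Finset.sum_sq_le_sq_sum_of_nonneg fun _ _ => abs_nonneg _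
      _ ≤ c ^ 2 := pow_le_pow_left₀ (Finset.sum_nonneg fun _ _ => abs_nonneg _) (hA a) 2
  unfold frobSq
  calc _ ≤ ∑ _a : ι, ∑ k, c ^ 2 * ∑ b, X b k ^ 2 :=
        Finset.sum_le_sum fun a _ => Finset.sum_le_sum fun k _ => h1 a k
    _ = _ := by
        rw [Finset.sum_const, Finset.card_univ, ← Finset.mul_sum, Finset.sum_comm, nsmul_eq_mul,
          mul_assoc]

/-- Gelfand's formula for the deflated matrix: its spectral radius is at most |λ₂|, strictly below 1
- p = (1+|λ₂|)/2, so the norms of its powers eventually decay faster than (1-p)^m. -/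
theorem exists_mixingTime : ∃ m : ℕ, IsMixingTime (mixingMatrix G) π m := by
  let := Matrix.linftyOpNormedRing (n := Idx G) (α := ℂ)
  let := Matrix.linftyOpNormedAlgebra (R := ℂ) (n := Idx G) (α := ℂ)
  have hne := hG.nonempty
  set B := mixingMatrix G - onesPi π with hB
  set Bc := B.map (algebraMap ℝ ℂ) with hBc
  have hcomplete : CompleteSpace (Matrix (Idx G) (Idx G) ℂ) := FiniteDimensional.complete ℂ _
  set l := lambdaTwo (mixingMatrix G) with hl
  have hl1 : l < 1 := lambdaTwo_lt_one hG hπ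
  have hq : 1 - gap (mixingMatrix G) = (1 + (l : ℝ)) / 2 := by unfold gap; rw [hl]; ring
  set q : ℝ≥0 := (1 + l) / 2 with hqdef
  have hlq : l < q := by
    rw [← NNReal.coe_lt_coe] at hl1 ⊢
    push_cast [hqdef]; push_cast at hl1; linarith
  -- The slack between r and q = 1 - p pays for the dimension factor lost in passing from the
  -- row-sum norm to the Frobenius norm.
  obtain ⟨r, hlr, hrq⟩ := exists_between hlq
  have hspec : spectralRadius ℂ Bc < r := by
    refine lt_of_le_of_lt (iSup₂_le fun z hz => ?_) (ENNReal.coe_lt_coe.2 hlr)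
    rw [Matrix.mem_spectrum_iff_isRoot_charpoly] at hz
    exact ENNReal.coe_le_coe.2 (nnnorm_root_le hG hπ
      ((Polynomial.mem_roots (Matrix.charpoly_monic _).ne_zero).2 hz))
  have hev := (spectrum.pow_nnnorm_pow_one_div_tendsto_nhds_spectralRadius Bc).eventually_lt_const
    hspec
  have hq0 : 0 < q := lt_of_le_of_lt (zero_le) hlq
  have hdecay : Filter.Tendsto (fun k : ℕ => (Fintype.card (Idx G) : ℝ)
      * (((r : ℝ) / q) ^ 2) ^ k) Filter.atTop (nhds 0) := by
    have h1 : ((r : ℝ) / q) < 1 := (div_lt_one (by exact_mod_cast hq0)).2 (by exact_mod_cast hrq)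
    have h2 : (0 : ℝ) ≤ (r : ℝ) / q := by positivity
    have := (tendsto_pow_atTop_nhds_zero_of_lt_one (sq_nonneg _)
      (show ((r : ℝ) / q) ^ 2 < 1 by nlinarith)).const_mul (Fintype.card (Idx G) : ℝ)
    simpa using this
  obtain ⟨m, hm1, hm2, hm3⟩ := (hev.and ((hdecay.eventually_le_const zero_lt_one).and
    (Filter.eventually_gt_atTop 0))).exists
  have hnorm : ‖Bc ^ m‖₊ ≤ r ^ m := by
    have h1 : ((‖Bc ^ m‖₊ : ENNReal) ^ (1 / (m : ℝ))) ^ (m : ℝ) ≤ (r : ENNReal) ^ (m : ℝ) :=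
      ENNReal.rpow_le_rpow hm1.le (by positivity)
    rw [← ENNReal.rpow_mul, one_div_mul_cancel (by positivity), ENNReal.rpow_one,
      ENNReal.rpow_natCast] at h1
    exact_mod_cast h1
  have hrow : ∀ a, ∑ b, |(B ^ m) a b| ≤ (r : ℝ) ^ m := by
    intro a
    have h1 : Bc ^ m = (B ^ m).map (algebraMap ℝ ℂ) := (Matrix.map_pow B (algebraMap ℝ ℂ) m).symm
    have h2 : ∑ b, ‖(Bc ^ m) a b‖₊ ≤ ‖Bc ^ m‖₊ := by
      rw [Matrix.linfty_opNNNorm_def]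
      exact Finset.le_sup (f := fun i => ∑ j, ‖(Bc ^ m) i j‖₊) (Finset.mem_univ a)
    have h3 := NNReal.coe_le_coe.2 (h2.trans hnorm)
    push_cast at h3
    refine le_trans (le_of_eq (Finset.sum_congr rfl fun b _ => ?_)) h3
    rw [h1]; simp
  refine ⟨m, hm3, fun d X => ?_⟩
  have hX : mixingMatrix G ^ m * X - onesPi π * X = B ^ m * (X - onesPi π * X) := by
    obtain ⟨k, rfl⟩ := Nat.exists_eq_succ_of_ne_zero hm3.ne'
    rw [hB, Nat.succ_eq_add_one, deflated_pow hG hπ, Matrix.mul_sub, ← Matrix.mul_assoc,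
      sub_mul (mixingMatrix G ^ (k + 1)) _ (onesPi π), mixing_pow_mul_onesPi hG hπ,
      onesPi_mul_self hG hπ, sub_self, Matrix.zero_mul, sub_zero, Matrix.sub_mul]
  rw [hX, hq]
  refine (frobSq_mul_le _ _ hrow).trans ?_
  refine mul_le_mul_of_nonneg_right ?_ (Finset.sum_nonneg fun _ _ =>
    Finset.sum_nonneg fun _ _ => sq_nonneg _)
  have hqq : (1 + (l : ℝ)) / 2 = (q : ℝ) := by rw [hqdef]; push_cast; ring
  have hq0' : (0 : ℝ) < q := by exact_mod_cast hq0
  rw [hqq]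
  rw [← pow_mul, div_pow, mul_div_assoc', div_le_one (by positivity)] at hm2
  calc _ = (Fintype.card (Idx G) : ℝ) * (r : ℝ) ^ (2 * m) := by ring
    _ ≤ _ := hm2

end Graph

/-! ### Norm inequalities -/

section Norm

variable {E : Type*} [NormedAddCommGroup E]

theorem norm_sub_sq_le_young {p : ℝ} (hp : 0 < p) (u v : E) :
    ‖u - v‖ ^ 2 ≤ (1 + p) * ‖u‖ ^ 2 + (1 + 1 / p) * ‖v‖ ^ 2 := by
  have h1 := norm_sub_le u v
  have h2 : ‖u - v‖ ^ 2 ≤ (‖u‖ + ‖v‖) ^ 2 := pow_le_pow_left₀ (norm_nonneg _) h1 2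
  have h3 : 0 ≤ (p * ‖u‖ - ‖v‖) ^ 2 / p := by positivity
  have h4 : (p * ‖u‖ - ‖v‖) ^ 2 / p = p * ‖u‖ ^ 2 - 2 * (‖u‖ * ‖v‖) + 1 / p * ‖v‖ ^ 2 := by
    field_simp
    ring
  nlinarith

theorem norm_sub_sq_le_two (u v : E) : ‖u - v‖ ^ 2 ≤ 2 * ‖u‖ ^ 2 + 2 * ‖v‖ ^ 2 := by
  have := norm_sub_sq_le_young one_pos u v
  linarith

theorem norm_add_sq_le_two (u v : E) : ‖u + v‖ ^ 2 ≤ 2 * ‖u‖ ^ 2 + 2 * ‖v‖ ^ 2 := by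
  have := norm_sub_sq_le_two u (-v)
  rwa [sub_neg_eq_add, norm_neg] at this

theorem norm_sum_sq_le {κ : Type*} (s : Finset κ) (y : κ → E) :
    ‖∑ l ∈ s, y l‖ ^ 2 ≤ s.card * ∑ l ∈ s, ‖y l‖ ^ 2 :=
  (pow_le_pow_left₀ (norm_nonneg _) (norm_sum_le _ _) 2).trans sq_sum_le_card_mul_sum_sq

theorem norm_add_add_sq_le (u v w : E) :
    ‖u + v + w‖ ^ 2 ≤ 3 * (‖u‖ ^ 2 + ‖v‖ ^ 2 + ‖w‖ ^ 2) := by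
  have := norm_sum_sq_le Finset.univ ![u, v, w]
  simpa [Fin.sum_univ_three] using this

theorem norm_weighted_sum_sq_le [NormedSpace ℝ E] {κ : Type*} (s : Finset κ) {w : κ → ℝ}
    (hw : ∀ b, 0 ≤ w b) (hs : ∑ b ∈ s, w b = 1) (y : κ → E) :
    ‖∑ b ∈ s, w b • y b‖ ^ 2 ≤ ∑ b ∈ s, w b * ‖y b‖ ^ 2 := by
  have h1 : ‖∑ b ∈ s, w b • y b‖ ≤ ∑ b ∈ s, w b * ‖y b‖ := by
    refine (norm_sum_le _ _).trans (le_of_eq (Finset.sum_congr rfl fun b _ => ?_))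
    rw [norm_smul, Real.norm_of_nonneg (hw b)]
  have h2 : (∑ b ∈ s, w b * ‖y b‖) ^ 2 ≤ (∑ b ∈ s, w b) * ∑ b ∈ s, w b * ‖y b‖ ^ 2 :=
    Finset.sum_sq_le_sum_mul_sum_of_sq_le_mul _ (fun b _ => hw b)
      (fun b _ => mul_nonneg (hw b) (sq_nonneg _)) fun b _ => le_of_eq (by ring)
  rw [hs, one_mul] at h2
  exact (pow_le_pow_left₀ (norm_nonneg _) h1 2).trans h2

theorem norm_avg_sq_le [NormedSpace ℝ E] {κ : Type*} [Fintype κ] [Nonempty κ] (y : κ → E) :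
    ‖(1 / (Fintype.card κ : ℝ)) • ∑ b, y b‖ ^ 2 ≤ (1 / (Fintype.card κ : ℝ)) * ∑ b, ‖y b‖ ^ 2 := by
  rw [Finset.smul_sum, Finset.mul_sum]
  exact norm_weighted_sum_sq_le _ (fun _ => by positivity) (by simp) y

end Norm

/-! ### Consensus along a trajectory -/

section Consensus

variable {V : Type*} [Fintype V] [DecidableEq V] {G : SimpleGraph V} {d : ℕ}

local notation "E" => EuclideanSpace ℝ (Fin d)

/-- The stacked states `(τ, i) ↦ x_i^{(t-τ)}`. -/
def stack (G : SimpleGraph V) (X : ℤ → V → E) (t : ℕ) (a : Idx G) : E :=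
  X ((t : ℤ) - ((a.1 : ℕ) : ℤ)) a.2

/-- The average with weights `π`. -/
def wmean (π : Idx G → ℝ) (Y : Idx G → E) : E := ∑ a, π a • Y a

/-- The gradients arriving in the rows of delay `0`. -/
def arrive (G : SimpleGraph V) (Γ : ℤ → V → E) (t : ℕ) (a : Idx G) : E :=
  if a.1 = 0 then (1 / (Fintype.card V : ℝ)) • ∑ j, Γ ((t : ℤ) - G.dist a.2 j) j else 0

/-- The consensus distance. -/
def consensus (π : Idx G → ℝ) (Y : Idx G → E) : ℝ := ∑ a, ‖Y a - wmean π Y‖ ^ 2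

/-- `X` follows the relayed descent recursion with gradients `Γ`. -/
def IsRelay (G : SimpleGraph V) (x₀ : E) (γ : ℝ) (X Γ : ℤ → V → E) : Prop :=
  (∀ s ≤ 0, ∀ i, X s i = x₀) ∧ ∀ (t : ℕ) i, X ((t : ℤ) + 1) i
    = (1 / (Fintype.card V : ℝ)) • ∑ j, (X ((t : ℤ) - G.dist i j) j - γ • Γ ((t : ℤ) - G.dist i j) j)

omit [DecidableEq V] in
theorem consensus_nonneg (π : Idx G → ℝ) (Y : Idx G → E) : 0 ≤ consensus π Y :=
  Finset.sum_nonneg fun _ _ => sq_nonneg _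

omit [DecidableEq V] in
theorem stack_src (hG : G.Connected) (X : ℤ → V → E) (t : ℕ) (i j : V) :
    stack G X t (src hG i j) = X ((t : ℤ) - G.dist i j) j := rfl

omit [DecidableEq V] in
theorem sum_src_le (hG : G.Connected) {h : Idx G → ℝ} (hh : ∀ a, 0 ≤ h a) (i : V) :
    ∑ j, h (src hG i j) ≤ ∑ a, h a := by
  rw [Fintype.sum_prod_type_right]
  exact Finset.sum_le_sum fun j _ => Finset.single_le_sum (f := fun τ => h (τ, j))
    (fun τ _ => hh _) (Finset.mem_univ (src hG i j).1)

omit [DecidableEq V] in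
theorem sum_norm_sq_act (M : Matrix (Idx G) (Idx G) ℝ) (Y : Idx G → E) :
    ∑ a, ‖act M Y a‖ ^ 2 = frobSq (M * Matrix.of fun a k => Y a k) := by
  unfold frobSq
  refine Finset.sum_congr rfl fun a _ => ?_
  rw [EuclideanSpace.norm_sq_eq]
  refine Finset.sum_congr rfl fun k _ => ?_
  simp [act, Matrix.mul_apply]

omit [DecidableEq V] in
theorem consensus_eq (π : Idx G → ℝ) (Y : Idx G → E) :
    consensus π Y = ∑ a, ‖(Y - act (onesPi π) Y) a‖ ^ 2 := by
  simp [consensus, wmean, act_onesPi]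

variable {x₀ : EuclideanSpace ℝ (Fin d)} {γ : ℝ} {X Γ : ℤ → V → EuclideanSpace ℝ (Fin d)}

omit [DecidableEq V] in
theorem stack_zero (h : IsRelay G x₀ γ X Γ) : stack G X 0 = fun _ => x₀ := by
  ext1 a
  exact h.1 _ (by simp) _

theorem stack_succ (hG : G.Connected) (h : IsRelay G x₀ γ X Γ) (t : ℕ) :
    stack G X (t + 1) = act (mixingMatrix G) (stack G X t) - γ • arrive G Γ t := by
  ext1 ⟨τ, i⟩
  refine Fin.cases ?_ (fun τ => ?_) τ
  · rw [Pi.sub_apply, act_mixing_zero hG]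
    have h1 : stack G X (t + 1) (0, i) = X ((t : ℤ) + 1) i := by simp [stack]
    rw [h1, h.2]
    simp only [Finset.sum_sub_distrib, smul_sub, stack_src, arrive, Pi.smul_apply, if_true,
      ← Finset.smul_sum, smul_comm γ]
  · rw [Pi.sub_apply, act_mixing_succ]
    simp [stack, arrive]

theorem stack_add (hG : G.Connected) (h : IsRelay G x₀ γ X Γ) (t k : ℕ) :
    stack G X (t + k) = act (mixingMatrix G ^ k) (stack G X t)
      - γ • ∑ l ∈ Finset.range k, act (mixingMatrix G ^ (k - 1 - l)) (arrive G Γ (t + l)) := by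
  induction k with
  | zero => simp [act_one]
  | succ k ih =>
    rw [← add_assoc, stack_succ hG h, ih, act_sub, act_smul, act_sum, ← act_mul, ← pow_succ',
      Finset.sum_range_succ, smul_add, ← sub_sub]
    have h1 : ∑ x ∈ Finset.range k, act (mixingMatrix G)
          (act (mixingMatrix G ^ (k - 1 - x)) (arrive G Γ (t + x)))
        = ∑ x ∈ Finset.range k, act (mixingMatrix G ^ (k + 1 - 1 - x)) (arrive G Γ (t + x)) := by
      refine Finset.sum_congr rfl fun l hl => ?_
      rw [← act_mul, ← pow_succ']
      have := Finset.mem_range.1 hl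
      congr 2
      omega
    rw [h1, show k + 1 - 1 - k = 0 by omega, pow_zero, act_one]

variable {π : Idx G → ℝ} (hG : G.Connected) (hπ : IsStationary (mixingMatrix G) π)
include hG hπ

/-- The rows of W^k are probability vectors, so Jensen's inequality moves the square inside;
`sum_act_pow_le` then bounds the column sums. W is not doubly stochastic, and τ_max + 1 is the
price. -/
theorem sum_norm_sq_act_pow_le (k : ℕ) (Y : Idx G → E) :
    ∑ a, ‖act (mixingMatrix G ^ k) Y a‖ ^ 2 ≤ ((G.diam : ℝ) + 1) * ∑ a, ‖Y a‖ ^ 2 := by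
  refine le_trans (Finset.sum_le_sum fun a _ => ?_)
    (sum_act_pow_le hG hπ k (h := fun a => ‖Y a‖ ^ 2) fun a => sq_nonneg _)
  exact norm_weighted_sum_sq_le _ (fun b => mixing_pow_nonneg k a b) (mixing_pow_row_sum hG k a) Y

theorem sum_norm_sq_act_onesPi_le (Y : Idx G → E) :
    ∑ a, ‖act (onesPi π) Y a‖ ^ 2 ≤ ((G.diam : ℝ) + 1) * ∑ a, ‖Y a‖ ^ 2 := by
  have := hG.nonempty
  have h1 : ‖∑ b, π b • Y b‖ ^ 2 ≤ ∑ b, (1 / (Fintype.card V : ℝ)) * ‖Y b‖ ^ 2 := by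
    refine (norm_weighted_sum_sq_le _ (stationary_nonneg hG hπ) hπ.2 Y).trans
      (Finset.sum_le_sum fun b _ => mul_le_mul_of_nonneg_right ?_ (sq_nonneg _))
    refine (stationary_le hG hπ b).trans ?_
    gcongr
    exact headMass_le_one hG hπ
  simp only [act_onesPi]
  calc _ ≤ ∑ _a : Idx G, ∑ b, (1 / (Fintype.card V : ℝ)) * ‖Y b‖ ^ 2 :=
        Finset.sum_le_sum fun _ _ => h1
    _ = _ := by
        rw [← Finset.mul_sum]
        simp
        field_simp

theorem sum_norm_sq_deflated_le (k : ℕ) (Y : Idx G → E) :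
    ∑ a, ‖act (mixingMatrix G ^ k - onesPi π) Y a‖ ^ 2
      ≤ 4 * ((G.diam : ℝ) + 1) * ∑ a, ‖Y a‖ ^ 2 := by
  rw [sub_act]
  calc _ ≤ ∑ a, (2 * ‖act (mixingMatrix G ^ k) Y a‖ ^ 2 + 2 * ‖act (onesPi π) Y a‖ ^ 2) :=
        Finset.sum_le_sum fun a _ => norm_sub_sq_le_two _ _
    _ ≤ _ := by
        rw [Finset.sum_add_distrib, ← Finset.mul_sum, ← Finset.mul_sum]
        linarith [sum_norm_sq_act_pow_le hG hπ k Y, sum_norm_sq_act_onesPi_le hG hπ Y]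

/-- As 1πᵀW^k = 1πᵀ, centring the unrolled recursion replaces each power of W by its deflation. -/
theorem centered_stack_add (h : IsRelay G x₀ γ X Γ) (t k : ℕ) :
    stack G X (t + k) - act (onesPi π) (stack G X (t + k))
      = act (mixingMatrix G ^ k - onesPi π) (stack G X t)
        - γ • ∑ l ∈ Finset.range k,
          act (mixingMatrix G ^ (k - 1 - l) - onesPi π) (arrive G Γ (t + l)) := by
  rw [stack_add hG h, act_sub, act_smul, act_sum, ← act_mul, onesPi_mul_mixing_pow hG hπ]
  simp only [← act_mul, onesPi_mul_mixing_pow hG hπ, sub_act, Finset.sum_sub_distrib, smul_sub]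
  abel

theorem sum_norm_sq_arrivals_le (t k : ℕ) :
    ∑ a, ‖(∑ l ∈ Finset.range k,
        act (mixingMatrix G ^ (k - 1 - l) - onesPi π) (arrive G Γ (t + l))) a‖ ^ 2
      ≤ k * (4 * ((G.diam : ℝ) + 1)) * ∑ l ∈ Finset.range k, ∑ a, ‖arrive G Γ (t + l) a‖ ^ 2 := by
  calc _ ≤ ∑ a, (k : ℝ) * ∑ l ∈ Finset.range k,
        ‖act (mixingMatrix G ^ (k - 1 - l) - onesPi π) (arrive G Γ (t + l)) a‖ ^ 2 := by
        refine Finset.sum_le_sum fun a _ => ?_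
        rw [Finset.sum_apply]
        simpa using norm_sum_sq_le (Finset.range k) fun l =>
          act (mixingMatrix G ^ (k - 1 - l) - onesPi π) (arrive G Γ (t + l)) a
    _ = k * ∑ l ∈ Finset.range k, ∑ a,
        ‖act (mixingMatrix G ^ (k - 1 - l) - onesPi π) (arrive G Γ (t + l)) a‖ ^ 2 := by
        rw [← Finset.mul_sum, Finset.sum_comm]
    _ ≤ k * ∑ l ∈ Finset.range k,
        4 * ((G.diam : ℝ) + 1) * ∑ a, ‖arrive G Γ (t + l) a‖ ^ 2 := by
        gcongr with l _
        exact sum_norm_sq_deflated_le hG hπ _ _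
    _ = _ := by rw [← Finset.mul_sum]; ring

theorem gap_le_half : gap (mixingMatrix G) ≤ 1 / 2 := by
  unfold gap
  have := (lambdaTwo (mixingMatrix G)).2
  linarith [NNReal.coe_nonneg (lambdaTwo (mixingMatrix G))]

/-- Young's inequality with parameter p separates the state from the arrivals. The state contracts
by the mixing time, and each arrival is propagated by a deflated power, whose expansion is at most
4(τ_max+1) on sums of squares. -/
theorem consensus_add_le (h : IsRelay G x₀ γ X Γ) {m : ℕ}
    (hm : IsMixingTime (mixingMatrix G) π m) (t : ℕ) :
    consensus π (stack G X (t + m))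
      ≤ (1 - gap (mixingMatrix G)) * consensus π (stack G X t)
        + 8 * γ ^ 2 * m * ((G.diam : ℝ) + 1) / gap (mixingMatrix G)
          * ∑ l ∈ Finset.range m, ∑ a, ‖arrive G Γ (t + l) a‖ ^ 2 := by
  set p := gap (mixingMatrix G) with hp
  have hp0 : 0 < p := gap_pos hG hπ
  have hp1 : p ≤ 1 / 2 := gap_le_half hG hπ
  set S := ∑ l ∈ Finset.range m, ∑ a, ‖arrive G Γ (t + l) a‖ ^ 2 with hS
  have hS0 : 0 ≤ S := Finset.sum_nonneg fun _ _ => Finset.sum_nonneg fun _ _ => sq_nonneg _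
  have hcontr : ∑ a, ‖act (mixingMatrix G ^ m - onesPi π) (stack G X t) a‖ ^ 2
      ≤ (1 - p) ^ (2 * m) * consensus π (stack G X t) := by
    have h1 := hm.2 d (Matrix.of fun a k => stack G X t a k)
    have h2 : consensus π (stack G X t)
        = ∑ a, ‖act (1 - onesPi π) (stack G X t) a‖ ^ 2 := by
      rw [consensus_eq, sub_act, act_one]
    have h3 : ∀ Z : Matrix (Idx G) (Fin d) ℝ, Z - onesPi π * Z = (1 - onesPi π) * Z := fun Z => by
      rw [Matrix.sub_mul, Matrix.one_mul]
    rwa [← Matrix.sub_mul, h3, ← sum_norm_sq_act, ← sum_norm_sq_act, ← h2] at h1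
  -- One factor (1-p)² suffices: it turns the Young factor 1 + p into (1+p)(1-p)² ≤ 1 - p.
  have hpow : (1 - p) ^ (2 * m) ≤ (1 - p) ^ 2 :=
    pow_le_pow_of_le_one (by linarith) (by linarith) (by have := hm.1; omega)
  have hc := consensus_nonneg π (stack G X t)
  have harr := sum_norm_sq_arrivals_le (Γ := Γ) hG hπ t m
  rw [consensus_eq, centered_stack_add hG hπ h]
  set u := act (mixingMatrix G ^ m - onesPi π) (stack G X t)
  set v := ∑ l ∈ Finset.range m,
          act (mixingMatrix G ^ (m - 1 - l) - onesPi π) (arrive G Γ (t + l))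
  calc ∑ a, ‖(u - γ • v) a‖ ^ 2
      ≤ ∑ a, ((1 + p) * ‖u a‖ ^ 2 + (1 + 1 / p) * ‖γ • v a‖ ^ 2) :=
        Finset.sum_le_sum fun a _ => norm_sub_sq_le_young hp0 _ _
    _ = (1 + p) * ∑ a, ‖u a‖ ^ 2 + (1 + 1 / p) * (γ ^ 2 * ∑ a, ‖v a‖ ^ 2) := by
        simp only [norm_smul, mul_pow, Real.norm_eq_abs, sq_abs, Finset.sum_add_distrib,
          ← Finset.mul_sum]
    _ ≤ (1 + p) * ((1 - p) ^ 2 * consensus π (stack G X t))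
        + (2 / p) * (γ ^ 2 * (m * (4 * ((G.diam : ℝ) + 1)) * S)) := by
        have h3 : 1 + 1 / p ≤ 2 / p := by
          have h4 : 1 ≤ 1 / p := by rw [le_div_iff₀ hp0]; linarith
          have h5 : 2 / p = 1 / p + 1 / p := by ring
          linarith
        gcongr
        exact hcontr.trans (mul_le_mul_of_nonneg_right hpow hc)
    _ ≤ _ := by
        refine add_le_add ?_ (le_of_eq (by ring))
        rw [← mul_assoc]
        refine mul_le_mul_of_nonneg_right ?_ hc
        nlinarith [mul_nonneg (show 0 ≤ 1 - p by linarith) (sq_nonneg p)]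

/-- All rows start at x₀, so there is no initial consensus error and only arrivals contribute. The
constant is weakened to that of `consensus_add_le` so that one scalar recursion covers both. -/
theorem consensus_init_le (h : IsRelay G x₀ γ X Γ) {m k : ℕ} (hk : k ≤ m) :
    consensus π (stack G X k)
      ≤ 8 * γ ^ 2 * m * ((G.diam : ℝ) + 1) / gap (mixingMatrix G)
          * ∑ l ∈ Finset.range k, ∑ a, ‖arrive G Γ l a‖ ^ 2 := by
  set p := gap (mixingMatrix G) with hp
  have hp0 : 0 < p := gap_pos hG hπ
  have hp1 : p ≤ 1 / 2 := gap_le_half hG hπ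
  have harr := sum_norm_sq_arrivals_le (Γ := Γ) hG hπ 0 k
  have h1 := centered_stack_add hG hπ h 0 k
  rw [stack_zero h, sub_act, act_mixing_pow_const hG] at h1
  have h2 : act (onesPi π) (fun _ => x₀) = fun _ => x₀ := by
    ext1 a; rw [act_onesPi, ← Finset.sum_smul, hπ.2, one_smul]
  rw [h2, sub_self, zero_sub] at h1
  simp only [zero_add] at h1 harr
  set S := ∑ l ∈ Finset.range k, ∑ a, ‖arrive G Γ l a‖ ^ 2 with hS
  have hS0 : 0 ≤ S := Finset.sum_nonneg fun _ _ => Finset.sum_nonneg fun _ _ => sq_nonneg _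
  rw [consensus_eq, h1]
  set v := ∑ l ∈ Finset.range k, act (mixingMatrix G ^ (k - 1 - l) - onesPi π) (arrive G Γ l)
  calc _ = γ ^ 2 * ∑ a, ‖v a‖ ^ 2 := by
        simp only [Pi.neg_apply, Pi.smul_apply, norm_neg, norm_smul, mul_pow, Real.norm_eq_abs,
          sq_abs, ← Finset.mul_sum]
    _ ≤ γ ^ 2 * (k * (4 * ((G.diam : ℝ) + 1)) * S) := by gcongr
    _ ≤ γ ^ 2 * (m * (4 * ((G.diam : ℝ) + 1)) * S) := by gcongr
    _ = 4 * γ ^ 2 * m * ((G.diam : ℝ) + 1) * S := by ring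
    _ ≤ _ := by
        refine mul_le_mul_of_nonneg_right ?_ hS0
        rw [le_div_iff₀ hp0]
        have : 0 ≤ γ ^ 2 * m * ((G.diam : ℝ) + 1) := by positivity
        nlinarith

/-- π ignores the mixing, and it weighs the arrivals equally with total mass nπ₀; hence the
effective step size γnπ₀. -/
theorem wmean_succ (h : IsRelay G x₀ γ X Γ) (t : ℕ) :
    wmean π (stack G X (t + 1)) = wmean π (stack G X t)
      - (γ * headMass π) • (1 / (Fintype.card V : ℝ)) • ∑ i,
        (1 / (Fintype.card V : ℝ)) • ∑ j, Γ ((t : ℤ) - G.dist i j) j := by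
  have h1 : ∑ a, π a • arrive G Γ t a = headMass π • (1 / (Fintype.card V : ℝ)) • ∑ i,
        (1 / (Fintype.card V : ℝ)) • ∑ j, Γ ((t : ℤ) - G.dist i j) j := by
    rw [Fintype.sum_prod_type, Fin.sum_univ_succ, Finset.sum_eq_zero (s := Finset.univ (α := Fin _)),
      add_zero, Finset.smul_sum, Finset.smul_sum]
    · refine Finset.sum_congr rfl fun i _ => ?_
      simp only [stationary_zero hG hπ, smul_smul, arrive, if_true]
      congr 1
      ring
    · intro τ _
      exact Finset.sum_eq_zero fun i _ => by simp [arrive]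
  rw [wmean, stack_succ hG h]
  simp only [Pi.sub_apply, smul_sub, Finset.sum_sub_distrib, Pi.smul_apply]
  rw [sum_stationary_act hG hπ, wmean, mul_smul, ← h1, Finset.smul_sum]
  simp only [smul_comm γ]

omit hπ in
theorem sum_dist_wmean_le (t : ℕ) :
    ∑ i, ∑ j, ‖X ((t : ℤ) - G.dist i j) j - wmean π (stack G X t)‖ ^ 2
      ≤ Fintype.card V * consensus π (stack G X t) := by
  calc _ ≤ ∑ _i : V, consensus π (stack G X t) :=
        Finset.sum_le_sum fun i _ => sum_src_le hG
          (h := fun a => ‖stack G X t a - wmean π (stack G X t)‖ ^ 2) (fun _ => sq_nonneg _) i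
    _ = _ := by simp

omit hπ in
-- Here heterogeneity drops out. Each arriving row already averages the gradients of all workers, so
-- transporting every g_j to the common point x̄ leaves only the mean gradient there, and no
-- individual one. Transport costs L² times the consensus distance.
theorem sum_norm_sq_arrive_le {g : V → E → E} {ζ : ℤ → V → E} {L : ℝ}
    (hΓ : ∀ s j, Γ s j = g j (X s j) + ζ s j)
    (hg : ∀ j x y, ‖g j x - g j y‖ ≤ L * ‖x - y‖) (t : ℕ) :
    ∑ a, ‖arrive G Γ t a‖ ^ 2
      ≤ 3 * (L ^ 2 * consensus π (stack G X t)
        + Fintype.card V * ‖(1 / (Fintype.card V : ℝ)) • ∑ j, g j (wmean π (stack G X t))‖ ^ 2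
        + (1 / (Fintype.card V : ℝ)) * ∑ i, ∑ j, ‖ζ ((t : ℤ) - G.dist i j) j‖ ^ 2) := by
  have := hG.nonempty
  set x := wmean π (stack G X t)
  set n : ℝ := (Fintype.card V : ℝ) with hn
  have hn0 : 0 < n := by positivity
  have h0 : ∑ a, ‖arrive G Γ t a‖ ^ 2 = ∑ i, ‖(1 / n) • ∑ j, Γ ((t : ℤ) - G.dist i j) j‖ ^ 2 := by
    rw [Fintype.sum_prod_type, Fin.sum_univ_succ, Finset.sum_eq_zero (s := Finset.univ (α := Fin _)),
      add_zero]
    · simp [arrive, hn]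
    · intro τ _
      exact Finset.sum_eq_zero fun i _ => by simp [arrive]
  have h1 : ∀ i, ‖(1 / n) • ∑ j, Γ ((t : ℤ) - G.dist i j) j‖ ^ 2
      ≤ 3 * ((1 / n) * (L ^ 2 * ∑ j, ‖X ((t : ℤ) - G.dist i j) j - x‖ ^ 2)
        + ‖(1 / n) • ∑ j, g j x‖ ^ 2 + (1 / n) * ∑ j, ‖ζ ((t : ℤ) - G.dist i j) j‖ ^ 2) := by
    intro i
    have h2 : (1 / n) • ∑ j, Γ ((t : ℤ) - G.dist i j) j
        = (1 / n) • ∑ j, (g j (X ((t : ℤ) - G.dist i j) j) - g j x) + (1 / n) • ∑ j, g j x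
          + (1 / n) • ∑ j, ζ ((t : ℤ) - G.dist i j) j := by
      rw [← smul_add, ← smul_add, ← Finset.sum_add_distrib, ← Finset.sum_add_distrib]
      congr 1
      exact Finset.sum_congr rfl fun j _ => by rw [hΓ]; abel
    rw [h2]
    refine (norm_add_add_sq_le _ _ _).trans ?_
    gcongr
    · refine (norm_avg_sq_le _).trans ?_
      refine mul_le_mul_of_nonneg_left ?_ (by positivity)
      rw [Finset.mul_sum]
      refine Finset.sum_le_sum fun j _ => ?_
      rw [← mul_pow]
      exact pow_le_pow_left₀ (norm_nonneg _) (hg j _ _) 2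
    · exact norm_avg_sq_le _
  rw [h0]
  refine (Finset.sum_le_sum fun i _ => h1 i).trans ?_
  rw [← Finset.mul_sum, Finset.sum_add_distrib, Finset.sum_add_distrib, ← Finset.mul_sum,
    ← Finset.mul_sum, ← Finset.mul_sum]
  have h3 := sum_dist_wmean_le (X := X) (π := π) hG t
  have h4 : 1 / n * (L ^ 2 * ∑ i, ∑ j, ‖X ((t : ℤ) - G.dist i j) j - x‖ ^ 2)
      ≤ L ^ 2 * consensus π (stack G X t) := by
    rw [← hn] at h3
    calc _ ≤ 1 / n * (L ^ 2 * (n * consensus π (stack G X t))) := by gcongr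
      _ = _ := by field_simp
  have h5 : ∑ _i : V, ‖(1 / n) • ∑ j, g j x‖ ^ 2 = n * ‖(1 / n) • ∑ j, g j x‖ ^ 2 := by
    rw [Finset.sum_const, Finset.card_univ, nsmul_eq_mul]
  rw [h5]
  linarith

end Consensus

/-! ### Scalar recursions -/

/-- Summing a contraction over `m` steps against slowly increasing weights. -/
theorem weighted_sum_le_of_contraction {ψ h w : ℕ → ℝ} {p D : ℝ} {m : ℕ} (hp : 0 < p)
    (hp1 : p ≤ 1 / 2) (hD : 0 ≤ D) (hψ : ∀ t, 0 ≤ ψ t) (hh : ∀ t, 0 ≤ h t) (hw : ∀ t, 0 < w t)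
    (hmono : Monotone w) (hwm : ∀ t, w (t + m) ≤ (1 + p / 2) * w t)
    (h1 : ∀ t, ψ (t + m) ≤ (1 - p) * ψ t + D * ∑ l ∈ Finset.range m, h (t + l))
    (h2 : ∀ k ≤ m, ψ k ≤ D * ∑ l ∈ Finset.range k, h l) (T : ℕ) :
    ∑ t ∈ Finset.range T, w t * ψ t ≤ 4 * D * m / p * ∑ t ∈ Finset.range T, w t * h t := by
  set S := ∑ t ∈ Finset.range T, w t * ψ t with hS
  set H := ∑ t ∈ Finset.range T, w t * h t with hH
  have hS0 : 0 ≤ S := Finset.sum_nonneg fun t _ => mul_nonneg (hw t).le (hψ t)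
  have hH0 : 0 ≤ H := Finset.sum_nonneg fun t _ => mul_nonneg (hw t).le (hh t)
  -- Both hypotheses in one inequality: the contraction term is set to 0 while t < m, and the inputs
  -- are those of the last m times.
  have hrec : ∀ t, ψ t ≤ (1 - p) * (if m ≤ t then ψ (t - m) else 0)
      + D * ∑ s ∈ Finset.range t, if t ≤ s + m then h s else 0 := by
    intro t
    split_ifs with hmt
    · obtain ⟨s, rfl⟩ := Nat.exists_eq_add_of_le' hmt
      refine (h1 s).trans ?_
      rw [Nat.add_sub_cancel, Finset.sum_range_add]
      gcongr
      rw [← zero_add (∑ l ∈ Finset.range m, h (s + l))]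
      refine add_le_add (Finset.sum_nonneg fun x _ => ?_) (Finset.sum_le_sum fun x _ => ?_)
      · split_ifs
        · exact hh x
        · exact le_rfl
      · rw [if_pos (by omega)]
    · rw [mul_zero, zero_add]
      refine (h2 t (by omega)).trans (le_of_eq ?_)
      congr 1
      exact Finset.sum_congr rfl fun s _ => (if_pos (by omega)).symm
  -- Shifting the summation index by m changes the weights by a factor of at most 1 + p/2.
  have hA : ∑ t ∈ Finset.range T, w t * (if m ≤ t then ψ (t - m) else 0) ≤ (1 + p / 2) * S := by
    rcases le_total T m with hTm | hTm
    · rw [Finset.sum_eq_zero]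
      · positivity
      · intro t ht
        have := Finset.mem_range.1 ht
        split_ifs with h'
        · omega
        · simp
    · obtain ⟨T', rfl⟩ := Nat.exists_eq_add_of_le hTm
      rw [Finset.sum_range_add, Finset.sum_eq_zero, zero_add]
      · calc _ ≤ ∑ x ∈ Finset.range T', (1 + p / 2) * (w x * ψ x) := by
              refine Finset.sum_le_sum fun x _ => ?_
              rw [if_pos (by omega), Nat.add_sub_cancel_left, add_comm m x, ← mul_assoc]
              exact mul_le_mul_of_nonneg_right (hwm x) (hψ x)
          _ ≤ _ := by
              rw [← Finset.mul_sum, hS]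
              refine mul_le_mul_of_nonneg_left ?_ (by positivity)
              exact Finset.sum_le_sum_of_subset_of_nonneg (Finset.range_subset_range.2 (by omega))
                fun t _ _ => mul_nonneg (hw t).le (hψ t)
      · intro t ht
        have := Finset.mem_range.1 ht
        split_ifs with h'
        · omega
        · simp
  -- After exchanging the sums, each h s is counted for the at most m times t in (s, s+m], again
  -- with a weight loss of at most 1 + p/2.
  have hB : ∑ t ∈ Finset.range T, w t * ∑ s ∈ Finset.range t, (if t ≤ s + m then h s else 0)
      ≤ m * (1 + p / 2) * H := by
    have e1 : ∀ t ∈ Finset.range T,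
        w t * ∑ s ∈ Finset.range t, (if t ≤ s + m then h s else 0)
          ≤ ∑ s ∈ Finset.range T, if t ∈ Finset.Ioc s (s + m) then (1 + p / 2) * (w s * h s) else 0 := by
      intro t ht
      have ht' := Finset.mem_range.1 ht
      rw [Finset.mul_sum]
      calc _ ≤ ∑ s ∈ Finset.range t,
            if t ∈ Finset.Ioc s (s + m) then (1 + p / 2) * (w s * h s) else 0 := by
            refine Finset.sum_le_sum fun s hs => ?_
            have hs' := Finset.mem_range.1 hs
            by_cases hts : t ≤ s + m
            · rw [if_pos hts, if_pos (Finset.mem_Ioc.2 ⟨hs', hts⟩), ← mul_assoc]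
              exact mul_le_mul_of_nonneg_right ((hmono hts).trans (hwm s)) (hh s)
            · rw [if_neg hts, mul_zero]
              split_ifs
              · have := mul_nonneg (hw s).le (hh s); positivity
              · exact le_rfl
        _ ≤ _ := by
            refine Finset.sum_le_sum_of_subset_of_nonneg
              (Finset.range_subset_range.2 ht'.le) fun s _ _ => ?_
            have := mul_nonneg (hw s).le (hh s)
            split_ifs
            · positivity
            · exact le_rfl
    refine (Finset.sum_le_sum e1).trans ?_
    rw [Finset.sum_comm, hH, Finset.mul_sum]
    refine Finset.sum_le_sum fun s _ => ?_
    have := mul_nonneg (hw s).le (hh s)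
    rw [← Finset.sum_filter, Finset.sum_const, nsmul_eq_mul, mul_assoc]
    refine mul_le_mul_of_nonneg_right ?_ (by positivity)
    have hcard : ((Finset.range T).filter fun t => t ∈ Finset.Ioc s (s + m)).card ≤ m := by
      calc _ ≤ (Finset.Ioc s (s + m)).card := Finset.card_le_card fun t ht =>
            (Finset.mem_filter.1 ht).2
        _ = m := by simp
    exact_mod_cast hcard
  -- Since (1-p)(1+p/2) ≤ 1 - p/2, the contraction term can be moved to the left, leaving at least
  -- pS/2 there.
  have hmain : S ≤ (1 - p) * ((1 + p / 2) * S) + D * (m * (1 + p / 2) * H) := by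
    calc S ≤ ∑ t ∈ Finset.range T, w t * ((1 - p) * (if m ≤ t then ψ (t - m) else 0)
          + D * ∑ s ∈ Finset.range t, if t ≤ s + m then h s else 0) :=
          Finset.sum_le_sum fun t _ => mul_le_mul_of_nonneg_left (hrec t) (hw t).le
      _ = (1 - p) * ∑ t ∈ Finset.range T, w t * (if m ≤ t then ψ (t - m) else 0)
          + D * ∑ t ∈ Finset.range T, w t * ∑ s ∈ Finset.range t, (if t ≤ s + m then h s else 0) := by
          rw [Finset.mul_sum, Finset.mul_sum, ← Finset.sum_add_distrib]
          exact Finset.sum_congr rfl fun t _ => by ring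
      _ ≤ _ := add_le_add (mul_le_mul_of_nonneg_left hA (by linarith))
          (mul_le_mul_of_nonneg_left hB hD)
  have hDmH : 0 ≤ D * m * H := by positivity
  rw [div_mul_eq_mul_div, le_div_iff₀ hp]
  nlinarith [mul_nonneg hS0 (sq_nonneg p)]

/-- The sum of ψ reappears on the right with the coefficient QL² ≤ 1/2 and is absorbed on the left.
-/
theorem weighted_sum_le_of_self_bound {ψ g w : ℕ → ℝ} {Q L n σ2 : ℝ} {T : ℕ}
    (hψ : ∀ t, 0 ≤ ψ t) (hw : ∀ t, 0 < w t) (hQL : Q * L ^ 2 ≤ 1 / 2)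
    (h : ∑ t ∈ Finset.range T, w t * ψ t
      ≤ Q * ∑ t ∈ Finset.range T, w t * (L ^ 2 * ψ t + n * g t + n * σ2)) :
    ∑ t ∈ Finset.range T, w t * ψ t
      ≤ 2 * Q * n * ∑ t ∈ Finset.range T, w t * (g t + σ2) := by
  have hS0 : 0 ≤ ∑ t ∈ Finset.range T, w t * ψ t :=
    Finset.sum_nonneg fun t _ => mul_nonneg (hw t).le (hψ t)
  have h2 : ∑ t ∈ Finset.range T, w t * (L ^ 2 * ψ t + n * g t + n * σ2)
      = L ^ 2 * ∑ t ∈ Finset.range T, w t * ψ t + n * ∑ t ∈ Finset.range T, w t * (g t + σ2) := by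
    rw [Finset.mul_sum, Finset.mul_sum, ← Finset.sum_add_distrib]
    exact Finset.sum_congr rfl fun t _ => by ring
  rw [h2] at h
  nlinarith [mul_le_mul_of_nonneg_right hQL hS0]

/-- Telescoping of a contraction with the weights `(1 - a)^{-(t+1)}`. -/
theorem weighted_telescope {r u : ℕ → ℝ} {a : ℝ} (ha : a < 1)
    (h : ∀ t, r (t + 1) ≤ (1 - a) * r t + u t) (T : ℕ) :
    ((1 - a) ^ T)⁻¹ * r T ≤ r 0 + ∑ t ∈ Finset.range T, ((1 - a) ^ (t + 1))⁻¹ * u t := by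
  induction T with
  | zero => simp
  | succ T ih =>
    have h1 : 0 < 1 - a := by linarith
    rw [Finset.sum_range_succ, ← add_assoc]
    calc ((1 - a) ^ (T + 1))⁻¹ * r (T + 1)
        ≤ ((1 - a) ^ (T + 1))⁻¹ * ((1 - a) * r T + u T) := by gcongr; exact h T
      _ = ((1 - a) ^ T)⁻¹ * r T + ((1 - a) ^ (T + 1))⁻¹ * u T := by
          rw [pow_succ]; field_simp
      _ ≤ _ := by gcongr

/-! ### Smooth functions -/

section Smooth

variable {E : Type*} [NormedAddCommGroup E] [InnerProductSpace ℝ E] [CompleteSpace E]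

/-- Along the segment from x to y, the difference between f and its quadratic upper model has
nonpositive derivative, by the Lipschitz bound on the gradient. -/
theorem descent_lemma {f : E → ℝ} {g : E → E} {L : ℝ} (hf : ∀ x, HasGradientAt f (g x) x)
    (hg : ∀ x y, ‖g x - g y‖ ≤ L * ‖x - y‖) (x y : E) :
    f y ≤ f x + ⟪g x, y - x⟫_ℝ + L / 2 * ‖y - x‖ ^ 2 := by
  set v := y - x with hv
  set φ : ℝ → ℝ := fun s => f (x + s • v) - s * ⟪g x, v⟫_ℝ - L / 2 * ‖v‖ ^ 2 * s ^ 2 with hφ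
  have hder : ∀ s, HasDerivAt φ (⟪g (x + s • v), v⟫_ℝ - ⟪g x, v⟫_ℝ - L / 2 * ‖v‖ ^ 2 * (2 * s)) s := by
    intro s
    have h1 : HasDerivAt (fun s : ℝ => x + s • v) v s := by
      simpa using ((hasDerivAt_id s).smul_const v).const_add x
    have h2 := (hf (x + s • v)).hasFDerivAt.comp_hasDerivAt s h1
    have h3 : HasDerivAt (fun s : ℝ => s * ⟪g x, v⟫_ℝ) (⟪g x, v⟫_ℝ) s := by
      simpa using (hasDerivAt_id s).mul_const (⟪g x, v⟫_ℝ)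
    have h4 : HasDerivAt (fun s : ℝ => L / 2 * ‖v‖ ^ 2 * s ^ 2) (L / 2 * ‖v‖ ^ 2 * (2 * s)) s := by
      simpa using (hasDerivAt_pow 2 s).const_mul (L / 2 * ‖v‖ ^ 2)
    exact (h2.sub h3).sub h4
  have hanti : AntitoneOn φ (Set.Icc 0 1) := by
    refine antitoneOn_of_deriv_nonpos (convex_Icc 0 1)
      (fun s _ => (hder s).continuousAt.continuousWithinAt)
      (fun s _ => (hder s).differentiableAt.differentiableWithinAt) fun s hs => ?_
    rw [interior_Icc] at hs
    rw [(hder s).deriv, ← inner_sub_left]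
    have h1 := real_inner_le_norm (g (x + s • v) - g x) v
    have h2 := hg (x + s • v) x
    rw [add_sub_cancel_left, norm_smul, Real.norm_of_nonneg hs.1.le] at h2
    nlinarith [mul_le_mul_of_nonneg_right h2 (norm_nonneg v)]
  have h01 := hanti (Set.left_mem_Icc.2 zero_le_one) (Set.right_mem_Icc.2 zero_le_one) zero_le_one
  simp only [hφ, zero_smul, add_zero, zero_mul, one_smul, one_mul, one_pow, mul_one, sub_zero, ne_eq,
    OfNat.ofNat_ne_zero, not_false_eq_true, zero_pow, mul_zero] at h01
  have : x + v = y := by rw [hv]; abel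
  rw [this] at h01
  linarith

/-- A gradient step of length 1/L decreases f by at least ‖g x‖²/(2L), and it cannot go below c. -/
theorem norm_gradient_sq_le {f : E → ℝ} {g : E → E} {L c : ℝ} (hL : 0 < L)
    (hf : ∀ x, HasGradientAt f (g x) x) (hg : ∀ x y, ‖g x - g y‖ ≤ L * ‖x - y‖)
    (hc : ∀ x, c ≤ f x) (x : E) : ‖g x‖ ^ 2 ≤ 2 * L * (f x - c) := by
  have h1 := descent_lemma hf hg x (x - (1 / L) • g x)
  have h2 := hc (x - (1 / L) • g x)
  rw [sub_sub_cancel_left, inner_neg_right, norm_neg, inner_smul_right, real_inner_self_eq_norm_sq,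
    norm_smul, mul_pow, Real.norm_of_nonneg (by positivity)] at h1
  have h3 : L / 2 * ((1 / L) ^ 2 * ‖g x‖ ^ 2) = 1 / (2 * L) * ‖g x‖ ^ 2 := by field_simp
  have h4 : 1 / L * ‖g x‖ ^ 2 = 2 * (1 / (2 * L) * ‖g x‖ ^ 2) := by field_simp
  have h5 : 1 / (2 * L) * ‖g x‖ ^ 2 ≤ f x - c := by linarith
  rwa [div_mul_eq_mul_div, one_mul, div_le_iff₀ (by positivity), mul_comm] at h5

theorem gradient_eq_zero_of_forall_le {f : E → ℝ} {g : E → E} (hf : ∀ x, HasGradientAt f (g x) x)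
    {x : E} (hx : ∀ y, f x ≤ f y) : g x = 0 := by
  have h1 : IsLocalMin f x := Filter.Eventually.of_forall hx
  have h2 := h1.hasFDerivAt_eq_zero (hf x).hasFDerivAt
  simpa using h2

end Smooth

/-! ### One step of perturbed gradient descent -/

section PairMean

variable {V : Type*} [Fintype V] {M : Type*} [AddCommGroup M] [Module ℝ M]

/-- The average over all ordered pairs of workers. -/
def pairMean (h : V → V → M) : M :=
  (1 / (Fintype.card V : ℝ)) • ∑ i, (1 / (Fintype.card V : ℝ)) • ∑ j, h i j

theorem pairMean_add (h k : V → V → M) :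
    pairMean (fun i j => h i j + k i j) = pairMean h + pairMean k := by
  simp [pairMean, Finset.sum_add_distrib]

theorem pairMean_sub (h k : V → V → M) :
    pairMean (fun i j => h i j - k i j) = pairMean h - pairMean k := by
  simp [pairMean, Finset.sum_sub_distrib, smul_sub]

theorem pairMean_smul (c : ℝ) (h : V → V → M) :
    pairMean (fun i j => c • h i j) = c • pairMean h := by
  simp only [pairMean, ← Finset.smul_sum, smul_comm c]

theorem pairMean_mul (c : ℝ) (h : V → V → ℝ) :
    pairMean (fun i j => c * h i j) = c * pairMean h := pairMean_smul c h

theorem pairMean_right [Nonempty V] (h : V → M) :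
    pairMean (fun _ : V => h) = (1 / (Fintype.card V : ℝ)) • ∑ j, h j := by
  rw [pairMean, Finset.sum_const, Finset.card_univ, ← Nat.cast_smul_eq_nsmul ℝ, smul_smul,
    one_div_mul_cancel (by positivity), one_smul]

theorem pairMean_const [Nonempty V] (x : M) : pairMean (fun _ _ : V => x) = x := by
  rw [pairMean_right, Finset.sum_const, Finset.card_univ, ← Nat.cast_smul_eq_nsmul ℝ, smul_smul,
    one_div_mul_cancel (by positivity), one_smul]

theorem pairMean_mono {h k : V → V → ℝ} (hk : ∀ i j, h i j ≤ k i j) : pairMean h ≤ pairMean k := by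
  simp only [pairMean, smul_eq_mul]
  gcongr
  exact hk _ _

theorem pairMean_nonneg {h : V → V → ℝ} (hk : ∀ i j, 0 ≤ h i j) : 0 ≤ pairMean h := by
  simp only [pairMean, smul_eq_mul]
  have := fun i => Finset.sum_nonneg fun j (_ : j ∈ Finset.univ) => hk i j
  have := Finset.sum_nonneg fun i (_ : i ∈ Finset.univ) =>
    mul_nonneg (one_div_nonneg.2 (Nat.cast_nonneg (α := ℝ) (Fintype.card V))) (this i)
  positivity

variable {E : Type*} [NormedAddCommGroup E] [InnerProductSpace ℝ E]

theorem inner_pairMean (h : V → V → E) (x : E) :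
    ⟪pairMean h, x⟫_ℝ = pairMean fun i j => ⟪h i j, x⟫_ℝ := by
  simp [pairMean, inner_smul_left, sum_inner]

theorem norm_pairMean_sq_le [Nonempty V] (h : V → V → E) :
    ‖pairMean h‖ ^ 2 ≤ pairMean fun i j => ‖h i j‖ ^ 2 := by
  refine (norm_avg_sq_le _).trans ?_
  simp only [pairMean, smul_eq_mul]
  gcongr
  exact norm_avg_sq_le _

end PairMean

section Step

variable {V : Type*} [Fintype V] [Nonempty V] {E : Type*} [NormedAddCommGroup E]
  [InnerProductSpace ℝ E] [CompleteSpace E] {f : V → E → ℝ} {g : V → E → E} {L : ℝ}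
  (hf : ∀ j x, HasGradientAt (f j) (g j x) x) (hg : ∀ j x y, ‖g j x - g j y‖ ≤ L * ‖x - y‖)

include hf in
omit [Nonempty V] in
theorem hasGradientAt_mean (x : E) :
    HasGradientAt (fun x => (1 / (Fintype.card V : ℝ)) * ∑ j, f j x)
      ((1 / (Fintype.card V : ℝ)) • ∑ j, g j x) x := by
  have h := (HasFDerivAt.fun_sum (u := Finset.univ) fun j _ => (hf j x).hasFDerivAt).const_mul
    (1 / (Fintype.card V : ℝ))
  have h2 : InnerProductSpace.toDual ℝ E ((1 / (Fintype.card V : ℝ)) • ∑ j, g j x)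
      = (1 / (Fintype.card V : ℝ)) • ∑ j, InnerProductSpace.toDual ℝ E (g j x) := by
    ext v
    simp
  rw [hasGradientAt_iff_hasFDerivAt, h2]
  exact h

include hg in
omit [CompleteSpace E] in
theorem norm_mean_sub_le (x y : E) :
    ‖(1 / (Fintype.card V : ℝ)) • ∑ j, g j x - (1 / (Fintype.card V : ℝ)) • ∑ j, g j y‖
      ≤ L * ‖x - y‖ := by
  rw [← smul_sub, ← Finset.sum_sub_distrib, norm_smul, Real.norm_of_nonneg (by positivity)]
  calc _ ≤ 1 / (Fintype.card V : ℝ) * ∑ _j : V, L * ‖x - y‖ := by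
        gcongr
        exact (norm_sum_le _ _).trans (Finset.sum_le_sum fun j _ => hg j x y)
    _ = _ := by simp

include hg in
omit [CompleteSpace E] in
-- Each g_j is compared only with itself at another point, so differences between workers play no
-- role.
theorem norm_pairMean_sub_sq_le (y : V → V → E) (z : E) :
    ‖pairMean (fun i j => g j (y i j)) - (1 / (Fintype.card V : ℝ)) • ∑ j, g j z‖ ^ 2
      ≤ L ^ 2 * pairMean fun i j => ‖y i j - z‖ ^ 2 := by
  rw [← pairMean_right (fun j => g j z), ← pairMean_sub, ← pairMean_mul]
  refine (norm_pairMean_sq_le _).trans (pairMean_mono fun i j => ?_)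
  rw [← mul_pow]
  exact pow_le_pow_left₀ (norm_nonneg _) (hg j _ _) 2

omit [InnerProductSpace ℝ E] [CompleteSpace E] in
theorem pairMean_norm_sub_sq_le (y : V → V → E) (x z : E) :
    (pairMean fun i j => ‖y i j - z‖ ^ 2) ≤ 2 * (pairMean fun i j => ‖y i j - x‖ ^ 2)
      + 2 * ‖x - z‖ ^ 2 := by
  rw [← pairMean_const (V := V) (2 * ‖x - z‖ ^ 2), ← pairMean_mul, ← pairMean_add]
  refine pairMean_mono fun i j => ?_
  have := norm_add_sq_le_two (y i j - x) (x - z)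
  rwa [sub_add_sub_cancel] at this

include hf hg in
-- Three kinds of points occur: y are the delayed models where gradients are evaluated, z is the
-- virtual iterate that moves, and x is the average at which the suboptimality is measured. The half
-- of the descent left after paying for η²‖m‖² is moved from z to x.
theorem convex_step {η μ : ℝ} (hL : 0 < L) (hη : 0 < η) (hηL : L * η ≤ 1 / 4) (hμ : 0 ≤ μ)
    (hμL : μ ≤ L)
    (hconv : ∀ j x y, f j x - f j y + μ / 2 * ‖x - y‖ ^ 2 ≤ ⟪g j x, x - y⟫_ℝ) {xs : E}
    (hxs : ∀ x, (1 / (Fintype.card V : ℝ)) * ∑ j, f j xs ≤ (1 / (Fintype.card V : ℝ)) * ∑ j, f j x)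
    (y : V → V → E) (x z : E) :
    ‖z - xs - η • pairMean (fun i j => g j (y i j))‖ ^ 2
      ≤ (1 - μ * η / 2) * ‖z - xs‖ ^ 2
        - η / 2 * ((1 / (Fintype.card V : ℝ)) * ∑ j, f j x
          - (1 / (Fintype.card V : ℝ)) * ∑ j, f j xs)
        + 6 * L * η * (pairMean fun i j => ‖y i j - x‖ ^ 2) + 7 * L * η * ‖x - z‖ ^ 2 := by
  set fb : E → ℝ := fun x => (1 / (Fintype.card V : ℝ)) * ∑ j, f j x with hfb
  set gb : E → E := fun x => (1 / (Fintype.card V : ℝ)) • ∑ j, g j x with hgb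
  set m := pairMean (fun i j => g j (y i j)) with hm
  set S := pairMean fun i j => ‖y i j - z‖ ^ 2 with hS
  have hS0 : 0 ≤ S := pairMean_nonneg fun _ _ => sq_nonneg _
  have hfg : ∀ x, HasGradientAt fb (gb x) x := hasGradientAt_mean hf
  have hgL : ∀ x y, ‖gb x - gb y‖ ≤ L * ‖x - y‖ := norm_mean_sub_le hg
  -- Smoothness leads from y to z and convexity from y to the minimizer, for the same f_j. Splitting
  -- ‖z - xs‖² at y halves the strong convexity term, whence μ/4.
  have hinner : fb z - fb xs - (L / 2 + μ / 2) * S + μ / 4 * ‖z - xs‖ ^ 2 ≤ ⟪m, z - xs⟫_ℝ := by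
    have h1 : ∀ i j, f j z - f j xs - (L / 2 + μ / 2) * ‖y i j - z‖ ^ 2 + μ / 4 * ‖z - xs‖ ^ 2
        ≤ ⟪g j (y i j), z - xs⟫_ℝ := by
      intro i j
      have e1 := descent_lemma (hf j) (hg j) (y i j) z
      have e2 := hconv j (y i j) xs
      have e3 : ⟪g j (y i j), z - xs⟫_ℝ
          = ⟪g j (y i j), z - y i j⟫_ℝ + ⟪g j (y i j), y i j - xs⟫_ℝ := by
        rw [← inner_add_right, sub_add_sub_cancel]
      have e4 := norm_add_sq_le_two (z - y i j) (y i j - xs)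
      rw [sub_add_sub_cancel] at e4
      rw [norm_sub_rev z (y i j)] at e1 e4
      nlinarith
    have h2 := pairMean_mono h1
    rw [pairMean_add, pairMean_sub, pairMean_mul, pairMean_const] at h2
    have h3 : pairMean (fun _ j : V => f j z - f j xs) = fb z - fb xs := by
      rw [pairMean_right, Finset.sum_sub_distrib, smul_sub]; rfl
    rw [h3] at h2
    rw [hm, inner_pairMean]
    exact h2
  have hmsq : ‖m‖ ^ 2 ≤ 2 * L ^ 2 * S + 4 * L * (fb z - fb xs) := by
    have e1 := norm_add_sq_le_two (m - gb z) (gb z)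
    rw [sub_add_cancel] at e1
    have e2 := norm_pairMean_sub_sq_le hg y z
    have e3 := norm_gradient_sq_le hL hfg hgL hxs z
    linarith
  -- Suboptimality at x is at most twice that at z plus a distance term, because the gradient at z
  -- is itself controlled by the suboptimality.
  have hfx : fb x - fb xs ≤ 2 * (fb z - fb xs) + L * ‖x - z‖ ^ 2 := by
    have e1 := descent_lemma hfg hgL z x
    have e2 := norm_gradient_sq_le hL hfg hgL hxs z
    have e3 := real_inner_le_norm (gb z) (x - z)
    have e4 : 0 ≤ (‖gb z‖ - L * ‖x - z‖) ^ 2 / (2 * L) := by positivity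
    have e5 : (‖gb z‖ - L * ‖x - z‖) ^ 2 / (2 * L)
        = ‖gb z‖ ^ 2 / (2 * L) - ‖gb z‖ * ‖x - z‖ + L / 2 * ‖x - z‖ ^ 2 := by
      field_simp
      ring
    have e6 : ‖gb z‖ ^ 2 / (2 * L) ≤ fb z - fb xs := by
      rw [div_le_iff₀ (by positivity)]; linarith
    linarith
  have hSx : S ≤ 2 * (pairMean fun i j => ‖y i j - x‖ ^ 2) + 2 * ‖x - z‖ ^ 2 :=
    pairMean_norm_sub_sq_le y x z
  have hz : 0 ≤ fb z - fb xs := sub_nonneg.2 (hxs z)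
  rw [norm_sub_sq_real, inner_smul_right, real_inner_comm, norm_smul, mul_pow,
    Real.norm_of_nonneg hη.le]
  have k1 : η ^ 2 * ‖m‖ ^ 2 ≤ L * η / 2 * S + η * (fb z - fb xs) := by
    calc η ^ 2 * ‖m‖ ^ 2 ≤ η ^ 2 * (2 * L ^ 2 * S + 4 * L * (fb z - fb xs)) := by gcongr
      _ = (L * η) * (2 * L * η * S) + (L * η) * (4 * η * (fb z - fb xs)) := by ring
      _ ≤ (1 / 4) * (2 * L * η * S) + (1 / 4) * (4 * η * (fb z - fb xs)) := by gcongr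
      _ = _ := by ring
  have k2 : η * (fb z - fb xs - (L / 2 + μ / 2) * S + μ / 4 * ‖z - xs‖ ^ 2)
      ≤ η * ⟪m, z - xs⟫_ℝ := by gcongr
  have k3 : η * (μ * S) ≤ η * (L * S) := by gcongr
  have k4 : L * η * S ≤ L * η * (2 * (pairMean fun i j => ‖y i j - x‖ ^ 2) + 2 * ‖x - z‖ ^ 2) := by
    gcongr
  have k5 : η * (fb x - fb xs) ≤ η * (2 * (fb z - fb xs) + L * ‖x - z‖ ^ 2) := by gcongr
  have k6 : 0 ≤ L * η * ‖x - z‖ ^ 2 := by positivity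
  have k7 : 0 ≤ L * η * pairMean fun i j => ‖y i j - x‖ ^ 2 :=
    mul_nonneg (by positivity) (pairMean_nonneg fun _ _ => sq_nonneg _)
  change _ ≤ (1 - μ * η / 2) * ‖z - xs‖ ^ 2 - η / 2 * (fb x - fb xs)
        + 6 * L * η * (pairMean fun i j => ‖y i j - x‖ ^ 2) + 7 * L * η * ‖x - z‖ ^ 2
  nlinarith

include hf hg in
-- Polarising the product of the exact delayed gradient with the gradient at z yields the descent.
-- The noise stays inside the step because f is not quadratic; its two inner products are kept
-- separate since their expectations will vanish.
theorem smooth_step {η : ℝ} (hη : 0 < η) (hηL : L * η ≤ 1)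
    (y : V → V → E) (x z ζ : E) :
    (1 / (Fintype.card V : ℝ)) * ∑ j, f j (z - η • (pairMean (fun i j => g j (y i j)) + ζ))
      ≤ (1 / (Fintype.card V : ℝ)) * ∑ j, f j z
        - η / 4 * ‖(1 / (Fintype.card V : ℝ)) • ∑ j, g j x‖ ^ 2
        + η * L ^ 2 * (pairMean fun i j => ‖y i j - x‖ ^ 2) + 3 / 2 * η * L ^ 2 * ‖x - z‖ ^ 2
        - η * ⟪(1 / (Fintype.card V : ℝ)) • ∑ j, g j z, ζ⟫_ℝ
        + L * η ^ 2 * ⟪pairMean (fun i j => g j (y i j)), ζ⟫_ℝ + L * η ^ 2 / 2 * ‖ζ‖ ^ 2 := by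
  set fb : E → ℝ := fun x => (1 / (Fintype.card V : ℝ)) * ∑ j, f j x with hfb
  set gb : E → E := fun x => (1 / (Fintype.card V : ℝ)) • ∑ j, g j x with hgb
  set m := pairMean (fun i j => g j (y i j)) with hm
  set S := pairMean fun i j => ‖y i j - z‖ ^ 2 with hS
  have hfg : ∀ x, HasGradientAt fb (gb x) x := hasGradientAt_mean hf
  have hgL : ∀ x y, ‖gb x - gb y‖ ≤ L * ‖x - y‖ := norm_mean_sub_le hg
  have e1 := descent_lemma hfg hgL z (z - η • (m + ζ))
  rw [sub_sub_cancel_left, inner_neg_right, norm_neg, inner_smul_right, inner_add_right, norm_smul,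
    mul_pow, Real.norm_of_nonneg hη.le, norm_add_sq_real] at e1
  have e2 : ‖m - gb z‖ ^ 2 ≤ L ^ 2 * S := norm_pairMean_sub_sq_le hg y z
  have e3 := norm_sub_sq_real m (gb z)
  rw [real_inner_comm] at e3
  have e4 : ‖gb x‖ ^ 2 ≤ 2 * ‖gb z‖ ^ 2 + 2 * (L ^ 2 * ‖x - z‖ ^ 2) := by
    have h1 := norm_add_sq_le_two (gb z) (gb x - gb z)
    rw [add_sub_cancel] at h1
    have h2 := pow_le_pow_left₀ (norm_nonneg _) (hgL x z) 2
    rw [mul_pow] at h2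
    linarith
  have hSx : S ≤ 2 * (pairMean fun i j => ‖y i j - x‖ ^ 2) + 2 * ‖x - z‖ ^ 2 :=
    pairMean_norm_sub_sq_le y x z
  have k1 : L * η * (η * ‖m‖ ^ 2) ≤ 1 * (η * ‖m‖ ^ 2) := by gcongr
  have k2 : η * ‖m - gb z‖ ^ 2
      ≤ η * (L ^ 2 * (2 * (pairMean fun i j => ‖y i j - x‖ ^ 2) + 2 * ‖x - z‖ ^ 2)) := by
    gcongr
    exact e2.trans (by gcongr)
  have k3 : η * ‖gb x‖ ^ 2 ≤ η * (2 * ‖gb z‖ ^ 2 + 2 * (L ^ 2 * ‖x - z‖ ^ 2)) := by gcongr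
  rw [e3] at k2
  change fb (z - η • (m + ζ)) ≤ fb z - η / 4 * ‖gb x‖ ^ 2
        + η * L ^ 2 * (pairMean fun i j => ‖y i j - x‖ ^ 2) + 3 / 2 * η * L ^ 2 * ‖x - z‖ ^ 2
        - η * ⟪gb z, ζ⟫_ℝ + L * η ^ 2 * ⟪m, ζ⟫_ℝ + L * η ^ 2 / 2 * ‖ζ‖ ^ 2
  linarith

end Step

/-! ### Measurability of the sample gradients -/

section Regularize

variable {d : ℕ} {S : Type*} [MeasurableSpace S]

local notation "E" => EuclideanSpace ℝ (Fin d)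

theorem norm_toDual_eq (x : E) : ‖InnerProductSpace.toDual ℝ E x‖ = ‖x‖ :=
  LinearIsometryEquiv.norm_map _ _

/-- Directional derivatives are limits of difference quotients with step 1/n, and the gradient is
assembled from those along an orthonormal basis. -/
theorem aemeasurable_gradient {μ : Measure S} {F : E → S → ℝ}
    (hF : ∀ x, AEMeasurable (F x) μ) (hd : ∀ᵐ ξ ∂μ, Differentiable ℝ fun x => F x ξ) (x : E) :
    AEMeasurable (fun ξ => ∇ (fun z => F z ξ) x) μ := by
  have h1 : ∀ v : E, AEMeasurable (fun ξ => ⟪v, ∇ (fun z => F z ξ) x⟫_ℝ) μ := by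
    intro v
    refine aemeasurable_of_tendsto_metrizable_ae (Filter.atTop (α := ℕ))
      (f := fun (n : ℕ) ξ => (n : ℝ) * (F (x + (n : ℝ)⁻¹ • v) ξ - F x ξ))
      (fun n => ((hF _).sub (hF x)).const_mul _) ?_
    filter_upwards [hd] with ξ hξ
    have h2 := ((hξ x).hasGradientAt.hasFDerivAt.lim_real v).comp tendsto_natCast_atTop_atTop
    rw [InnerProductSpace.toDual_apply_apply, real_inner_comm] at h2
    exact h2
  have h2 : (fun ξ => ∇ (fun z => F z ξ) x) = fun ξ => ∑ k,
      ⟪EuclideanSpace.basisFun (Fin d) ℝ k, ∇ (fun z => F z ξ) x⟫_ℝ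
        • EuclideanSpace.basisFun (Fin d) ℝ k := by
    ext1 ξ
    exact (OrthonormalBasis.sum_repr' _ _).symm
  rw [h2]
  exact Finset.aemeasurable_fun_sum _ fun k _ => (h1 _).smul_const _

/-- Losses that are smooth for almost every sample can be changed on a null set of samples so that
all of them are smooth and the gradient is jointly measurable. -/
theorem exists_regularization {μ : Measure S} {F : E → S → ℝ} {L : ℝ} (hL : 0 ≤ L)
    (hF : ∀ x, AEMeasurable (F x) μ)
    (hs : ∀ᵐ ξ ∂μ, Differentiable ℝ (fun x => F x ξ) ∧
      ∀ x y, ‖∇ (fun z => F z ξ) x - ∇ (fun z => F z ξ) y‖ ≤ L * ‖x - y‖) :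
    ∃ F' : E → S → ℝ, (∀ ξ, Differentiable ℝ fun x => F' x ξ) ∧
      (∀ ξ x y, ‖∇ (fun z => F' z ξ) x - ∇ (fun z => F' z ξ) y‖ ≤ L * ‖x - y‖) ∧
      Measurable (fun q : E × S => ∇ (fun z => F' z q.2) q.1) ∧
      ∀ᵐ ξ ∂μ, ∀ x, F' x ξ = F x ξ := by
  classical
  have hae := aemeasurable_gradient hF (hs.mono fun ξ h => h.1)
  set q := TopologicalSpace.denseSeq E
  have hall : ∀ᵐ ξ ∂μ, (Differentiable ℝ (fun x => F x ξ) ∧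
      ∀ x y, ‖∇ (fun z => F z ξ) x - ∇ (fun z => F z ξ) y‖ ≤ L * ‖x - y‖) ∧
      ∀ n, ∇ (fun z => F z ξ) (q n) = (hae (q n)).mk _ ξ :=
    hs.and (ae_all_iff.2 fun n => (hae (q n)).ae_eq_mk)
  -- On A the loss is smooth and its gradient agrees with measurable versions at a countable dense
  -- set of points. Outside A the loss is replaced by 0.
  obtain ⟨A, hAae, hAm, hA⟩ := hall.exists_measurable_mem
  have hgrad : ∀ ξ x, ∇ (fun z => if ξ ∈ A then F z ξ else 0) x
      = A.indicator (fun ξ => ∇ (fun z => F z ξ) x) ξ := by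
    intro ξ x
    by_cases h : ξ ∈ A
    · simp [h]
    · simp [h, gradient_fun_const]
  have hlip : ∀ ξ x y, ‖∇ (fun z => if ξ ∈ A then F z ξ else 0) x
      - ∇ (fun z => if ξ ∈ A then F z ξ else 0) y‖ ≤ L * ‖x - y‖ := by
    intro ξ x y
    rw [hgrad, hgrad]
    by_cases h : ξ ∈ A
    · simpa [h] using (hA ξ h).1.2 x y
    · simp only [h, not_false_eq_true, Set.indicator_of_notMem, sub_zero, norm_zero]
      positivity
  refine ⟨fun x ξ => if ξ ∈ A then F x ξ else 0, fun ξ => ?_, hlip, ?_, ?_⟩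
  · by_cases h : ξ ∈ A
    · simpa [h] using (hA ξ h).1.1
    · simp [h]
  -- Carathéodory argument: the gradient is continuous in x, and for fixed x it is measurable in ξ
  -- as a limit of its values along the dense sequence.
  · refine measurable_uncurry_of_continuous_of_measurable
      (u := fun x ξ => ∇ (fun z => if ξ ∈ A then F z ξ else 0) x) (fun ξ => ?_) fun x => ?_
    · exact (LipschitzWith.of_dist_le_mul (K := ⟨L, hL⟩) fun x y => by
        rw [dist_eq_norm, dist_eq_norm]; exact hlip ξ x y).continuous
    · simp only [hgrad]
      obtain ⟨u, hu, hux⟩ := mem_closure_iff_seq_limit.1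
        ((TopologicalSpace.denseRange_denseSeq E).closure_range ▸ Set.mem_univ x :
          x ∈ closure (Set.range q))
      choose n hn using hu
      obtain rfl : u = fun k => q (n k) := funext fun k => (hn k).symm
      refine measurable_of_tendsto_metrizable
        (f := fun k ξ => A.indicator ((hae (q (n k))).mk _) ξ)
        (fun k => (hae (q (n k))).measurable_mk.indicator hAm) ?_
      rw [tendsto_pi_nhds]
      intro ξ
      by_cases h : ξ ∈ A
      · simp only [h, Set.indicator_of_mem, ← (hA ξ h).2]
        have hc : Continuous fun y => ∇ (fun z => F z ξ) y :=
          (LipschitzWith.of_dist_le_mul (K := ⟨L, hL⟩) fun x y => by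
            rw [dist_eq_norm, dist_eq_norm]; exact (hA ξ h).1.2 x y).continuous
        exact (hc.tendsto x).comp hux
      · simp [h]
  · filter_upwards [hAae] with ξ hξ x
    exact if_pos hξ

/-- The expectation of a smooth random function is smooth, with the expected gradient. -/
theorem hasGradientAt_integral {μ : Measure S} [IsProbabilityMeasure μ] {F : E → S → ℝ} {L : ℝ}
    (hF : ∀ x, Integrable (F x) μ) (hd : ∀ ξ, Differentiable ℝ fun x => F x ξ)
    (hl : ∀ ξ x y, ‖∇ (fun z => F z ξ) x - ∇ (fun z => F z ξ) y‖ ≤ L * ‖x - y‖)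
    (hi : ∀ x, Integrable (fun ξ => ∇ (fun z => F z ξ) x) μ) (x : E) :
    HasGradientAt (fun x => ∫ ξ, F x ξ ∂μ) (∫ ξ, ∇ (fun z => F z ξ) x ∂μ) x := by
  have h1 := hasFDerivAt_integral_of_dominated_of_fderiv_le (μ := μ) (F := F) (x₀ := x)
    (F' := fun y ξ => InnerProductSpace.toDual ℝ E (∇ (fun z => F z ξ) y))
    -- On the unit ball around x the gradient differs from its value at x by at most |L|, which
    -- gives an integrable dominating function.
    (bound := fun ξ => ‖∇ (fun z => F z ξ) x‖ + |L|) (s := Metric.ball x 1)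
    (Metric.ball_mem_nhds x one_pos)
    (Filter.Eventually.of_forall fun y => (hF y).aestronglyMeasurable) (hF x)
    ((InnerProductSpace.toDual ℝ E).continuous.comp_aestronglyMeasurable
      (hi x).aestronglyMeasurable)
    (Filter.Eventually.of_forall fun ξ y hy => ?_) ((hi x).norm.add (integrable_const _))
    (Filter.Eventually.of_forall fun ξ y _ => (hd ξ y).hasGradientAt.hasFDerivAt)
  · have h2 : ∫ ξ, InnerProductSpace.toDual ℝ E (∇ (fun z => F z ξ) x) ∂μ
        = InnerProductSpace.toDual ℝ E (∫ ξ, ∇ (fun z => F z ξ) x ∂μ) := by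
      have hint : Integrable (fun ξ => InnerProductSpace.toDual ℝ E (∇ (fun z => F z ξ) x)) μ :=
        (hi x).mono ((InnerProductSpace.toDual ℝ E).continuous.comp_aestronglyMeasurable
          (hi x).aestronglyMeasurable) (Filter.Eventually.of_forall fun ξ => by
            rw [norm_toDual_eq])
      ext v
      rw [ContinuousLinearMap.integral_apply hint]
      simp only [InnerProductSpace.toDual_apply_apply]
      rw [real_inner_comm, ← integral_inner (hi x)]
      simp only [real_inner_comm]
    rw [h2] at h1
    exact h1
  · rw [norm_toDual_eq]
    have h3 := hl ξ y x
    have h4 : ‖y - x‖ ≤ 1 := by rw [← dist_eq_norm]; exact (Metric.mem_ball.1 hy).le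
    have h5 : L * ‖y - x‖ ≤ |L| := by
      have := le_abs_self L
      have := abs_nonneg L
      nlinarith [norm_nonneg (y - x)]
    have h6 := norm_le_norm_add_norm_sub' (∇ (fun z => F z ξ) y) (∇ (fun z => F z ξ) x)
    linarith

end Regularize

/-! ### Regular losses and the local objectives they define -/

section Regular

variable {V : Type*} {d : ℕ} {Ξ : V → Type*} [∀ i, MeasurableSpace (Ξ i)]

/-- Smoothness for every sample, with jointly measurable gradients and bounded noise. -/
structure IsRegular (D : ∀ i, Measure (Ξ i)) (F : ∀ i, EuclideanSpace ℝ (Fin d) → Ξ i → ℝ)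
    (L σ : ℝ) : Prop where
  nonneg : 0 ≤ L
  integrable : ∀ i x, Integrable (F i x) (D i)
  differentiable : ∀ i ξ, Differentiable ℝ fun x => F i x ξ
  lipschitz : ∀ i ξ x y, ‖∇ (fun z => F i z ξ) x - ∇ (fun z => F i z ξ) y‖ ≤ L * ‖x - y‖
  measurable : ∀ i, Measurable fun q : EuclideanSpace ℝ (Fin d) × Ξ i => ∇ (fun z => F i z q.2) q.1
  noise : BoundedNoise D F σ

theorem localObj_congr {D : ∀ i, Measure (Ξ i)} {F F' : ∀ i, EuclideanSpace ℝ (Fin d) → Ξ i → ℝ}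
    (h : ∀ i, ∀ᵐ ξ ∂(D i), ∀ x, F' i x ξ = F i x ξ) : localObj D F' = localObj D F := by
  ext i x
  exact integral_congr_ae ((h i).mono fun ξ hξ => hξ x)

theorem exists_isRegular {D : ∀ i, Measure (Ξ i)}
    {F : ∀ i, EuclideanSpace ℝ (Fin d) → Ξ i → ℝ} {L σ : ℝ}
    (hF : ∀ i x, Integrable (F i x) (D i)) (hL : LSmooth D F L) (hσ : BoundedNoise D F σ) :
    ∃ F', IsRegular D F' L σ ∧ ∀ i, ∀ᵐ ξ ∂(D i), ∀ x, F' i x ξ = F i x ξ := by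
  choose F' h1 h2 h3 h4 using fun i =>
    exists_regularization hL.1 (fun x => (hF i x).aemeasurable) (hL.2 i)
  refine ⟨F', ⟨hL.1, fun i x => ?_, h1, h2, h3, hσ.1, fun i x => ?_⟩, h4⟩
  · exact (hF i x).congr ((h4 i).mono fun ξ hξ => (hξ x).symm)
  · have h5 : (fun ξ => ‖∇ (fun z => F' i z ξ) x - ∇ (localObj D F' i) x‖ ^ 2) =ᵐ[D i]
        fun ξ => ‖∇ (fun z => F i z ξ) x - ∇ (localObj D F i) x‖ ^ 2 := by
      filter_upwards [h4 i] with ξ hξ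
      rw [localObj_congr h4, funext hξ]
    exact ⟨(hσ.2 i x).1.congr h5.symm, (integral_congr_ae h5).trans_le (hσ.2 i x).2⟩

namespace IsRegular

variable {D : ∀ i, Measure (Ξ i)} [∀ i, IsProbabilityMeasure (D i)]
  {F : ∀ i, EuclideanSpace ℝ (Fin d) → Ξ i → ℝ} {L σ : ℝ} (h : IsRegular D F L σ)
include h

omit [∀ i, IsProbabilityMeasure (D i)] in
theorem measurable_gradient (i : V) (x : EuclideanSpace ℝ (Fin d)) :
    Measurable fun ξ => ∇ (fun z => F i z ξ) x :=
  (h.measurable i).comp measurable_prodMk_left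

/-- The noise bound makes the gradient square integrable around a constant, whatever that constant
is. Thus integrability is available before the differentiability of `localObj` is known. -/
theorem integrable_gradient (i : V) (x : EuclideanSpace ℝ (Fin d)) :
    Integrable (fun ξ => ∇ (fun z => F i z ξ) x) (D i) := by
  have h1 : MemLp (fun ξ => ∇ (fun z => F i z ξ) x - ∇ (localObj D F i) x) 2 (D i) :=
    (memLp_two_iff_integrable_sq_norm
      ((h.measurable_gradient i x).sub_const _).aestronglyMeasurable).2 (h.noise.2 i x).1
  have h2 := (h1.integrable one_le_two).add (integrable_const (∇ (localObj D F i) x))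
  exact h2.congr (Filter.Eventually.of_forall fun ξ => by simp)

theorem hasGradientAt_localObj' (i : V) (x : EuclideanSpace ℝ (Fin d)) :
    HasGradientAt (localObj D F i) (∫ ξ, ∇ (fun z => F i z ξ) x ∂(D i)) x :=
  hasGradientAt_integral (h.integrable i) (h.differentiable i) (h.lipschitz i)
    (h.integrable_gradient i) x

theorem gradient_localObj (i : V) (x : EuclideanSpace ℝ (Fin d)) :
    ∇ (localObj D F i) x = ∫ ξ, ∇ (fun z => F i z ξ) x ∂(D i) :=
  (h.hasGradientAt_localObj' i x).gradient

theorem hasGradientAt_localObj (i : V) (x : EuclideanSpace ℝ (Fin d)) :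
    HasGradientAt (localObj D F i) (∇ (localObj D F i) x) x :=
  (h.hasGradientAt_localObj' i x).differentiableAt.hasGradientAt

theorem norm_gradient_localObj_sub_le (i : V) (x y : EuclideanSpace ℝ (Fin d)) :
    ‖∇ (localObj D F i) x - ∇ (localObj D F i) y‖ ≤ L * ‖x - y‖ := by
  rw [h.gradient_localObj, h.gradient_localObj,
    ← integral_sub (h.integrable_gradient i x) (h.integrable_gradient i y)]
  simpa using norm_integral_le_of_norm_le_const (μ := D i)
    (Filter.Eventually.of_forall fun ξ => h.lipschitz i ξ x y)

theorem integral_noise (i : V) (x : EuclideanSpace ℝ (Fin d)) :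
    ∫ ξ, (∇ (fun z => F i z ξ) x - ∇ (localObj D F i) x) ∂(D i) = 0 := by
  rw [integral_sub (h.integrable_gradient i x) (integrable_const _), h.gradient_localObj]
  simp

theorem continuous_gradient_localObj (i : V) : Continuous (∇ (localObj D F i)) :=
  (LipschitzWith.of_dist_le_mul (K := ⟨L, h.nonneg⟩) fun x y => by
    rw [dist_eq_norm, dist_eq_norm]; exact h.norm_gradient_localObj_sub_le i x y).continuous

end IsRegular

end Regular

/-! ### Independence of the noise -/

theorem integrable_inner_of_memLp {Ω E : Type*} [MeasurableSpace Ω] {P : Measure Ω}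
    [NormedAddCommGroup E] [InnerProductSpace ℝ E] {f g : Ω → E} (hf : MemLp f 2 P)
    (hg : MemLp g 2 P) : Integrable (fun ω => ⟪f ω, g ω⟫_ℝ) P := by
  refine (hf.norm.integrable_mul hg.norm).mono
    (hf.aestronglyMeasurable.inner hg.aestronglyMeasurable)
    (Filter.Eventually.of_forall fun ω => ?_)
  simpa using abs_real_inner_le_norm (f ω) (g ω)

theorem memLp_comp_of_lipschitz {Ω E : Type*} [MeasurableSpace Ω] {P : Measure Ω}
    [IsFiniteMeasure P] [NormedAddCommGroup E] {g : E → E} {L : ℝ} (hL : 0 ≤ L)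
    (hg : ∀ x y, ‖g x - g y‖ ≤ L * ‖x - y‖) {X : Ω → E} (hX : MemLp X 2 P) :
    MemLp (fun ω => g (X ω)) 2 P := by
  have hlip : LipschitzWith ⟨L, hL⟩ fun x => g x - g 0 := LipschitzWith.of_dist_le_mul fun x y => by
    rw [dist_eq_norm, dist_eq_norm, sub_sub_sub_cancel_right]
    exact hg x y
  have h := (hlip.comp_memLp (sub_self _) hX).add (memLp_const (g 0))
  refine (memLp_congr_ae (Filter.Eventually.of_forall fun ω => ?_)).1 h
  simp

/-- A trajectory of the relayed recursion with exact gradients `g` and centred noise `ζ`, the noise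
`ζ s i` being uncorrelated with everything measurable with respect to `past s i`. -/
structure NoisyRelay {V : Type*} [Fintype V] {d : ℕ} {Ω : Type*} [MeasurableSpace Ω]
    (G : SimpleGraph V) (P : Measure Ω)
    (g : V → EuclideanSpace ℝ (Fin d) → EuclideanSpace ℝ (Fin d))
    (x₀ : EuclideanSpace ℝ (Fin d)) (γ σ : ℝ) (past : ℤ → V → MeasurableSpace Ω)
    (X ζ : ℤ → V → Ω → EuclideanSpace ℝ (Fin d)) : Prop where
  relay : ∀ ω, IsRelay G x₀ γ (fun s i => X s i ω) fun s j => g j (X s j ω) + ζ s j ω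
  memLp : ∀ s i, MemLp (X s i) 2 P
  memLp_noise : ∀ s i, MemLp (ζ s i) 2 P
  noise_le : ∀ s i, ∫ ω, ‖ζ s i ω‖ ^ 2 ∂P ≤ σ ^ 2
  measurable : ∀ s i r k, r ≤ s → Measurable[past s i] (X r k)
  measurable_noise : ∀ s i r k, r ≤ s → (k, r) ≠ (i, s) → Measurable[past s i] (ζ r k)
  orthogonal : ∀ s i (H : Ω → EuclideanSpace ℝ (Fin d)), Measurable[past s i] H → MemLp H 2 P →
    ∫ ω, ⟪ζ s i ω, H ω⟫_ℝ ∂P = 0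

section Sampling

variable {V : Type*} {d : ℕ} {Ξ : V → Type*} [∀ i, MeasurableSpace (Ξ i)] {Ω : Type*}

/-- The information contained in a set of samples. -/
def sampleInfo (ξ : ∀ i, ℤ → Ω → Ξ i) (S : Set (V × ℤ)) : MeasurableSpace Ω :=
  ⨆ q ∈ S, MeasurableSpace.comap (ξ q.1 q.2) inferInstance

theorem sampleInfo_mono (ξ : ∀ i, ℤ → Ω → Ξ i) {S T : Set (V × ℤ)} (h : S ⊆ T) :
    sampleInfo ξ S ≤ sampleInfo ξ T := biSup_mono h

theorem measurable_sampleInfo (ξ : ∀ i, ℤ → Ω → Ξ i) {S : Set (V × ℤ)} {j : V} {s : ℤ}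
    (h : (j, s) ∈ S) : Measurable[sampleInfo ξ S] (ξ j s) := by
  rw [measurable_iff_comap_le]
  exact le_biSup (fun q : V × ℤ => MeasurableSpace.comap (ξ q.1 q.2) inferInstance) h

variable [Fintype V] {G : SimpleGraph V} [MeasurableSpace Ω] {P : Measure Ω} [IsProbabilityMeasure P]
  {D : ∀ i, Measure (Ξ i)} [∀ i, IsProbabilityMeasure (D i)]
  {F : ∀ i, EuclideanSpace ℝ (Fin d) → Ξ i → ℝ} {L σ : ℝ} {ξ : ∀ i, ℤ → Ω → Ξ i}

omit [Fintype V] [IsProbabilityMeasure P] [∀ i, IsProbabilityMeasure (D i)] in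
theorem sampleInfo_le (hξ : IsSampling P D ξ) (S : Set (V × ℤ)) :
    sampleInfo ξ S ≤ ‹MeasurableSpace Ω› :=
  iSup₂_le fun q _ => (hξ.1 q.1 q.2).comap_le

omit [∀ i, MeasurableSpace (Ξ i)] in
theorem model_nonpos (x₀ : EuclideanSpace ℝ (Fin d)) (γ : ℝ) (u : ∀ i, ℤ → Ξ i) {s : ℤ} (hs : s ≤ 0)
    (i : V) : model G F x₀ γ u s i = x₀ := by
  rw [model, dif_neg (not_lt.2 hs)]

omit [∀ i, MeasurableSpace (Ξ i)] in
theorem model_pos (x₀ : EuclideanSpace ℝ (Fin d)) (γ : ℝ) (u : ∀ i, ℤ → Ξ i) {s : ℤ} (hs : 0 < s)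
    (i : V) : model G F x₀ γ u s i = (1 / (Fintype.card V : ℝ)) • ∑ j,
      (model G F x₀ γ u (s - 1 - (G.dist i j : ℤ)) j
        - γ • ∇ (fun z => F j z (u j (s - 1 - (G.dist i j : ℤ))))
            (model G F x₀ γ u (s - 1 - (G.dist i j : ℤ)) j)) := by
  rw [model, dif_pos hs]

omit [Fintype V] in
/-- Induction along the recursion for the models. -/
theorem model_induction (G : SimpleGraph V) {p : ℤ → Prop} (h0 : ∀ s ≤ 0, p s)
    (h1 : ∀ s, 0 < s → (∀ i j, p (s - 1 - (G.dist i j : ℤ))) → p s) (s : ℤ) : p s := by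
  have key : ∀ N : ℕ, ∀ s : ℤ, s.toNat ≤ N → p s := by
    intro N
    induction N with
    | zero => exact fun s hs => h0 s (by omega)
    | succ N ih =>
      intro s hs
      rcases le_or_gt s 0 with h | h
      · exact h0 s h
      · exact h1 s h fun i j => ih _ (by omega)
  exact key _ s le_rfl

omit [MeasurableSpace Ω] [∀ i, IsProbabilityMeasure (D i)] in
theorem measurable_model (hF : IsRegular D F L σ) (x₀ : EuclideanSpace ℝ (Fin d)) (γ : ℝ) (s : ℤ) :
    ∀ i, Measurable[sampleInfo ξ {q | q.2 < s}]
      fun ω => model G F x₀ γ (fun i s => ξ i s ω) s i := by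
  refine model_induction G (p := fun s => ∀ i, Measurable[sampleInfo ξ {q | q.2 < s}]
      fun ω => model G F x₀ γ (fun i s => ξ i s ω) s i) (fun s hs i => ?_) (fun s hs ih i => ?_) s
  · simp only [model_nonpos x₀ γ _ hs]
    exact measurable_const
  · simp only [model_pos x₀ γ _ hs]
    suffices h : ∀ j, Measurable[sampleInfo ξ {q | q.2 < s}] fun ω =>
        model G F x₀ γ (fun i s => ξ i s ω) (s - 1 - (G.dist i j : ℤ)) j
          - γ • ∇ (fun z => F j z (ξ j (s - 1 - (G.dist i j : ℤ)) ω))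
            (model G F x₀ γ (fun i s => ξ i s ω) (s - 1 - (G.dist i j : ℤ)) j) from
      (Finset.measurable_fun_sum Finset.univ fun j _ => h j).const_smul
        (1 / (Fintype.card V : ℝ))
    intro j
    have hle : sampleInfo ξ {q | q.2 < s - 1 - (G.dist i j : ℤ)} ≤ sampleInfo ξ {q | q.2 < s} :=
      sampleInfo_mono ξ fun q hq => by simp only [Set.mem_ofPred_eq] at hq ⊢; omega
    have h1 := (ih i j j).mono hle le_rfl
    have h2 : Measurable[sampleInfo ξ {q | q.2 < s}] (ξ j (s - 1 - (G.dist i j : ℤ))) :=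
      measurable_sampleInfo ξ (by simp only [Set.mem_ofPred_eq]; omega)
    exact h1.sub (((hF.measurable j).comp (h1.prodMk h2)).const_smul γ)

omit [Fintype V] [∀ i, IsProbabilityMeasure (D i)] in
-- Independence of one sample from all others, as a product law: Z may be frozen while the sample is
-- integrated out.
theorem map_prodMk_sample {β : Type*} [MeasurableSpace β] (hξ : IsSampling P D ξ) {j : V} {s : ℤ}
    {Z : Ω → β} (hZ : Measurable[sampleInfo ξ {(j, s)}ᶜ] Z) :
    P.map (fun ω => (Z ω, ξ j s ω)) = (P.map Z).prod (D j) := by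
  have h1 := indep_iSup_of_disjoint (m := fun q : V × ℤ =>
      MeasurableSpace.comap (ξ q.1 q.2) inferInstance)
    (fun q => (hξ.1 q.1 q.2).comap_le) hξ.2.2.iIndep
    (disjoint_compl_left (a := ({(j, s)} : Set (V × ℤ))))
  have h2 : IndepFun Z (ξ j s) P := by
    rw [IndepFun_iff_Indep]
    refine indep_of_indep_of_le_left (indep_of_indep_of_le_right h1 ?_) hZ.comap_le
    exact le_biSup (fun q : V × ℤ => MeasurableSpace.comap (ξ q.1 q.2) inferInstance)
      (Set.mem_singleton (j, s))
  rw [(indepFun_iff_map_prod_eq_prod_map_map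
    (hZ.mono (sampleInfo_le hξ _) le_rfl).aemeasurable (hξ.1 j s).aemeasurable).1 h2, hξ.2.1]

/-- The noise of the stochastic gradient of worker `j` at the point `x`. -/
@[irreducible] def gradNoise (D : ∀ i, Measure (Ξ i)) (F : ∀ i, EuclideanSpace ℝ (Fin d) → Ξ i → ℝ) (j : V)
    (x : EuclideanSpace ℝ (Fin d)) (u : Ξ j) : EuclideanSpace ℝ (Fin d) :=
  ∇ (fun z => F j z u) x - ∇ (localObj D F j) x

omit [Fintype V] in
theorem measurable_gradNoise (hF : IsRegular D F L σ) (j : V) :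
    Measurable fun q : EuclideanSpace ℝ (Fin d) × Ξ j => gradNoise D F j q.1 q.2 := by
  simp only [gradNoise]
  exact (hF.measurable j).sub ((hF.continuous_gradient_localObj j).measurable.comp measurable_fst)

omit [Fintype V] in
-- By Tonelli over the product law, the variance bound holds for each frozen value of Z, uniformly.
theorem gradNoise_memLp (hF : IsRegular D F L σ) (hξ : IsSampling P D ξ) {j : V} {s : ℤ}
    {Z : Ω → EuclideanSpace ℝ (Fin d)} (hZ : Measurable[sampleInfo ξ {(j, s)}ᶜ] Z) :
    MemLp (fun ω => gradNoise D F j (Z ω) (ξ j s ω)) 2 P ∧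
      ∫ ω, ‖gradNoise D F j (Z ω) (ξ j s ω)‖ ^ 2 ∂P ≤ σ ^ 2 := by
  have hZm := hZ.mono (sampleInfo_le hξ _) le_rfl
  have hZP : IsProbabilityMeasure (P.map Z) := Measure.isProbabilityMeasure_map hZm.aemeasurable
  have hmeas : Measurable fun ω => gradNoise D F j (Z ω) (ξ j s ω) :=
    (measurable_gradNoise hF j).comp (hZm.prodMk (hξ.1 j s))
  have hmeas2 : Measurable fun q : EuclideanSpace ℝ (Fin d) × Ξ j =>
      ENNReal.ofReal (‖gradNoise D F j q.1 q.2‖ ^ 2) :=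
    ((measurable_gradNoise hF j).norm.pow_const 2).ennreal_ofReal
  have hle : ∫⁻ ω, ENNReal.ofReal (‖gradNoise D F j (Z ω) (ξ j s ω)‖ ^ 2) ∂P
      ≤ ENNReal.ofReal (σ ^ 2) := by
    rw [← lintegral_map (μ := P) (g := fun ω => (Z ω, ξ j s ω)) hmeas2 (hZm.prodMk (hξ.1 j s)),
      map_prodMk_sample hξ hZ, lintegral_prod _ hmeas2.aemeasurable]
    calc _ ≤ ∫⁻ _x, ENNReal.ofReal (σ ^ 2) ∂(P.map Z) := by
          refine lintegral_mono fun x => ?_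
          have hx : Integrable (fun u => ‖gradNoise D F j x u‖ ^ 2) (D j)
              ∧ ∫ u, ‖gradNoise D F j x u‖ ^ 2 ∂(D j) ≤ σ ^ 2 := by
            simp only [gradNoise]
            exact hF.noise.2 j x
          rw [← ofReal_integral_eq_lintegral_ofReal hx.1
            (Filter.Eventually.of_forall fun _ => sq_nonneg _)]
          exact ENNReal.ofReal_le_ofReal hx.2
      _ = _ := by simp
  refine ⟨?_, ?_⟩
  · rw [memLp_two_iff_integrable_sq_norm hmeas.aestronglyMeasurable]
    exact (lintegral_ofReal_ne_top_iff_integrable (hmeas.norm.pow_const 2).aestronglyMeasurable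
      (Filter.Eventually.of_forall fun _ => sq_nonneg _)).1
      (hle.trans_lt ENNReal.ofReal_lt_top).ne
  · rw [integral_eq_lintegral_of_nonneg_ae (Filter.Eventually.of_forall fun _ => sq_nonneg _)
      (hmeas.norm.pow_const 2).aestronglyMeasurable]
    exact ENNReal.toReal_le_of_le_ofReal (sq_nonneg _) hle

omit [Fintype V] in
-- With Z and H frozen, the noise has mean zero. Fubini applies because both factors are square
-- integrable.
theorem gradNoise_orthogonal (hF : IsRegular D F L σ) (hξ : IsSampling P D ξ) {j : V} {s : ℤ}
    {Z H : Ω → EuclideanSpace ℝ (Fin d)} (hZ : Measurable[sampleInfo ξ {(j, s)}ᶜ] Z)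
    (hH : Measurable[sampleInfo ξ {(j, s)}ᶜ] H) (hH2 : MemLp H 2 P) :
    ∫ ω, ⟪gradNoise D F j (Z ω) (ξ j s ω), H ω⟫_ℝ ∂P = 0 := by
  have hZH : Measurable[sampleInfo ξ {(j, s)}ᶜ] fun ω => (Z ω, H ω) := hZ.prodMk hH
  have hm := hZH.mono (sampleInfo_le hξ _) le_rfl
  have hP : IsProbabilityMeasure (P.map fun ω => (Z ω, H ω)) :=
    Measure.isProbabilityMeasure_map hm.aemeasurable
  have hmeas : Measurable fun q : (EuclideanSpace ℝ (Fin d) × EuclideanSpace ℝ (Fin d)) × Ξ j =>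
      ⟪gradNoise D F j q.1.1 q.2, q.1.2⟫_ℝ :=
    ((measurable_gradNoise hF j).comp
      ((measurable_fst.comp measurable_fst).prodMk measurable_snd)).inner
      (measurable_snd.comp measurable_fst)
  have hpair := hm.prodMk (hξ.1 j s)
  have hint : Integrable (fun q : (EuclideanSpace ℝ (Fin d) × EuclideanSpace ℝ (Fin d)) × Ξ j =>
      ⟪gradNoise D F j q.1.1 q.2, q.1.2⟫_ℝ) ((P.map fun ω => (Z ω, H ω)).prod (D j)) := by
    rw [← map_prodMk_sample hξ hZH,
      integrable_map_measure hmeas.aestronglyMeasurable hpair.aemeasurable]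
    exact integrable_inner_of_memLp (gradNoise_memLp hF hξ hZ).1 hH2
  have h1 := integral_map (μ := P) hpair.aemeasurable
    (f := fun q : (EuclideanSpace ℝ (Fin d) × EuclideanSpace ℝ (Fin d)) × Ξ j =>
      ⟪gradNoise D F j q.1.1 q.2, q.1.2⟫_ℝ) hmeas.aestronglyMeasurable
  rw [← h1, map_prodMk_sample hξ hZH, integral_prod _ hint]
  refine integral_eq_zero_of_ae (Filter.Eventually.of_forall fun q => ?_)
  have h2 : Integrable (fun u => gradNoise D F j q.1 u) (D j) :=
by
    simp only [gradNoise]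
    exact (hF.integrable_gradient j q.1).sub (integrable_const _)
  simp only [real_inner_comm q.2, integral_inner h2]
  have h3 : ∫ u, gradNoise D F j q.1 u ∂(D j) = 0 := by
    simp only [gradNoise]
    exact hF.integral_noise j q.1
  rw [h3]
  simp

/-- The information `past s i` is generated by all samples except (i, s), including later ones and
those of other workers at time s. Models up to time s use only earlier samples, so they never see
(i, s). Two noises with different labels are orthogonal because one of them is measurable for the
other's past. -/
theorem noisyRelay_model (hF : IsRegular D F L σ) (hξ : IsSampling P D ξ)
    (x₀ : EuclideanSpace ℝ (Fin d)) (γ : ℝ) :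
    NoisyRelay G P (fun j => ∇ (localObj D F j)) x₀ γ σ (fun s i => sampleInfo ξ {(i, s)}ᶜ)
      (fun s i ω => model G F x₀ γ (fun i s => ξ i s ω) s i)
      (fun s i ω => gradNoise D F i (model G F x₀ γ (fun i s => ξ i s ω) s i) (ξ i s ω)) := by
  have hpast : ∀ s i r k, r ≤ s → Measurable[sampleInfo ξ {(i, s)}ᶜ]
      fun ω => model G F x₀ γ (fun i s => ξ i s ω) r k := by
    intro s i r k hrs
    refine (measurable_model hF x₀ γ r k).mono (sampleInfo_mono ξ ?_) le_rfl
    rintro ⟨k, q⟩ hq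
    simp only [Set.mem_ofPred_eq] at hq
    simp only [Set.mem_compl_iff, Set.mem_singleton_iff, Prod.mk.injEq, not_and]
    omega
  have hnoise := fun s i => gradNoise_memLp hF hξ (hpast s i s i le_rfl)
  refine ⟨fun ω => ⟨fun s hs i => model_nonpos x₀ γ _ hs i, fun t i => ?_⟩, fun s => ?_,
    fun s i => (hnoise s i).1, fun s i => (hnoise s i).2, hpast, ?_,
    fun s i H hH hH2 => gradNoise_orthogonal hF hξ (hpast s i s i le_rfl) hH hH2⟩
  · have ht : (0 : ℤ) < t + 1 := by omega
    simp only [model_pos x₀ γ _ ht]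
    simp only [add_sub_cancel_right, gradNoise, add_sub_cancel]
  · refine model_induction G (p := fun s => ∀ i,
      MemLp (fun ω => model G F x₀ γ (fun i s => ξ i s ω) s i) 2 P) (fun s hs i => ?_)
      (fun s hs ih i => ?_) s
    · simp only [model_nonpos x₀ γ _ hs]
      exact memLp_const _
    · simp only [model_pos x₀ γ _ hs]
      suffices h : ∀ j, MemLp (fun ω => model G F x₀ γ (fun i s => ξ i s ω)
          (s - 1 - (G.dist i j : ℤ)) j - γ • ∇ (fun z => F j z (ξ j (s - 1 - (G.dist i j : ℤ)) ω))
            (model G F x₀ γ (fun i s => ξ i s ω) (s - 1 - (G.dist i j : ℤ)) j)) 2 P from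
        (memLp_finsetSum Finset.univ fun j _ => h j).const_smul (1 / (Fintype.card V : ℝ))
      intro j
      have h1 := ih i j j
      have h2 := (hnoise (s - 1 - (G.dist i j : ℤ)) j).1
      set r := s - 1 - (G.dist i j : ℤ)
      have h3 : MemLp (fun ω => ∇ (localObj D F j) (model G F x₀ γ (fun i s => ξ i s ω) r j)) 2 P :=
        memLp_comp_of_lipschitz hF.nonneg (hF.norm_gradient_localObj_sub_le j) h1
      have h4 : ∀ ω, ∇ (fun z => F j z (ξ j r ω)) (model G F x₀ γ (fun i s => ξ i s ω) r j)
          = gradNoise D F j (model G F x₀ γ (fun i s => ξ i s ω) r j) (ξ j r ω)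
            + ∇ (localObj D F j) (model G F x₀ γ (fun i s => ξ i s ω) r j) := fun ω => by
        simp only [gradNoise, sub_add_cancel]
      simp only [h4]
      exact h1.sub ((h2.add h3).const_smul γ)
  · intro s i r k hrs hne
    refine (measurable_gradNoise hF k).comp ((hpast s i r k hrs).prodMk ?_)
    exact measurable_sampleInfo ξ (by simpa using hne)

end Sampling

/-! ### Expectations along a noisy trajectory -/

/-- Delaying a sum by k changes only its two ends: it gains the k terms before time 0 and loses the
last k terms. -/
theorem sum_shift_sub {M : Type*} [AddCommGroup M] (a : ℤ → M) (k t : ℕ) :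
    ∑ s ∈ Finset.range t, a ((s : ℤ) - k) - ∑ s ∈ Finset.range t, a s
      = ∑ l ∈ Finset.range k, a ((l : ℤ) - k) - ∑ l ∈ Finset.range k, a ((t : ℤ) - k + l) := by
  induction t with
  | zero => simp [neg_add_eq_sub]
  | succ t ih =>
    have h1 := Finset.sum_range_sub (fun l : ℕ => a ((t : ℤ) - k + l)) k
    rw [Finset.sum_sub_distrib] at h1
    have h2 : ∑ l ∈ Finset.range k, a (((t + 1 : ℕ) : ℤ) - k + l)
        = ∑ l ∈ Finset.range k, a ((t : ℤ) - k + (l + 1 : ℕ)) := by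
      refine Finset.sum_congr rfl fun l _ => ?_
      congr 1
      push_cast
      ring
    rw [Finset.sum_range_succ, Finset.sum_range_succ, h2]
    have h3 : (t : ℤ) - k + (k : ℕ) = t := by ring
    have h4 : (t : ℤ) - k + (0 : ℕ) = t - k := by simp
    rw [h3, h4] at h1
    rw [eq_add_of_sub_eq h1, add_sub_add_comm, ih]
    abel

theorem integrable_norm_sq {Ω E : Type*} [MeasurableSpace Ω] {P : Measure Ω}
    [NormedAddCommGroup E] {f : Ω → E} (hf : MemLp f 2 P) : Integrable (fun ω => ‖f ω‖ ^ 2) P :=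
  (memLp_two_iff_integrable_sq_norm hf.aestronglyMeasurable).1 hf

/-- Smoothness used in both directions squeezes f(X) between integrable expressions in X and g(X).
-/
theorem integrable_comp_of_smooth {Ω : Type*} [MeasurableSpace Ω] {P : Measure Ω}
    [IsProbabilityMeasure P] {d : ℕ} {f : EuclideanSpace ℝ (Fin d) → ℝ}
    {g : EuclideanSpace ℝ (Fin d) → EuclideanSpace ℝ (Fin d)} {L : ℝ} (hL : 0 ≤ L)
    (hf : ∀ x, HasGradientAt f (g x) x) (hg : ∀ x y, ‖g x - g y‖ ≤ L * ‖x - y‖)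
    {X : Ω → EuclideanSpace ℝ (Fin d)} (hX : MemLp X 2 P) : Integrable (fun ω => f (X ω)) P := by
  have hc : Continuous f := continuous_iff_continuousAt.2 fun x => (hf x).differentiableAt.continuousAt
  have hsq : Integrable (fun ω => ‖X ω‖ ^ 2) P :=
    integrable_norm_sq hX
  have h1 : Integrable (fun ω => f 0 + ⟪g 0, X ω⟫_ℝ + L / 2 * ‖X ω‖ ^ 2) P :=
    ((integrable_const _).add (integrable_inner_of_memLp (memLp_const _) hX)).add (hsq.const_mul _)
  have h2 : Integrable (fun ω => f 0 + ⟪g (X ω), X ω⟫_ℝ - L / 2 * ‖X ω‖ ^ 2) P :=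
    ((integrable_const _).add (integrable_inner_of_memLp (memLp_comp_of_lipschitz hL hg hX) hX)).sub
      (hsq.const_mul _)
  refine (h1.norm.add h2.norm).mono' (hc.comp_aestronglyMeasurable hX.aestronglyMeasurable)
    (Filter.Eventually.of_forall fun ω => ?_)
  have e1 := descent_lemma hf hg 0 (X ω)
  have e2 := descent_lemma hf hg (X ω) 0
  rw [sub_zero] at e1
  rw [zero_sub, norm_neg, inner_neg_right] at e2
  simp only [Pi.add_apply, Real.norm_eq_abs]
  have a1 := le_abs_self (f 0 + ⟪g 0, X ω⟫_ℝ + L / 2 * ‖X ω‖ ^ 2)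
  have a2 := neg_abs_le (f 0 + ⟪g (X ω), X ω⟫_ℝ - L / 2 * ‖X ω‖ ^ 2)
  have a3 := abs_nonneg (f 0 + ⟪g 0, X ω⟫_ℝ + L / 2 * ‖X ω‖ ^ 2)
  have a4 := abs_nonneg (f 0 + ⟪g (X ω), X ω⟫_ℝ - L / 2 * ‖X ω‖ ^ 2)
  rw [abs_le]
  constructor <;> linarith

section Noisy

variable {V : Type*} [Fintype V] {d : ℕ} {Ω : Type*} [MeasurableSpace Ω]
  {G : SimpleGraph V} {P : Measure Ω} [IsProbabilityMeasure P]
  {g : V → EuclideanSpace ℝ (Fin d) → EuclideanSpace ℝ (Fin d)}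
  {x₀ : EuclideanSpace ℝ (Fin d)} {γ σ : ℝ} {past : ℤ → V → MeasurableSpace Ω}
  {X ζ : ℤ → V → Ω → EuclideanSpace ℝ (Fin d)}

/-- The averaged iterate. -/
def avgIter (G : SimpleGraph V) (π : Idx G → ℝ) (X : ℤ → V → Ω → EuclideanSpace ℝ (Fin d)) (t : ℕ)
    (ω : Ω) : EuclideanSpace ℝ (Fin d) := wmean π (stack G (fun s i => X s i ω) t)

/-- The averaged exact gradient, at the delayed iterates. -/
def delayedGrad (G : SimpleGraph V) (g : V → EuclideanSpace ℝ (Fin d) → EuclideanSpace ℝ (Fin d))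
    (X : ℤ → V → Ω → EuclideanSpace ℝ (Fin d)) (t : ℕ) (ω : Ω) : EuclideanSpace ℝ (Fin d) :=
  pairMean fun i j => g j (X ((t : ℤ) - G.dist i j) j ω)

/-- The averaged noise of time `t`. -/
def meanNoise (ζ : ℤ → V → Ω → EuclideanSpace ℝ (Fin d)) (t : ℕ) (ω : Ω) :
    EuclideanSpace ℝ (Fin d) := (1 / (Fintype.card V : ℝ)) • ∑ j, ζ t j ω

/-- The virtual iterate, which has received the noise of every time `s < t` without delay. -/
def virtIter (G : SimpleGraph V) (π : Idx G → ℝ) (γ : ℝ)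
    (X ζ : ℤ → V → Ω → EuclideanSpace ℝ (Fin d)) (t : ℕ) (ω : Ω) : EuclideanSpace ℝ (Fin d) :=
  avgIter G π X t ω + (γ * headMass π) • pairMean fun i j =>
    (∑ s ∈ Finset.range t, ζ ((s : ℤ) - G.dist i j) j ω - ∑ s ∈ Finset.range t, ζ s j ω)

namespace NoisyRelay

variable (h : NoisyRelay G P g x₀ γ σ past X ζ)
include h

omit [IsProbabilityMeasure P] in
theorem integrable_noise_sq (s : ℤ) (i : V) : Integrable (fun ω => ‖ζ s i ω‖ ^ 2) P :=
  integrable_norm_sq (h.memLp_noise s i)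

omit [IsProbabilityMeasure P] in
theorem integral_inner_noise {s r : ℤ} {i k : V} (hne : (k, r) ≠ (i, s)) :
    ∫ ω, ⟪ζ s i ω, ζ r k ω⟫_ℝ ∂P = 0 := by
  rcases le_total r s with hrs | hrs
  · exact h.orthogonal s i _ (h.measurable_noise s i r k hrs hne) (h.memLp_noise r k)
  · simp only [real_inner_comm (ζ r k _)]
    exact h.orthogonal r k _ (h.measurable_noise r k s i hrs hne.symm) (h.memLp_noise s i)

omit [IsProbabilityMeasure P] in
-- Noises with distinct labels are orthogonal, so their variances add. Injectivity of `e` excludes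
-- repeated samples.
theorem integral_norm_sq_noise_sum_le {κ : Type*} (S : Finset κ) {e : κ → V × ℤ}
    (he : Set.InjOn e S) :
    ∫ ω, ‖∑ k ∈ S, ζ (e k).2 (e k).1 ω‖ ^ 2 ∂P ≤ S.card * σ ^ 2 := by
  classical
  induction S using Finset.induction_on with
  | empty => simp
  | insert k S hk ih =>
    have ih' := ih (he.mono (by simp))
    have hS : MemLp (fun ω => ∑ k ∈ S, ζ (e k).2 (e k).1 ω) 2 P :=
      memLp_finsetSum _ fun k _ => h.memLp_noise _ _
    have hSq := integrable_norm_sq hS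
    have hin : ∫ ω, ⟪ζ (e k).2 (e k).1 ω, ∑ k ∈ S, ζ (e k).2 (e k).1 ω⟫_ℝ ∂P = 0 := by
      simp only [inner_sum]
      rw [integral_finsetSum _ fun l _ => integrable_inner_of_memLp (h.memLp_noise _ _)
        (h.memLp_noise _ _)]
      refine Finset.sum_eq_zero fun l hl => h.integral_inner_noise fun heq => hk ?_
      have : l = k := he (by simp [hl]) (by simp) heq
      exact this ▸ hl
    have hini : Integrable (fun ω => 2 * ⟪ζ (e k).2 (e k).1 ω, ∑ k ∈ S, ζ (e k).2 (e k).1 ω⟫_ℝ) P :=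
      (integrable_inner_of_memLp (h.memLp_noise _ _) hS).const_mul 2
    simp only [Finset.sum_insert hk, norm_add_sq_real]
    have hadd : Integrable (fun ω => ‖ζ (e k).2 (e k).1 ω‖ ^ 2
        + 2 * ⟪ζ (e k).2 (e k).1 ω, ∑ k ∈ S, ζ (e k).2 (e k).1 ω⟫_ℝ) P :=
      (h.integrable_noise_sq _ _).add hini
    rw [integral_add hadd hSq,
      integral_add (h.integrable_noise_sq _ _) hini, integral_const_mul, hin,
      Finset.card_insert_of_notMem hk]
    have := h.noise_le (e k).2 (e k).1
    push_cast
    linarith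

omit [IsProbabilityMeasure P] in
theorem memLp_meanNoise (t : ℕ) : MemLp (meanNoise ζ t) 2 P :=
  (memLp_finsetSum Finset.univ fun j _ => h.memLp_noise t j).const_smul (1 / (Fintype.card V : ℝ))

theorem integral_norm_sq_meanNoise_le [Nonempty V] (t : ℕ) :
    ∫ ω, ‖meanNoise ζ t ω‖ ^ 2 ∂P ≤ σ ^ 2 / Fintype.card V := by
  have h1 := h.integral_norm_sq_noise_sum_le (Finset.univ : Finset V) (e := fun j => (j, (t : ℤ)))
    (fun a _ b _ hab => (Prod.mk.inj hab).1)
  simp only [meanNoise, norm_smul, mul_pow]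
  rw [integral_const_mul, Real.norm_of_nonneg (by positivity)]
  calc _ ≤ (1 / (Fintype.card V : ℝ)) ^ 2 * ((Finset.univ : Finset V).card * σ ^ 2) := by gcongr
    _ = _ := by rw [Finset.card_univ]; field_simp

omit [IsProbabilityMeasure P] in
theorem integral_inner_meanNoise {t : ℕ} {H : Ω → EuclideanSpace ℝ (Fin d)}
    (hH : ∀ i, Measurable[past t i] H) (hH2 : MemLp H 2 P) :
    ∫ ω, ⟪H ω, meanNoise ζ t ω⟫_ℝ ∂P = 0 := by
  simp only [meanNoise, inner_smul_right, inner_sum]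
  rw [integral_const_mul, integral_finsetSum _ fun j _ =>
    integrable_inner_of_memLp hH2 (h.memLp_noise t j), Finset.sum_eq_zero, mul_zero]
  intro j _
  simp only [real_inner_comm (ζ _ _ _)]
  exact h.orthogonal t j H (hH j) hH2

omit [IsProbabilityMeasure P] in
theorem memLp_avgIter (π : Idx G → ℝ) (t : ℕ) : MemLp (avgIter G π X t) 2 P :=
  memLp_finsetSum Finset.univ fun a _ => (h.memLp _ a.2).const_smul (π a)

omit [IsProbabilityMeasure P] in
theorem measurable_avgIter (π : Idx G → ℝ) (t : ℕ) (i : V) :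
    Measurable[past t i] (avgIter G π X t) :=
  Finset.measurable_fun_sum Finset.univ fun a _ =>
    (h.measurable t i ((t : ℤ) - ((a.1 : ℕ) : ℤ)) a.2 (by omega)).const_smul (π a)

omit [IsProbabilityMeasure P] in
theorem memLp_virtIter (π : Idx G → ℝ) (t : ℕ) : MemLp (virtIter G π γ X ζ t) 2 P := by
  have hterm : ∀ i j, MemLp (fun ω => (∑ s ∈ Finset.range t, ζ ((s : ℤ) - G.dist i j) j ω
      - ∑ s ∈ Finset.range t, ζ s j ω)) 2 P := fun i j =>
    (memLp_finsetSum _ fun s _ => h.memLp_noise _ _).sub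
      (memLp_finsetSum _ fun s _ => h.memLp_noise _ _)
  have hrow : ∀ i, MemLp (fun ω => (1 / (Fintype.card V : ℝ)) • ∑ j,
      (∑ s ∈ Finset.range t, ζ ((s : ℤ) - G.dist i j) j ω - ∑ s ∈ Finset.range t, ζ s j ω)) 2 P :=
    fun i => (memLp_finsetSum Finset.univ fun j _ => hterm i j).const_smul
      (1 / (Fintype.card V : ℝ))
  have hmean : MemLp (fun ω => pairMean fun i j =>
      (∑ s ∈ Finset.range t, ζ ((s : ℤ) - G.dist i j) j ω - ∑ s ∈ Finset.range t, ζ s j ω)) 2 P :=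
    (memLp_finsetSum Finset.univ fun i _ => hrow i).const_smul (1 / (Fintype.card V : ℝ))
  exact (h.memLp_avgIter π t).add (hmean.const_smul (γ * headMass π))

omit [IsProbabilityMeasure P] in
theorem measurable_virtIter (π : Idx G → ℝ) (t : ℕ) (i : V) :
    Measurable[past t i] (virtIter G π γ X ζ t) := by
  have hnoise : ∀ (r : ℤ) (k : V), r < t → Measurable[past t i] (ζ r k) := fun r k hr =>
    h.measurable_noise t i r k hr.le fun heq => hr.ne (Prod.mk.inj heq).2
  have hterm : ∀ k j, Measurable[past t i] fun ω =>
      (∑ s ∈ Finset.range t, ζ ((s : ℤ) - G.dist k j) j ω - ∑ s ∈ Finset.range t, ζ s j ω) := by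
    intro k j
    refine Measurable.sub (Finset.measurable_fun_sum _ fun s hs => hnoise _ _ ?_)
      (Finset.measurable_fun_sum _ fun s hs => hnoise _ _ ?_)
    · have := Finset.mem_range.1 hs; omega
    · have := Finset.mem_range.1 hs; omega
  have hrow : ∀ k, Measurable[past t i] fun ω => (1 / (Fintype.card V : ℝ)) • ∑ j,
      (∑ s ∈ Finset.range t, ζ ((s : ℤ) - G.dist k j) j ω - ∑ s ∈ Finset.range t, ζ s j ω) :=
    fun k => (Finset.measurable_fun_sum Finset.univ fun j _ => hterm k j).const_smul
      (1 / (Fintype.card V : ℝ))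
  have hmean : Measurable[past t i] fun ω => pairMean fun k j =>
      (∑ s ∈ Finset.range t, ζ ((s : ℤ) - G.dist k j) j ω - ∑ s ∈ Finset.range t, ζ s j ω) :=
    (Finset.measurable_fun_sum Finset.univ fun k _ => hrow k).const_smul (1 / (Fintype.card V : ℝ))
  exact (h.measurable_avgIter π t i).add (hmean.const_smul (γ * headMass π))

theorem memLp_delayedGrad {L : ℝ} (hL : 0 ≤ L) (hg : ∀ j x y, ‖g j x - g j y‖ ≤ L * ‖x - y‖)
    (t : ℕ) : MemLp (delayedGrad G g X t) 2 P := by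
  have hrow : ∀ i, MemLp (fun ω => (1 / (Fintype.card V : ℝ)) •
      ∑ j, g j (X ((t : ℤ) - G.dist i j) j ω)) 2 P := fun i =>
    (memLp_finsetSum Finset.univ fun j _ => memLp_comp_of_lipschitz hL (hg j)
      (h.memLp _ j)).const_smul (1 / (Fintype.card V : ℝ))
  exact (memLp_finsetSum Finset.univ fun i _ => hrow i).const_smul (1 / (Fintype.card V : ℝ))

omit [IsProbabilityMeasure P] in
theorem measurable_delayedGrad {L : ℝ} (hL : 0 ≤ L) (hg : ∀ j x y, ‖g j x - g j y‖ ≤ L * ‖x - y‖)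
    (t : ℕ) (i : V) : Measurable[past t i] (delayedGrad G g X t) := by
  have hgm : ∀ j, Measurable (g j) := fun j =>
    (LipschitzWith.of_dist_le_mul (K := ⟨L, hL⟩) fun x y => by
      rw [dist_eq_norm, dist_eq_norm]; exact hg j x y).continuous.measurable
  have hrow : ∀ k, Measurable[past t i] fun ω => (1 / (Fintype.card V : ℝ)) •
      ∑ j, g j (X ((t : ℤ) - G.dist k j) j ω) := fun k =>
    (Finset.measurable_fun_sum Finset.univ fun j _ =>
      (hgm j).comp (h.measurable t i _ j (by omega))).const_smul (1 / (Fintype.card V : ℝ))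
  exact (Finset.measurable_fun_sum Finset.univ fun k _ => hrow k).const_smul
    (1 / (Fintype.card V : ℝ))

omit [IsProbabilityMeasure P] in
theorem integrable_consensus (π : Idx G → ℝ) (t : ℕ) :
    Integrable (fun ω => consensus π (stack G (fun s i => X s i ω) t)) P :=
  integrable_finsetSum _ fun a _ => integrable_norm_sq ((h.memLp _ a.2).sub (h.memLp_avgIter π t))

end NoisyRelay

end Noisy

/-! ### Dynamics of the virtual iterate and the expected consensus distance -/

section Graph

variable {V : Type*} [Fintype V] [DecidableEq V] {d : ℕ} {Ω : Type*} [MeasurableSpace Ω]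
  {G : SimpleGraph V} {P : Measure Ω} [IsProbabilityMeasure P]
  {g : V → EuclideanSpace ℝ (Fin d) → EuclideanSpace ℝ (Fin d)}
  {x₀ : EuclideanSpace ℝ (Fin d)} {γ σ : ℝ} {past : ℤ → V → MeasurableSpace Ω}
  {X ζ : ℤ → V → Ω → EuclideanSpace ℝ (Fin d)} {π : Idx G → ℝ}

namespace NoisyRelay

variable (hG : G.Connected) (hπ : IsStationary (mixingMatrix G) π)
  (h : NoisyRelay G P g x₀ γ σ past X ζ)
include hG hπ h

omit [IsProbabilityMeasure P] in
theorem virtIter_zero (ω : Ω) : virtIter G π γ X ζ 0 ω = x₀ := by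
  have := hG.nonempty
  simp only [virtIter, avgIter, stack_zero (h.relay ω), wmean, ← Finset.sum_smul, hπ.2, one_smul,
    Finset.range_zero, Finset.sum_empty, sub_zero, pairMean_const, smul_zero, add_zero]

omit [IsProbabilityMeasure P] in
-- The correction in `virtIter` exchanges the delayed noise arriving now for the noise drawn now.
-- Unlike the former, the latter is orthogonal to the current state.
theorem virtIter_succ (t : ℕ) (ω : Ω) : virtIter G π γ X ζ (t + 1) ω
    = virtIter G π γ X ζ t ω
      - (γ * headMass π) • (delayedGrad G g X t ω + meanNoise ζ t ω) := by
  have := hG.nonempty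
  have h1 := wmean_succ hG hπ (h.relay ω) t
  have h2 : ∀ A : V → V → EuclideanSpace ℝ (Fin d), (1 / (Fintype.card V : ℝ)) • ∑ i,
      (1 / (Fintype.card V : ℝ)) • ∑ j, A i j = pairMean A := fun _ => rfl
  rw [h2 fun i j => g j (X ((t : ℤ) - G.dist i j) j ω) + ζ ((t : ℤ) - G.dist i j) j ω,
    pairMean_add] at h1
  have h3 : (pairMean fun i j => (∑ s ∈ Finset.range (t + 1), ζ ((s : ℤ) - G.dist i j) j ω
        - ∑ s ∈ Finset.range (t + 1), ζ s j ω))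
      = (pairMean fun i j => (∑ s ∈ Finset.range t, ζ ((s : ℤ) - G.dist i j) j ω
        - ∑ s ∈ Finset.range t, ζ s j ω))
        + ((pairMean fun i j => ζ ((t : ℤ) - G.dist i j) j ω) - meanNoise ζ t ω) := by
    rw [meanNoise, ← pairMean_right fun j => ζ t j ω, ← pairMean_sub, ← pairMean_add]
    congr 1
    ext1 i
    ext1 j
    rw [Finset.sum_range_succ, Finset.sum_range_succ]
    abel
  simp only [virtIter, avgIter] at h1 ⊢
  rw [h1, h3, delayedGrad]
  module

omit [DecidableEq V] hπ in
-- For each receiver the delayed and undelayed noise sums differ by two boundary windows, of at most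
-- nτ_max distinct noises each. Orthogonality gives nτ_maxσ² per window, and the average over
-- senders divides by n².
theorem integral_norm_sq_avgIter_sub_virtIter_le (t : ℕ) :
    ∫ ω, ‖avgIter G π X t ω - virtIter G π γ X ζ t ω‖ ^ 2 ∂P
      ≤ 4 * (γ * headMass π) ^ 2 * G.diam * σ ^ 2 / Fintype.card V := by
  have := hG.nonempty
  set n : ℝ := (Fintype.card V : ℝ) with hn
  have hn0 : 0 < n := by positivity
  set η := γ * headMass π
  set A : V → Ω → EuclideanSpace ℝ (Fin d) := fun i ω =>
    ∑ q ∈ Finset.univ.sigma fun j => Finset.range (G.dist i j),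
      ζ ((q.2 : ℤ) - G.dist i q.1) q.1 ω with hA
  set B : V → Ω → EuclideanSpace ℝ (Fin d) := fun i ω =>
    ∑ q ∈ Finset.univ.sigma fun j => Finset.range (G.dist i j),
      ζ ((t : ℤ) - G.dist i q.1 + q.2) q.1 ω with hB
  have hcard : ∀ i, (((Finset.univ : Finset V).sigma fun j => Finset.range (G.dist i j)).card : ℝ)
      ≤ n * G.diam := by
    intro i
    rw [Finset.card_sigma]
    have : ∑ j, (Finset.range (G.dist i j)).card ≤ ∑ _j : V, G.diam :=
      Finset.sum_le_sum fun j _ => by rw [Finset.card_range]; exact dist_le_diam hG i j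
    rw [Finset.sum_const, Finset.card_univ, smul_eq_mul] at this
    rw [hn]
    exact_mod_cast this
  have hAi : ∀ i, ∫ ω, ‖A i ω‖ ^ 2 ∂P ≤ n * G.diam * σ ^ 2 := by
    intro i
    refine (h.integral_norm_sq_noise_sum_le _
      (e := fun q : (_ : V) × ℕ => (q.1, (q.2 : ℤ) - G.dist i q.1)) ?_).trans
      (mul_le_mul_of_nonneg_right (hcard i) (sq_nonneg _))
    rintro ⟨j, l⟩ _ ⟨j', l'⟩ _ hq
    obtain ⟨rfl, h2⟩ := Prod.mk.inj hq
    obtain rfl : l = l' := by simpa using h2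
    rfl
  have hBi : ∀ i, ∫ ω, ‖B i ω‖ ^ 2 ∂P ≤ n * G.diam * σ ^ 2 := by
    intro i
    refine (h.integral_norm_sq_noise_sum_le _
      (e := fun q : (_ : V) × ℕ => (q.1, (t : ℤ) - G.dist i q.1 + q.2)) ?_).trans
      (mul_le_mul_of_nonneg_right (hcard i) (sq_nonneg _))
    rintro ⟨j, l⟩ _ ⟨j', l'⟩ _ hq
    obtain ⟨rfl, h2⟩ := Prod.mk.inj hq
    obtain rfl : l = l' := by simpa using h2
    rfl
  have hA2 : ∀ i, MemLp (A i) 2 P := fun i => memLp_finsetSum _ fun q _ => h.memLp_noise _ q.1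
  have hB2 : ∀ i, MemLp (B i) 2 P := fun i => memLp_finsetSum _ fun q _ => h.memLp_noise _ q.1
  have hAI : ∀ i, Integrable (fun ω => ‖A i ω‖ ^ 2) P := fun i => integrable_norm_sq (hA2 i)
  have hBI : ∀ i, Integrable (fun ω => ‖B i ω‖ ^ 2) P := fun i => integrable_norm_sq (hB2 i)
  have hpt : ∀ ω, ‖avgIter G π X t ω - virtIter G π γ X ζ t ω‖ ^ 2
      ≤ η ^ 2 * (1 / n * ∑ i, (1 / n) ^ 2 * (2 * ‖A i ω‖ ^ 2 + 2 * ‖B i ω‖ ^ 2)) := by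
    intro ω
    rw [virtIter, sub_add_cancel_left, norm_neg, norm_smul, mul_pow, Real.norm_eq_abs, sq_abs]
    refine mul_le_mul_of_nonneg_left ?_ (sq_nonneg _)
    refine (norm_avg_sq_le _).trans ?_
    refine mul_le_mul_of_nonneg_left (Finset.sum_le_sum fun i _ => ?_) (by positivity)
    have h1 : ∑ j, (∑ s ∈ Finset.range t, ζ ((s : ℤ) - G.dist i j) j ω
        - ∑ s ∈ Finset.range t, ζ s j ω) = A i ω - B i ω := by
      rw [Finset.sum_congr rfl fun j _ => sum_shift_sub (fun s => ζ s j ω) (G.dist i j) t,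
        Finset.sum_sub_distrib]
      simp only [hA, hB, Finset.sum_sigma]
    rw [h1, norm_smul, mul_pow, Real.norm_of_nonneg (by positivity)]
    exact mul_le_mul_of_nonneg_left (norm_sub_sq_le_two _ _) (by positivity)
  have hABI : ∀ i, Integrable (fun ω => (1 / n) ^ 2 * (2 * ‖A i ω‖ ^ 2 + 2 * ‖B i ω‖ ^ 2)) P :=
    fun i => (((hAI i).const_mul 2).add ((hBI i).const_mul 2)).const_mul _
  calc _ ≤ ∫ ω, η ^ 2 * (1 / n * ∑ i, (1 / n) ^ 2 * (2 * ‖A i ω‖ ^ 2 + 2 * ‖B i ω‖ ^ 2)) ∂P :=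
        integral_mono (integrable_norm_sq ((h.memLp_avgIter π t).sub (h.memLp_virtIter π t))) (((integrable_finsetSum _ fun i _ => hABI i).const_mul _).const_mul _) hpt
    _ = η ^ 2 * (1 / n * ∑ i, (1 / n) ^ 2 * (2 * ∫ ω, ‖A i ω‖ ^ 2 ∂P + 2 * ∫ ω, ‖B i ω‖ ^ 2 ∂P)) := by
        rw [integral_const_mul, integral_const_mul, integral_finsetSum _ fun i _ => hABI i]
        congr 2
        refine Finset.sum_congr rfl fun i _ => ?_
        rw [integral_const_mul, integral_add ((hAI i).const_mul 2) ((hBI i).const_mul 2),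
          integral_const_mul, integral_const_mul]
    _ ≤ η ^ 2 * (1 / n * ∑ _i : V, (1 / n) ^ 2 * (2 * (n * G.diam * σ ^ 2)
          + 2 * (n * G.diam * σ ^ 2))) := by
        gcongr with i _
        · exact hAi i
        · exact hBi i
    _ = _ := by
        rw [Finset.sum_const, Finset.card_univ, nsmul_eq_mul, ← hn]
        field_simp
        ring

/-- The expected consensus distance, summed against slowly increasing weights. -/
theorem weighted_consensus_le {L : ℝ} {m : ℕ} {w : ℕ → ℝ} (hL : 0 ≤ L)
    (hg : ∀ j x y, ‖g j x - g j y‖ ≤ L * ‖x - y‖)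
    (hm : IsMixingTime (mixingMatrix G) π m)
    (hw : ∀ t, 0 < w t) (hmono : Monotone w)
    (hwm : ∀ t, w (t + m) ≤ (1 + gap (mixingMatrix G) / 2) * w t) {Q : ℝ}
    (hQ : Q = 96 * γ ^ 2 * ((G.diam : ℝ) + 1) / effGap (mixingMatrix G) m ^ 2)
    (hQL : Q * L ^ 2 ≤ 1 / 2) (T : ℕ) :
    ∑ t ∈ Finset.range T, w t * ∫ ω, consensus π (stack G (fun s i => X s i ω) t) ∂P
      ≤ 2 * Q * Fintype.card V * ∑ t ∈ Finset.range T, w t *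
        ((∫ ω, ‖(1 / (Fintype.card V : ℝ)) • ∑ j, g j (avgIter G π X t ω)‖ ^ 2 ∂P) + σ ^ 2) := by
  have := hG.nonempty
  set p := gap (mixingMatrix G) with hp
  have hp0 : 0 < p := gap_pos hG hπ
  have hp1 : p ≤ 1 / 2 := gap_le_half hG hπ
  have hm0 : (0 : ℝ) < m := by exact_mod_cast hm.1
  set n : ℝ := (Fintype.card V : ℝ) with hn
  have hn0 : 0 < n := by positivity
  set ψ : ℕ → ℝ := fun t => ∫ ω, consensus π (stack G (fun s i => X s i ω) t) ∂P with hψ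
  set gs : ℕ → ℝ := fun t => ∫ ω, ‖(1 / n) • ∑ j, g j (avgIter G π X t ω)‖ ^ 2 ∂P with hgs
  set Γ : Ω → ℤ → V → EuclideanSpace ℝ (Fin d) := fun ω s j => g j (X s j ω) + ζ s j ω with hΓ
  set u : ℕ → ℝ := fun t => ∫ ω, ∑ a, ‖arrive G (Γ ω) t a‖ ^ 2 ∂P with hu
  have hψ0 : ∀ t, 0 ≤ ψ t := fun t => integral_nonneg fun ω => consensus_nonneg _ _
  have hgs0 : ∀ t, 0 ≤ gs t := fun t => integral_nonneg fun ω => sq_nonneg _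
  have hΓ2 : ∀ s j, MemLp (fun ω => Γ ω s j) 2 P := fun s j =>
    (memLp_comp_of_lipschitz hL (hg j) (h.memLp s j)).add (h.memLp_noise s j)
  have harr : ∀ t a, MemLp (fun ω => arrive G (Γ ω) t a) 2 P := by
    intro t a
    simp only [arrive]
    split_ifs
    · exact (memLp_finsetSum Finset.univ fun j _ => hΓ2 _ j).const_smul (1 / (Fintype.card V : ℝ))
    · exact memLp_const _
  have hui : ∀ t, Integrable (fun ω => ∑ a, ‖arrive G (Γ ω) t a‖ ^ 2) P := fun t =>
    integrable_finsetSum _ fun a _ => integrable_norm_sq (harr t a)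
  have hgi : ∀ t, Integrable (fun ω => ‖(1 / n) • ∑ j, g j (avgIter G π X t ω)‖ ^ 2) P := fun t =>
    integrable_norm_sq (memLp_comp_of_lipschitz hL (norm_mean_sub_le hg) (h.memLp_avgIter π t))
  have hule : ∀ t, u t ≤ 3 * (L ^ 2 * ψ t + n * gs t + n * σ ^ 2) := by
    intro t
    have hzi : ∀ i, Integrable (fun ω => ∑ j, ‖ζ ((t : ℤ) - G.dist i j) j ω‖ ^ 2) P := fun i =>
      integrable_finsetSum _ fun j _ => h.integrable_noise_sq _ _
    have hz : ∫ ω, (1 / n) * ∑ i, ∑ j, ‖ζ ((t : ℤ) - G.dist i j) j ω‖ ^ 2 ∂P ≤ n * σ ^ 2 := by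
      rw [integral_const_mul, integral_finsetSum _ fun i _ => hzi i]
      calc _ ≤ 1 / n * ∑ _i : V, ∑ _j : V, σ ^ 2 := by
            gcongr with i _
            rw [integral_finsetSum _ fun j _ => h.integrable_noise_sq _ _]
            exact Finset.sum_le_sum fun j _ => h.noise_le _ _
        _ = _ := by
            simp only [Finset.sum_const, Finset.card_univ, nsmul_eq_mul, ← hn]
            field_simp
    have i1 := (h.integrable_consensus π t).const_mul (L ^ 2)
    have i2 := (hgi t).const_mul n
    have i3 : Integrable (fun ω => (1 / n) * ∑ i, ∑ j, ‖ζ ((t : ℤ) - G.dist i j) j ω‖ ^ 2) P :=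
      (integrable_finsetSum _ fun i _ => hzi i).const_mul _
    have i12 : Integrable (fun ω => L ^ 2 * consensus π (stack G (fun s i => X s i ω) t)
          + n * ‖(1 / n) • ∑ j, g j (avgIter G π X t ω)‖ ^ 2) P := i1.add i2
    calc u t ≤ ∫ ω, 3 * (L ^ 2 * consensus π (stack G (fun s i => X s i ω) t)
          + n * ‖(1 / n) • ∑ j, g j (avgIter G π X t ω)‖ ^ 2
          + (1 / n) * ∑ i, ∑ j, ‖ζ ((t : ℤ) - G.dist i j) j ω‖ ^ 2) ∂P :=
          integral_mono (hui t) ((i12.add i3).const_mul 3) fun ω =>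
            sum_norm_sq_arrive_le hG (fun s j => rfl) hg t
      _ ≤ _ := by
          rw [integral_const_mul, integral_add i12 i3, integral_add i1 i2,
            integral_const_mul, integral_const_mul]
          linarith
  set D₀ := 8 * γ ^ 2 * m * ((G.diam : ℝ) + 1) / p with hD₀
  have hD₀0 : 0 ≤ D₀ := by positivity
  have hh0 : ∀ t, 0 ≤ 3 * (L ^ 2 * ψ t + n * gs t + n * σ ^ 2) := fun t => by
    have := hψ0 t
    have := hgs0 t
    positivity
  refine weighted_sum_le_of_self_bound hψ0 hw hQL ?_
  have hsum := weighted_sum_le_of_contraction hp0 hp1 hD₀0 hψ0 hh0 hw hmono hwm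
    (fun t => ?_) (fun k hk => ?_) T
  · refine hsum.trans (le_of_eq ?_)
    have h3 : ∀ t, w t * (3 * (L ^ 2 * ψ t + n * gs t + n * σ ^ 2))
        = 3 * (w t * (L ^ 2 * ψ t + n * gs t + n * σ ^ 2)) := fun t => by ring
    simp only [h3]
    -- The constant 96 is 4·8·3, from the scalar recursion, the consensus contraction and the
    -- three-term split of an arrival; m²/p² is 1/ρ².
    rw [← Finset.mul_sum, ← mul_assoc, hQ, hD₀, effGap, ← hp]
    congr 1
    field_simp
    ring
  · calc ψ (t + m) ≤ ∫ ω, ((1 - p) * consensus π (stack G (fun s i => X s i ω) t)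
          + D₀ * ∑ l ∈ Finset.range m, ∑ a, ‖arrive G (Γ ω) (t + l) a‖ ^ 2) ∂P :=
          integral_mono (h.integrable_consensus π _)
            (((h.integrable_consensus π t).const_mul _).add
              ((integrable_finsetSum _ fun l _ => hui (t + l)).const_mul _))
            fun ω => consensus_add_le hG hπ (h.relay ω) hm t
      _ = (1 - p) * ψ t + D₀ * ∑ l ∈ Finset.range m, u (t + l) := by
          rw [integral_add ((h.integrable_consensus π t).const_mul _)
              ((integrable_finsetSum _ fun l _ => hui (t + l)).const_mul _),
            integral_const_mul, integral_const_mul, integral_finsetSum _ fun l _ => hui (t + l)]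
      _ ≤ _ := by
          gcongr with l _
          exact hule _
  · calc ψ k ≤ ∫ ω, D₀ * ∑ l ∈ Finset.range k, ∑ a, ‖arrive G (Γ ω) l a‖ ^ 2 ∂P :=
          integral_mono (h.integrable_consensus π _)
            ((integrable_finsetSum _ fun l _ => hui l).const_mul _)
            fun ω => consensus_init_le hG hπ (h.relay ω) hk
      _ = D₀ * ∑ l ∈ Finset.range k, u l := by
          rw [integral_const_mul, integral_finsetSum _ fun l _ => hui l]
      _ ≤ _ := by
          gcongr with l _
          exact hule _

end NoisyRelay

end Graph

/-! ### Descent in expectation -/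

theorem weight_pos {a : ℝ} (ha1 : a < 1) (t : ℕ) : 0 < ((1 - a) ^ (t + 1))⁻¹ :=
  inv_pos.2 (pow_pos (by linarith) _)

theorem weight_monotone {a : ℝ} (ha : 0 ≤ a) (ha1 : a < 1) :
    Monotone fun t : ℕ => ((1 - a) ^ (t + 1))⁻¹ := fun s t hst =>
  inv_anti₀ (pow_pos (by linarith) _) (pow_le_pow_of_le_one (by linarith) (by linarith) (by omega))

/-- Bernoulli gives (1-a)^m ≥ 1 - am ≥ 1 - p/4, and (1-p/4)(1+p/2) ≥ 1. -/
theorem weight_add_le {a p : ℝ} {m : ℕ} (ha1 : a < 1) (hp : 0 ≤ p) (hp1 : p ≤ 1)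
    (ham : a * m ≤ p / 4) (t : ℕ) :
    ((1 - a) ^ (t + m + 1))⁻¹ ≤ (1 + p / 2) * ((1 - a) ^ (t + 1))⁻¹ := by
  have h1 : 0 < 1 - a := by linarith
  have h2 : 1 + (m : ℝ) * (-a) ≤ (1 + -a) ^ m := one_add_mul_le_pow (by linarith) m
  rw [← sub_eq_add_neg 1 a] at h2
  have h3 : ((1 - a) ^ m)⁻¹ ≤ 1 + p / 2 := by
    rw [inv_le_comm₀ (by positivity) (by positivity), inv_le_iff_one_le_mul₀ (by positivity)]
    nlinarith
  rw [show t + m + 1 = m + (t + 1) by ring, pow_add, mul_inv]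
  exact mul_le_mul_of_nonneg_right h3 (by positivity)

theorem mul_sum_weight_le {a : ℝ} (ha1 : a < 1) (T : ℕ) :
    a * ∑ t ∈ Finset.range T, ((1 - a) ^ (t + 1))⁻¹ ≤ ((1 - a) ^ T)⁻¹ := by
  have h1 : 0 < 1 - a := by linarith
  have h2 : ∀ t : ℕ, a * ((1 - a) ^ (t + 1))⁻¹ = ((1 - a) ^ (t + 1))⁻¹ - ((1 - a) ^ t)⁻¹ := by
    intro t
    rw [pow_succ]
    field_simp
    ring
  rw [Finset.mul_sum, Finset.sum_congr rfl fun t _ => h2 t,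
    Finset.sum_range_sub fun t => ((1 - a) ^ t)⁻¹]
  simp

theorem pairMean_le_consensus {V : Type*} [Fintype V] [DecidableEq V] {G : SimpleGraph V} {d : ℕ}
    (hG : G.Connected) (π : Idx G → ℝ) (X : ℤ → V → EuclideanSpace ℝ (Fin d)) (t : ℕ) :
    (pairMean fun i j => ‖X ((t : ℤ) - G.dist i j) j - wmean π (stack G X t)‖ ^ 2)
      ≤ consensus π (stack G X t) / Fintype.card V := by
  have := hG.nonempty
  have h := sum_dist_wmean_le (X := X) (π := π) hG t
  simp only [pairMean, smul_eq_mul]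
  rw [← Finset.mul_sum, ← mul_assoc]
  calc _ ≤ 1 / (Fintype.card V : ℝ) * (1 / (Fintype.card V : ℝ))
        * (Fintype.card V * consensus π (stack G X t)) := by gcongr
    _ = _ := by field_simp

namespace NoisyRelay

variable {V : Type*} [Fintype V] [DecidableEq V] {d : ℕ} {Ω : Type*} [MeasurableSpace Ω]
  {G : SimpleGraph V} {P : Measure Ω} [IsProbabilityMeasure P]
  {f : V → EuclideanSpace ℝ (Fin d) → ℝ}
  {g : V → EuclideanSpace ℝ (Fin d) → EuclideanSpace ℝ (Fin d)}
  {x₀ xs : EuclideanSpace ℝ (Fin d)} {γ σ L μ : ℝ} {past : ℤ → V → MeasurableSpace Ω}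
  {X ζ : ℤ → V → Ω → EuclideanSpace ℝ (Fin d)} {π : Idx G → ℝ}
  (hG : G.Connected) (hπ : IsStationary (mixingMatrix G) π)
  (h : NoisyRelay G P g x₀ γ σ past X ζ) (hL : 0 < L)
  (hf : ∀ j x, HasGradientAt (f j) (g j x) x) (hg : ∀ j x y, ‖g j x - g j y‖ ≤ L * ‖x - y‖)
  (hxs : ∀ x, (1 / (Fintype.card V : ℝ)) * ∑ j, f j xs ≤ (1 / (Fintype.card V : ℝ)) * ∑ j, f j x)
include hG hπ h hL hf hg

omit [DecidableEq V] hπ in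
theorem integrable_obj_avgIter (t : ℕ) :
    Integrable (fun ω => (1 / (Fintype.card V : ℝ)) * ∑ j, f j (avgIter G π X t ω)) P := by
  have := hG.nonempty
  exact integrable_comp_of_smooth hL.le (hasGradientAt_mean hf) (norm_mean_sub_le hg)
    (h.memLp_avgIter π t)

omit [DecidableEq V] hπ in
theorem integrable_obj_virtIter (t : ℕ) :
    Integrable (fun ω => (1 / (Fintype.card V : ℝ)) * ∑ j, f j (virtIter G π γ X ζ t ω)) P := by
  have := hG.nonempty
  exact integrable_comp_of_smooth hL.le (hasGradientAt_mean hf) (norm_mean_sub_le hg)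
    (h.memLp_virtIter π t)

omit [DecidableEq V] hL hf hπ in
theorem integrable_grad_avgIter (hL : 0 ≤ L) (t : ℕ) :
    Integrable (fun ω => ‖(1 / (Fintype.card V : ℝ)) • ∑ j, g j (avgIter G π X t ω)‖ ^ 2) P := by
  have := hG.nonempty
  exact integrable_norm_sq (memLp_comp_of_lipschitz hL (norm_mean_sub_le hg) (h.memLp_avgIter π t))

include hxs in
-- Before the fresh noise is added, the moved iterate is measurable for the past, so the cross term
-- vanishes and the noise contributes η²σ²/n. The distance from z to the average contributes at most
-- the same amount once 28Lητ_max ≤ 1, whence the factor 2.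
theorem convex_descent (hη : 0 < γ * headMass π) (hηL : L * (γ * headMass π) ≤ 1 / 4)
    (hητ : 28 * (L * (γ * headMass π)) * G.diam ≤ 1) (hμ : 0 ≤ μ) (hμL : μ ≤ L)
    (hconv : ∀ j x y, f j x - f j y + μ / 2 * ‖x - y‖ ^ 2 ≤ ⟪g j x, x - y⟫_ℝ) (t : ℕ) :
    ∫ ω, ‖virtIter G π γ X ζ (t + 1) ω - xs‖ ^ 2 ∂P
      ≤ (1 - μ * (γ * headMass π) / 2) * ∫ ω, ‖virtIter G π γ X ζ t ω - xs‖ ^ 2 ∂P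
        + (-(γ * headMass π / 2) *
            ((∫ ω, (1 / (Fintype.card V : ℝ)) * ∑ j, f j (avgIter G π X t ω) ∂P)
              - (1 / (Fintype.card V : ℝ)) * ∑ j, f j xs)
          + 6 * L * (γ * headMass π) / Fintype.card V
            * ∫ ω, consensus π (stack G (fun s i => X s i ω) t) ∂P
          + 2 * (γ * headMass π) ^ 2 * σ ^ 2 / Fintype.card V) := by
  have := hG.nonempty
  set n : ℝ := (Fintype.card V : ℝ) with hn
  have hn0 : 0 < n := by positivity
  set fs := 1 / n * ∑ j, f j xs with hfs
  have hdist := h.integral_norm_sq_avgIter_sub_virtIter_le (π := π) hG t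
  have hnoise := h.integral_norm_sq_meanNoise_le t
  have hvs := h.virtIter_succ hG hπ t
  set η := γ * headMass π
  set A : Ω → EuclideanSpace ℝ (Fin d) := fun ω =>
    virtIter G π γ X ζ t ω - xs - η • delayedGrad G g X t ω with hA
  have hA2 : MemLp A 2 P := ((h.memLp_virtIter π t).sub (memLp_const xs)).sub
    ((h.memLp_delayedGrad hL.le hg t).const_smul η)
  have hAm : ∀ i, Measurable[past t i] A := fun i => ((h.measurable_virtIter π t i).sub
    measurable_const).sub ((h.measurable_delayedGrad hL.le hg t i).const_smul η)
  have hAz := h.integral_inner_meanNoise hAm hA2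
  have hAI := integrable_norm_sq hA2
  have hNI := integrable_norm_sq (h.memLp_meanNoise t)
  have hANI := integrable_inner_of_memLp hA2 (h.memLp_meanNoise t)
  have hexp : ∀ ω, ‖virtIter G π γ X ζ (t + 1) ω - xs‖ ^ 2
      = ‖A ω‖ ^ 2 + (-(2 * η) * ⟪A ω, meanNoise ζ t ω⟫_ℝ + η ^ 2 * ‖meanNoise ζ t ω‖ ^ 2) := by
    intro ω
    have : virtIter G π γ X ζ (t + 1) ω - xs = A ω - η • meanNoise ζ t ω := by
      rw [hvs, hA]; module
    rw [this, norm_sub_sq_real, inner_smul_right, norm_smul, mul_pow, Real.norm_of_nonneg hη.le]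
    ring
  have hsplit : ∫ ω, ‖virtIter G π γ X ζ (t + 1) ω - xs‖ ^ 2 ∂P
      = ∫ ω, ‖A ω‖ ^ 2 ∂P + η ^ 2 * ∫ ω, ‖meanNoise ζ t ω‖ ^ 2 ∂P := by
    have hsum : Integrable (fun ω => -(2 * η) * ⟪A ω, meanNoise ζ t ω⟫_ℝ
        + η ^ 2 * ‖meanNoise ζ t ω‖ ^ 2) P := (hANI.const_mul _).add (hNI.const_mul _)
    simp only [hexp]
    rw [integral_add hAI hsum,
      integral_add (hANI.const_mul _) (hNI.const_mul _), integral_const_mul, integral_const_mul,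
      hAz, mul_zero, zero_add]
  have hpt : ∀ ω, ‖A ω‖ ^ 2 ≤ (1 - μ * η / 2) * ‖virtIter G π γ X ζ t ω - xs‖ ^ 2
      + (-(η / 2) * (1 / n * ∑ j, f j (avgIter G π X t ω) - fs)
        + (6 * L * η / n * consensus π (stack G (fun s i => X s i ω) t)
        + 7 * L * η * ‖avgIter G π X t ω - virtIter G π γ X ζ t ω‖ ^ 2)) := by
    intro ω
    have h1 := convex_step hf hg hL hη hηL hμ hμL hconv hxs
      (fun i j => X ((t : ℤ) - G.dist i j) j ω) (avgIter G π X t ω) (virtIter G π γ X ζ t ω)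
    have h2 := mul_le_mul_of_nonneg_left
      (pairMean_le_consensus hG π (fun s i => X s i ω) t) (show 0 ≤ 6 * L * η by positivity)
    have h3 : 6 * L * η / n * consensus π (stack G (fun s i => X s i ω) t)
        = 6 * L * η * (consensus π (stack G (fun s i => X s i ω) t) / n) := by ring
    rw [h3]
    change ‖A ω‖ ^ 2 ≤ (1 - μ * η / 2) * ‖virtIter G π γ X ζ t ω - xs‖ ^ 2
      - η / 2 * (1 / n * ∑ j, f j (avgIter G π X t ω) - fs) + 6 * L * η * (pairMean fun i j =>
        ‖X ((t : ℤ) - G.dist i j) j ω - avgIter G π X t ω‖ ^ 2)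
        + 7 * L * η * ‖avgIter G π X t ω - virtIter G π γ X ζ t ω‖ ^ 2 at h1
    change 6 * L * η * (pairMean fun i j =>
        ‖X ((t : ℤ) - G.dist i j) j ω - avgIter G π X t ω‖ ^ 2) ≤ _ at h2
    linarith
  have i1 : Integrable (fun ω => (1 - μ * η / 2) * ‖virtIter G π γ X ζ t ω - xs‖ ^ 2) P :=
    (integrable_norm_sq ((h.memLp_virtIter π t).sub (memLp_const xs))).const_mul _
  have i2' : Integrable (fun ω => 1 / n * ∑ j, f j (avgIter G π X t ω)) P :=
    h.integrable_obj_avgIter hG hL hf hg t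
  have i2 : Integrable (fun ω => -(η / 2) * (1 / n * ∑ j, f j (avgIter G π X t ω) - fs)) P :=
    (i2'.sub (integrable_const fs)).const_mul _
  have i3 : Integrable (fun ω => 6 * L * η / n * consensus π (stack G (fun s i => X s i ω) t)) P :=
    (h.integrable_consensus π t).const_mul _
  have i4 : Integrable (fun ω => 7 * L * η * ‖avgIter G π X t ω - virtIter G π γ X ζ t ω‖ ^ 2) P :=
    (integrable_norm_sq ((h.memLp_avgIter π t).sub (h.memLp_virtIter π t))).const_mul _
  have i34 : Integrable (fun ω => 6 * L * η / n * consensus π (stack G (fun s i => X s i ω) t)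
      + 7 * L * η * ‖avgIter G π X t ω - virtIter G π γ X ζ t ω‖ ^ 2) P := i3.add i4
  have i234 : Integrable (fun ω => -(η / 2) * (1 / n * ∑ j, f j (avgIter G π X t ω) - fs)
      + (6 * L * η / n * consensus π (stack G (fun s i => X s i ω) t)
      + 7 * L * η * ‖avgIter G π X t ω - virtIter G π γ X ζ t ω‖ ^ 2)) P := i2.add i34
  have hmean := integral_mono hAI (i1.add i234) hpt
  simp only [Pi.add_apply] at hmean
  rw [integral_add i1 i234, integral_add i2 i34, integral_add i3 i4, integral_const_mul,
    integral_const_mul, integral_const_mul, integral_const_mul, integral_sub i2'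
    (integrable_const fs), integral_const, probReal_univ, one_smul] at hmean
  have k1 : η ^ 2 * ∫ ω, ‖meanNoise ζ t ω‖ ^ 2 ∂P ≤ η ^ 2 * (σ ^ 2 / n) := by gcongr
  have k2 : 7 * L * η * ∫ ω, ‖avgIter G π X t ω - virtIter G π γ X ζ t ω‖ ^ 2 ∂P
      ≤ 7 * L * η * (4 * η ^ 2 * G.diam * σ ^ 2 / n) := by gcongr
  have k3 : 7 * L * η * (4 * η ^ 2 * G.diam * σ ^ 2 / n)
      = (28 * (L * η) * G.diam) * (η ^ 2 * (σ ^ 2 / n)) := by ring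
  have k4 : (28 * (L * η) * G.diam) * (η ^ 2 * (σ ^ 2 / n)) ≤ 1 * (η ^ 2 * (σ ^ 2 / n)) := by gcongr
  have k5 : 2 * η ^ 2 * σ ^ 2 / n = 2 * (η ^ 2 * (σ ^ 2 / n)) := by ring
  rw [hsplit, k5]
  linarith

/-- Both noise products vanish in expectation: the mean gradient at z and the delayed gradients are
measurable for the past. The noise square and the distance from z to the average each contribute at
most Lη²σ²/(2n). -/
theorem smooth_descent (hη : 0 < γ * headMass π) (hηL : L * (γ * headMass π) ≤ 1)
    (hητ : 12 * (L * (γ * headMass π)) * G.diam ≤ 1) (t : ℕ) :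
    ∫ ω, (1 / (Fintype.card V : ℝ)) * ∑ j, f j (virtIter G π γ X ζ (t + 1) ω) ∂P
      ≤ ∫ ω, (1 / (Fintype.card V : ℝ)) * ∑ j, f j (virtIter G π γ X ζ t ω) ∂P
        + (-(γ * headMass π / 4) *
            (∫ ω, ‖(1 / (Fintype.card V : ℝ)) • ∑ j, g j (avgIter G π X t ω)‖ ^ 2 ∂P)
          + (γ * headMass π) * L ^ 2 / Fintype.card V
            * ∫ ω, consensus π (stack G (fun s i => X s i ω) t) ∂P
          + L * (γ * headMass π) ^ 2 * σ ^ 2 / Fintype.card V) := by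
  have := hG.nonempty
  set n : ℝ := (Fintype.card V : ℝ) with hn
  have hn0 : 0 < n := by positivity
  have hdist := h.integral_norm_sq_avgIter_sub_virtIter_le (π := π) hG t
  have hnoise := h.integral_norm_sq_meanNoise_le t
  have hvs := h.virtIter_succ hG hπ t
  set η := γ * headMass π
  set B : Ω → EuclideanSpace ℝ (Fin d) := fun ω =>
    (1 / n) • ∑ j, g j (virtIter G π γ X ζ t ω) with hB
  have hgL : ∀ x y, ‖(1 / n) • ∑ j, g j x - (1 / n) • ∑ j, g j y‖ ≤ L * ‖x - y‖ :=
    norm_mean_sub_le hg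
  have hB2 : MemLp B 2 P := memLp_comp_of_lipschitz hL.le hgL (h.memLp_virtIter π t)
  have hgc : Continuous fun x => (1 / n) • ∑ j, g j x :=
    (LipschitzWith.of_dist_le_mul (K := ⟨L, hL.le⟩) fun x y => by
      rw [dist_eq_norm, dist_eq_norm]; exact hgL x y).continuous
  have hBm : ∀ i, Measurable[past t i] B := fun i =>
    hgc.measurable.comp (h.measurable_virtIter π t i)
  have hD2 := h.memLp_delayedGrad hL.le hg t
  have hDm := h.measurable_delayedGrad hL.le hg t
  have hpt : ∀ ω, 1 / n * ∑ j, f j (virtIter G π γ X ζ (t + 1) ω)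
      ≤ 1 / n * ∑ j, f j (virtIter G π γ X ζ t ω)
      + (-(η / 4) * ‖(1 / n) • ∑ j, g j (avgIter G π X t ω)‖ ^ 2
      + (η * L ^ 2 / n * consensus π (stack G (fun s i => X s i ω) t)
      + (3 / 2 * η * L ^ 2 * ‖avgIter G π X t ω - virtIter G π γ X ζ t ω‖ ^ 2
      + (-η * ⟪B ω, meanNoise ζ t ω⟫_ℝ
      + (L * η ^ 2 * ⟪delayedGrad G g X t ω, meanNoise ζ t ω⟫_ℝ
      + L * η ^ 2 / 2 * ‖meanNoise ζ t ω‖ ^ 2))))) := by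
    intro ω
    have h1 := smooth_step hf hg hη hηL
      (fun i j => X ((t : ℤ) - G.dist i j) j ω) (avgIter G π X t ω) (virtIter G π γ X ζ t ω)
      (meanNoise ζ t ω)
    have h2 := mul_le_mul_of_nonneg_left
      (pairMean_le_consensus hG π (fun s i => X s i ω) t) (show 0 ≤ η * L ^ 2 by positivity)
    have h3 : η * L ^ 2 / n * consensus π (stack G (fun s i => X s i ω) t)
        = η * L ^ 2 * (consensus π (stack G (fun s i => X s i ω) t) / n) := by ring
    rw [h3, hvs]
    change 1 / n * ∑ j, f j (virtIter G π γ X ζ t ω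
        - η • (delayedGrad G g X t ω + meanNoise ζ t ω)) ≤
        1 / n * ∑ j, f j (virtIter G π γ X ζ t ω)
        - η / 4 * ‖(1 / n) • ∑ j, g j (avgIter G π X t ω)‖ ^ 2
        + η * L ^ 2 * (pairMean fun i j =>
          ‖X ((t : ℤ) - G.dist i j) j ω - avgIter G π X t ω‖ ^ 2)
        + 3 / 2 * η * L ^ 2 * ‖avgIter G π X t ω - virtIter G π γ X ζ t ω‖ ^ 2
        - η * ⟪B ω, meanNoise ζ t ω⟫_ℝ + L * η ^ 2 * ⟪delayedGrad G g X t ω, meanNoise ζ t ω⟫_ℝ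
        + L * η ^ 2 / 2 * ‖meanNoise ζ t ω‖ ^ 2 at h1
    change η * L ^ 2 * (pairMean fun i j =>
        ‖X ((t : ℤ) - G.dist i j) j ω - avgIter G π X t ω‖ ^ 2) ≤ _ at h2
    linarith
  have i1 : Integrable (fun ω => 1 / n * ∑ j, f j (virtIter G π γ X ζ t ω)) P :=
    h.integrable_obj_virtIter hG hL hf hg t
  have i2 : Integrable (fun ω => -(η / 4) * ‖(1 / n) • ∑ j, g j (avgIter G π X t ω)‖ ^ 2) P :=
    (h.integrable_grad_avgIter hG hg hL.le t).const_mul _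
  have i3 : Integrable (fun ω => η * L ^ 2 / n * consensus π (stack G (fun s i => X s i ω) t)) P :=
    (h.integrable_consensus π t).const_mul _
  have i4 : Integrable (fun ω => 3 / 2 * η * L ^ 2
      * ‖avgIter G π X t ω - virtIter G π γ X ζ t ω‖ ^ 2) P :=
    (integrable_norm_sq ((h.memLp_avgIter π t).sub (h.memLp_virtIter π t))).const_mul _
  have i5 : Integrable (fun ω => -η * ⟪B ω, meanNoise ζ t ω⟫_ℝ) P :=
    (integrable_inner_of_memLp hB2 (h.memLp_meanNoise t)).const_mul _
  have i6 : Integrable (fun ω => L * η ^ 2 * ⟪delayedGrad G g X t ω, meanNoise ζ t ω⟫_ℝ) P :=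
    (integrable_inner_of_memLp hD2 (h.memLp_meanNoise t)).const_mul _
  have i7 : Integrable (fun ω => L * η ^ 2 / 2 * ‖meanNoise ζ t ω‖ ^ 2) P :=
    (integrable_norm_sq (h.memLp_meanNoise t)).const_mul _
  have j6 : Integrable (fun ω => L * η ^ 2 * ⟪delayedGrad G g X t ω, meanNoise ζ t ω⟫_ℝ
      + L * η ^ 2 / 2 * ‖meanNoise ζ t ω‖ ^ 2) P := i6.add i7
  have j5 : Integrable (fun ω => -η * ⟪B ω, meanNoise ζ t ω⟫_ℝ
      + (L * η ^ 2 * ⟪delayedGrad G g X t ω, meanNoise ζ t ω⟫_ℝ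
      + L * η ^ 2 / 2 * ‖meanNoise ζ t ω‖ ^ 2)) P := i5.add j6
  have j4 : Integrable (fun ω => 3 / 2 * η * L ^ 2
      * ‖avgIter G π X t ω - virtIter G π γ X ζ t ω‖ ^ 2 + (-η * ⟪B ω, meanNoise ζ t ω⟫_ℝ
      + (L * η ^ 2 * ⟪delayedGrad G g X t ω, meanNoise ζ t ω⟫_ℝ
      + L * η ^ 2 / 2 * ‖meanNoise ζ t ω‖ ^ 2))) P := i4.add j5
  have j3 : Integrable (fun ω => η * L ^ 2 / n * consensus π (stack G (fun s i => X s i ω) t)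
      + (3 / 2 * η * L ^ 2
      * ‖avgIter G π X t ω - virtIter G π γ X ζ t ω‖ ^ 2 + (-η * ⟪B ω, meanNoise ζ t ω⟫_ℝ
      + (L * η ^ 2 * ⟪delayedGrad G g X t ω, meanNoise ζ t ω⟫_ℝ
      + L * η ^ 2 / 2 * ‖meanNoise ζ t ω‖ ^ 2)))) P := i3.add j4
  have j2 : Integrable (fun ω => -(η / 4) * ‖(1 / n) • ∑ j, g j (avgIter G π X t ω)‖ ^ 2
      + (η * L ^ 2 / n * consensus π (stack G (fun s i => X s i ω) t)
      + (3 / 2 * η * L ^ 2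
      * ‖avgIter G π X t ω - virtIter G π γ X ζ t ω‖ ^ 2 + (-η * ⟪B ω, meanNoise ζ t ω⟫_ℝ
      + (L * η ^ 2 * ⟪delayedGrad G g X t ω, meanNoise ζ t ω⟫_ℝ
      + L * η ^ 2 / 2 * ‖meanNoise ζ t ω‖ ^ 2))))) P := i2.add j3
  have hmean := integral_mono (h.integrable_obj_virtIter hG hL hf hg (t + 1)) (i1.add j2) hpt
  simp only [Pi.add_apply] at hmean
  rw [integral_add i1 j2, integral_add i2 j3, integral_add i3 j4, integral_add i4 j5,
    integral_add i5 j6, integral_add i6 i7, integral_const_mul (-(η / 4)),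
    integral_const_mul (η * L ^ 2 / n), integral_const_mul (3 / 2 * η * L ^ 2),
    integral_const_mul (-η), integral_const_mul (L * η ^ 2), integral_const_mul (L * η ^ 2 / 2),
    h.integral_inner_meanNoise hBm hB2, h.integral_inner_meanNoise hDm hD2] at hmean
  have k1 : L * η ^ 2 / 2 * ∫ ω, ‖meanNoise ζ t ω‖ ^ 2 ∂P ≤ L * η ^ 2 / 2 * (σ ^ 2 / n) := by gcongr
  have k2 : 3 / 2 * η * L ^ 2 * ∫ ω, ‖avgIter G π X t ω - virtIter G π γ X ζ t ω‖ ^ 2 ∂P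
      ≤ 3 / 2 * η * L ^ 2 * (4 * η ^ 2 * G.diam * σ ^ 2 / n) := by gcongr
  have k3 : 3 / 2 * η * L ^ 2 * (4 * η ^ 2 * G.diam * σ ^ 2 / n)
      = (12 * (L * η) * G.diam) * (L * η ^ 2 / 2 * (σ ^ 2 / n)) := by ring
  have k4 : (12 * (L * η) * G.diam) * (L * η ^ 2 / 2 * (σ ^ 2 / n))
      ≤ 1 * (L * η ^ 2 / 2 * (σ ^ 2 / n)) := by gcongr
  have k5 : L * η ^ 2 * σ ^ 2 / n = 2 * (L * η ^ 2 / 2 * (σ ^ 2 / n)) := by ring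
  rw [k5]
  refine hmean.trans ?_
  linarith

end NoisyRelay

/-! ### Comparing the diameter, the gap and the mixing time with C -/

section Constants

variable {V : Type*} [Fintype V] [DecidableEq V] {G : SimpleGraph V} {π : Idx G → ℝ} {m : ℕ}

theorem effGap_pos (hG : G.Connected) (hπ : IsStationary (mixingMatrix G) π) (hm : 0 < m) :
    0 < effGap (mixingMatrix G) m :=
  div_pos (gap_pos hG hπ) (Nat.cast_pos.2 hm)

theorem relayConst_sq (G : SimpleGraph V) (m : ℕ) :
    relayConst G m ^ 2 = ((G.diam : ℝ) + 1) ^ 3 / effGap (mixingMatrix G) m ^ 2 := by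
  rw [relayConst, div_pow, ← Real.rpow_natCast, ← Real.rpow_mul (by positivity)]
  norm_num

theorem inv_effGap_mul_le_relayConst (hG : G.Connected) (hπ : IsStationary (mixingMatrix G) π)
    (hm : 0 < m) : ((G.diam : ℝ) + 1) * (effGap (mixingMatrix G) m)⁻¹ ≤ relayConst G m := by
  rw [relayConst, div_eq_mul_inv]
  have := effGap_pos hG hπ hm
  gcongr
  exact Real.self_le_rpow_of_one_le (by simp) (by norm_num)

theorem diam_add_one_le_relayConst (hG : G.Connected) (hπ : IsStationary (mixingMatrix G) π)
    (hm : 0 < m) : (G.diam : ℝ) + 1 ≤ relayConst G m := by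
  refine le_trans ?_ (inv_effGap_mul_le_relayConst hG hπ hm)
  refine le_mul_of_one_le_right (by positivity) ((one_le_inv₀ (effGap_pos hG hπ hm)).2 ?_)
  have h1 := gap_le_half hG hπ
  have h2 : (1 : ℝ) ≤ m := by exact_mod_cast hm
  rw [effGap, div_le_one (by positivity)]
  linarith

theorem one_le_relayConst (hG : G.Connected) (hπ : IsStationary (mixingMatrix G) π)
    (hm : 0 < m) : 1 ≤ relayConst G m :=
  le_trans (by simp) (diam_add_one_le_relayConst hG hπ hm)

theorem le_relayConst_mul_gap (hG : G.Connected) (hπ : IsStationary (mixingMatrix G) π)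
    (hm : 0 < m) : (m : ℝ) ≤ relayConst G m * gap (mixingMatrix G) := by
  have h1 := inv_effGap_mul_le_relayConst hG hπ hm
  have h2 := gap_pos hG hπ
  have h3 := inv_pos.2 (effGap_pos hG hπ hm)
  have h4 : (effGap (mixingMatrix G) m)⁻¹ * gap (mixingMatrix G) = m := by
    rw [effGap]
    field_simp
  have h5 : (effGap (mixingMatrix G) m)⁻¹ ≤ relayConst G m := by
    have : (0 : ℝ) ≤ G.diam := by positivity
    nlinarith
  rw [← h4]
  gcongr

/-- The consensus constant in terms of the effective step size `η = γ n π₀`. -/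
theorem consensus_const_le (hG : G.Connected) (hπ : IsStationary (mixingMatrix G) π)
    {γ : ℝ} (hγ : 0 ≤ γ) :
    96 * γ ^ 2 * ((G.diam : ℝ) + 1) / effGap (mixingMatrix G) m ^ 2
      ≤ 96 * (γ * headMass π) ^ 2 * relayConst G m ^ 2 := by
  have h1 := one_le_headMass_mul hG hπ
  have h2 := headMass_pos hG hπ
  -- Replacing γ by the effective step costs τ_max + 1, hence its square in γ². With the factor
  -- already present this makes (τ_max+1)³, the numerator of C².
  have h3 : γ ≤ γ * headMass π * ((G.diam : ℝ) + 1) := by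
    rw [mul_assoc]
    exact le_mul_of_one_le_right hγ h1
  rw [relayConst_sq]
  calc _ ≤ 96 * (γ * headMass π * ((G.diam : ℝ) + 1)) ^ 2 * ((G.diam : ℝ) + 1)
        / effGap (mixingMatrix G) m ^ 2 := by gcongr
    _ = _ := by ring

end Constants

/-! ### Summed descent inequalities for a small effective step -/

namespace NoisyRelay

variable {V : Type*} [Fintype V] [DecidableEq V] {d : ℕ} {Ω : Type*} [MeasurableSpace Ω]
  {G : SimpleGraph V} {P : Measure Ω} [IsProbabilityMeasure P]
  {f : V → EuclideanSpace ℝ (Fin d) → ℝ}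
  {g : V → EuclideanSpace ℝ (Fin d) → EuclideanSpace ℝ (Fin d)}
  {x₀ xs : EuclideanSpace ℝ (Fin d)} {γ σ L μ : ℝ} {past : ℤ → V → MeasurableSpace Ω}
  {X ζ : ℤ → V → Ω → EuclideanSpace ℝ (Fin d)} {π : Idx G → ℝ} {m : ℕ}
  (hG : G.Connected) (hπ : IsStationary (mixingMatrix G) π)
  (h : NoisyRelay G P g x₀ γ σ past X ζ) (hL : 0 < L)
  (hf : ∀ j x, HasGradientAt (f j) (g j x) x) (hg : ∀ j x y, ‖g j x - g j y‖ ≤ L * ‖x - y‖)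
  (hxs : ∀ x, (1 / (Fintype.card V : ℝ)) * ∑ j, f j xs ≤ (1 / (Fintype.card V : ℝ)) * ∑ j, f j x)
  (hm : IsMixingTime (mixingMatrix G) π m) (hγ : 0 < γ)
  (hstep : 200 * (L * (γ * headMass π) * relayConst G m) ≤ 1)
include hG hπ h hL hf hg hxs hm hγ hstep

/-- In the consensus bound, ‖∇f‖² ≤ 2L(f - f*) turns the gradient part into suboptimality. Its
coefficient is at most η/4 and is absorbed, halving the available descent η/2. The σ² part leaves
1152 = 12·96. -/
theorem convex_sum_le (hμ : 0 ≤ μ) (hμL : μ ≤ L)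
    (hconv : ∀ j x y, f j x - f j y + μ / 2 * ‖x - y‖ ^ 2 ≤ ⟪g j x, x - y⟫_ℝ) (T : ℕ) :
    ((1 - μ * (γ * headMass π) / 2) ^ T)⁻¹ * ∫ ω, ‖virtIter G π γ X ζ T ω - xs‖ ^ 2 ∂P
      + γ * headMass π / 4 * ∑ t ∈ Finset.range T, ((1 - μ * (γ * headMass π) / 2) ^ (t + 1))⁻¹ *
          ((∫ ω, (1 / (Fintype.card V : ℝ)) * ∑ j, f j (avgIter G π X t ω) ∂P)
              - (1 / (Fintype.card V : ℝ)) * ∑ j, f j xs)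
      ≤ ‖x₀ - xs‖ ^ 2 + (2 * (γ * headMass π) ^ 2 * σ ^ 2 / Fintype.card V
          + 1152 * L * (γ * headMass π) ^ 3 * relayConst G m ^ 2 * σ ^ 2)
        * ∑ t ∈ Finset.range T, ((1 - μ * (γ * headMass π) / 2) ^ (t + 1))⁻¹ := by
  have := hG.nonempty
  have hhead := headMass_pos hG hπ
  have hC1 := one_le_relayConst hG hπ hm.1
  have hCd := diam_add_one_le_relayConst hG hπ hm.1
  have hCm := le_relayConst_mul_gap hG hπ hm.1
  have hp := gap_pos hG hπ
  have hp2 := gap_le_half hG hπ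
  have hQle := consensus_const_le (m := m) hG hπ hγ.le
  set n : ℝ := (Fintype.card V : ℝ) with hn
  have hn0 : 0 < n := by positivity
  set η := γ * headMass π with hη
  have hη0 : 0 < η := mul_pos hγ hhead
  set C := relayConst G m
  set a := μ * η / 2 with ha
  set Q := 96 * γ ^ 2 * ((G.diam : ℝ) + 1) / effGap (mixingMatrix G) m ^ 2 with hQ
  set fs := 1 / n * ∑ j, f j xs
  have hLη : 0 < L * η := mul_pos hL hη0
  have hLηC : L * η ≤ L * η * C := le_mul_of_one_le_right hLη.le hC1
  have hLηd : L * η * G.diam ≤ L * η * C := by gcongr; linarith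
  have hμη : μ * η ≤ L * η := by gcongr
  have ha0 : 0 ≤ a := by positivity
  have ha1 : a < 1 := by linarith
  -- The weights may grow by at most 1 + p/2 over m steps; m ≤ Cp converts the step size restriction
  -- into this condition.
  have ham : a * m ≤ gap (mixingMatrix G) / 4 := by
    calc a * m ≤ (L * η / 2) * (C * gap (mixingMatrix G)) :=
          mul_le_mul (by rw [ha]; linarith) hCm (by positivity) (by positivity)
      _ = (L * η * C) / 2 * gap (mixingMatrix G) := by ring
      _ ≤ 1 / 4 * gap (mixingMatrix G) := mul_le_mul_of_nonneg_right (by linarith) hp.le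
      _ = _ := by ring
  have hQL : Q * L ^ 2 ≤ 1 / 96 := by
    calc Q * L ^ 2 ≤ 96 * η ^ 2 * C ^ 2 * L ^ 2 := by gcongr
      _ = 96 * (L * η * C) ^ 2 := by ring
      _ ≤ 96 * (1 / 200) ^ 2 := by gcongr; linarith
      _ ≤ _ := by norm_num
  have hQ0 : 0 ≤ Q := by positivity
  have hcons := h.weighted_consensus_le hG hπ hL.le hg hm (w := fun t => ((1 - a) ^ (t + 1))⁻¹)
    (weight_pos ha1) (weight_monotone ha0 ha1)
    (weight_add_le ha1 hp.le (by linarith) ham) hQ (by linarith) T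
  have htel := weighted_telescope
    (r := fun t => ∫ ω, ‖virtIter G π γ X ζ t ω - xs‖ ^ 2 ∂P) ha1
    (h.convex_descent hG hπ hL hf hg hxs hη0 (by linarith) (by linarith) hμ hμL hconv) T
  simp only [h.virtIter_zero hG hπ, integral_const, probReal_univ, one_smul] at htel
  have hgrad : ∀ t, ∫ ω, ‖(1 / n) • ∑ j, g j (avgIter G π X t ω)‖ ^ 2 ∂P
      ≤ 2 * L * ((∫ ω, 1 / n * ∑ j, f j (avgIter G π X t ω) ∂P) - fs) := by
    intro t
    have hi := h.integrable_obj_avgIter (π := π) hG hL hf hg t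
    have h1 : (∫ ω, 1 / n * ∑ j, f j (avgIter G π X t ω) ∂P) - fs
        = ∫ ω, (1 / n * ∑ j, f j (avgIter G π X t ω) - fs) ∂P := by
      rw [integral_sub hi (integrable_const _), integral_const, probReal_univ, one_smul]
    rw [h1, ← integral_const_mul]
    refine integral_mono (h.integrable_grad_avgIter hG hg hL.le t)
      ((hi.sub (integrable_const _)).const_mul _) fun ω => ?_
    exact norm_gradient_sq_le hL (hasGradientAt_mean hf) (norm_mean_sub_le hg) hxs _
  set w := fun t : ℕ => ((1 - a) ^ (t + 1))⁻¹ with hw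
  set Δ := fun t : ℕ => (∫ ω, 1 / n * ∑ j, f j (avgIter G π X t ω) ∂P) - fs with hΔ
  set c := fun t : ℕ => ∫ ω, consensus π (stack G (fun s i => X s i ω) t) ∂P with hc
  have hw0 : ∀ t, 0 < w t := weight_pos ha1
  have hΔ0 : ∀ t, 0 ≤ Δ t := fun t => by
    have h1 := hgrad t
    have h2 : 0 ≤ ∫ ω, ‖(1 / n) • ∑ j, g j (avgIter G π X t ω)‖ ^ 2 ∂P :=
      integral_nonneg fun ω => by positivity
    exact nonneg_of_mul_nonneg_right (h2.trans h1) (by positivity)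
  have hcons2 : ∑ t ∈ Finset.range T, w t * c t
      ≤ 2 * Q * n * (2 * L * ∑ t ∈ Finset.range T, w t * Δ t
        + σ ^ 2 * ∑ t ∈ Finset.range T, w t) := by
    refine hcons.trans ?_
    rw [Finset.mul_sum _ _ (2 * L), Finset.mul_sum _ _ (σ ^ 2), ← Finset.sum_add_distrib]
    refine mul_le_mul_of_nonneg_left (Finset.sum_le_sum fun t _ => ?_) (by positivity)
    have h1 := mul_le_mul_of_nonneg_left (hgrad t) (hw0 t).le
    rw [mul_add]
    linarith
  have hsum : ∑ t ∈ Finset.range T, w t * (-(η / 2) * Δ t + 6 * L * η / n * c t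
        + 2 * η ^ 2 * σ ^ 2 / n)
      = -(η / 2) * ∑ t ∈ Finset.range T, w t * Δ t + 6 * L * η / n * ∑ t ∈ Finset.range T, w t * c t
        + 2 * η ^ 2 * σ ^ 2 / n * ∑ t ∈ Finset.range T, w t := by
    simp only [Finset.mul_sum, ← Finset.sum_add_distrib]
    exact Finset.sum_congr rfl fun t _ => by ring
  have htel2 : ((1 - a) ^ T)⁻¹ * ∫ ω, ‖virtIter G π γ X ζ T ω - xs‖ ^ 2 ∂P
      ≤ ‖x₀ - xs‖ ^ 2 + ∑ t ∈ Finset.range T, w t * (-(η / 2) * Δ t + 6 * L * η / n * c t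
        + 2 * η ^ 2 * σ ^ 2 / n) := htel
  rw [hsum] at htel2
  have hSΔ : 0 ≤ ∑ t ∈ Finset.range T, w t * Δ t :=
    Finset.sum_nonneg fun t _ => mul_nonneg (hw0 t).le (hΔ0 t)
  have hSw : 0 ≤ ∑ t ∈ Finset.range T, w t := Finset.sum_nonneg fun t _ => (hw0 t).le
  set SΔ := ∑ t ∈ Finset.range T, w t * Δ t
  set Sw := ∑ t ∈ Finset.range T, w t
  have h1 : 6 * L * η / n * ∑ t ∈ Finset.range T, w t * c t
      ≤ 24 * η * (Q * L ^ 2) * SΔ + 12 * L * η * Q * σ ^ 2 * Sw := by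
    calc _ ≤ 6 * L * η / n * (2 * Q * n * (2 * L * SΔ + σ ^ 2 * Sw)) := by gcongr
      _ = _ := by field_simp; ring
  have h2 : 24 * η * (Q * L ^ 2) * SΔ ≤ 24 * η * (1 / 96) * SΔ := by gcongr
  have h3 : 12 * L * η * Q * σ ^ 2 * Sw ≤ 12 * L * η * (96 * η ^ 2 * C ^ 2) * σ ^ 2 * Sw := by
    gcongr
  show _ + η / 4 * SΔ ≤ _ + _ * Sw
  linarith

/-- The consensus sum contains the very gradients being summed, with a coefficient below η/8, so it
is absorbed; 192 = 2·96 is left in front of σ². -/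
theorem smooth_sum_le (T : ℕ) :
    γ * headMass π / 8 * ∑ t ∈ Finset.range T,
        ∫ ω, ‖(1 / (Fintype.card V : ℝ)) • ∑ j, g j (avgIter G π X t ω)‖ ^ 2 ∂P
      ≤ ((1 / (Fintype.card V : ℝ)) * ∑ j, f j x₀ - (1 / (Fintype.card V : ℝ)) * ∑ j, f j xs)
        + (L * (γ * headMass π) ^ 2 * σ ^ 2 / Fintype.card V
          + 192 * L ^ 2 * (γ * headMass π) ^ 3 * relayConst G m ^ 2 * σ ^ 2) * T := by
  have := hG.nonempty
  have hhead := headMass_pos hG hπ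
  have hC1 := one_le_relayConst hG hπ hm.1
  have hCd := diam_add_one_le_relayConst hG hπ hm.1
  have hp := gap_pos hG hπ
  have hQle := consensus_const_le (m := m) hG hπ hγ.le
  set n : ℝ := (Fintype.card V : ℝ) with hn
  have hn0 : 0 < n := by positivity
  set η := γ * headMass π with hη
  have hη0 : 0 < η := mul_pos hγ hhead
  set C := relayConst G m
  set Q := 96 * γ ^ 2 * ((G.diam : ℝ) + 1) / effGap (mixingMatrix G) m ^ 2 with hQ
  set fs := 1 / n * ∑ j, f j xs
  have hLη : 0 < L * η := mul_pos hL hη0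
  have hLηC : L * η ≤ L * η * C := le_mul_of_one_le_right hLη.le hC1
  have hLηd : L * η * G.diam ≤ L * η * C := by gcongr; linarith
  have hQL : Q * L ^ 2 ≤ 1 / 96 := by
    calc Q * L ^ 2 ≤ 96 * η ^ 2 * C ^ 2 * L ^ 2 := by gcongr
      _ = 96 * (L * η * C) ^ 2 := by ring
      _ ≤ 96 * (1 / 200) ^ 2 := by gcongr; linarith
      _ ≤ _ := by norm_num
  have hQ0 : 0 ≤ Q := by positivity
  have hcons := h.weighted_consensus_le hG hπ hL.le hg hm (w := fun _ => 1)
    (fun _ => one_pos) monotone_const (fun _ => by linarith) hQ (by linarith) T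
  set gr := fun t : ℕ => ∫ ω, ‖(1 / n) • ∑ j, g j (avgIter G π X t ω)‖ ^ 2 ∂P with hgr
  set c := fun t : ℕ => ∫ ω, consensus π (stack G (fun s i => X s i ω) t) ∂P with hc
  have htel := weighted_telescope
    (r := fun t => ∫ ω, 1 / n * ∑ j, f j (virtIter G π γ X ζ t ω) ∂P) (a := 0) one_pos (fun t => by
    rw [sub_zero, one_mul]
    exact h.smooth_descent hG hπ hL hf hg hη0 (by linarith) (by linarith) t) T
  simp only [h.virtIter_zero hG hπ, integral_const, probReal_univ, one_smul, sub_zero, one_pow,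
    inv_one, one_mul] at htel hcons
  have hlow : fs ≤ ∫ ω, 1 / n * ∑ j, f j (virtIter G π γ X ζ T ω) ∂P := by
    have h1 : ∫ _, fs ∂P ≤ ∫ ω, 1 / n * ∑ j, f j (virtIter G π γ X ζ T ω) ∂P :=
      integral_mono (integrable_const _) (h.integrable_obj_virtIter hG hL hf hg T) fun ω => hxs _
    simpa using h1
  have hsum : ∑ t ∈ Finset.range T, (-(η / 4) * gr t + η * L ^ 2 / n * c t + L * η ^ 2 * σ ^ 2 / n)
      = -(η / 4) * ∑ t ∈ Finset.range T, gr t + η * L ^ 2 / n * ∑ t ∈ Finset.range T, c t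
        + L * η ^ 2 * σ ^ 2 / n * T := by
    simp only [Finset.mul_sum, Finset.sum_add_distrib, Finset.sum_const, Finset.card_range,
      nsmul_eq_mul]
    ring
  have htel2 : ∫ ω, 1 / n * ∑ j, f j (virtIter G π γ X ζ T ω) ∂P ≤ 1 / n * ∑ j, f j x₀
      + ∑ t ∈ Finset.range T, (-(η / 4) * gr t + η * L ^ 2 / n * c t + L * η ^ 2 * σ ^ 2 / n) := htel
  have hcons2 : ∑ t ∈ Finset.range T, c t
      ≤ 2 * Q * n * (∑ t ∈ Finset.range T, gr t + σ ^ 2 * T) := by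
    refine hcons.trans_eq ?_
    simp only [Finset.sum_add_distrib, Finset.sum_const, Finset.card_range, nsmul_eq_mul]
    ring
  have hSg : 0 ≤ ∑ t ∈ Finset.range T, gr t :=
    Finset.sum_nonneg fun t _ => integral_nonneg fun ω => by positivity
  set Sg := ∑ t ∈ Finset.range T, gr t
  have h1 : η * L ^ 2 / n * ∑ t ∈ Finset.range T, c t
      ≤ 2 * η * (Q * L ^ 2) * Sg + 2 * L ^ 2 * η * Q * σ ^ 2 * T := by
    calc _ ≤ η * L ^ 2 / n * (2 * Q * n * (Sg + σ ^ 2 * T)) := by gcongr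
      _ = _ := by field_simp
  have h2 : 2 * η * (Q * L ^ 2) * Sg ≤ 2 * η * (1 / 96) * Sg := by gcongr
  have h3 : 2 * L ^ 2 * η * Q * σ ^ 2 * T ≤ 2 * L ^ 2 * η * (96 * η ^ 2 * C ^ 2) * σ ^ 2 * T := by
    gcongr
  have h4 : 0 ≤ η * Sg := by positivity
  show η / 8 * Sg ≤ _
  linarith

end NoisyRelay

/-! ### Choice of the effective step size and bounds on the number of steps -/

section StepSize

/-- The inverse of the effective step size, up to a numerical factor. -/
def invStep (n C L σ ε : ℝ) : ℝ := σ ^ 2 / (n * ε) + C * √L * σ / √ε + C * L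

variable {n C L σ ε η : ℝ} (hn : 0 < n) (hC : 0 < C) (hL : 0 < L) (hσ : 0 ≤ σ) (hε : 0 < ε)
include hn hC hL hσ hε

theorem invStep_pos : 0 < invStep n C L σ ε := by
  unfold invStep
  positivity

/-- Each of the three nonnegative summands of `invStep`, multiplied by η, is at most 1/200. They
yield one conclusion each, the middle one after squaring. -/
theorem step_bounds (hη : η = 1 / (200 * invStep n C L σ ε)) :
    200 * (L * η * C) ≤ 1 ∧ η * σ ^ 2 / n ≤ ε / 200 ∧ L * η ^ 2 * C ^ 2 * σ ^ 2 ≤ ε / 40000 := by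
  have hS := invStep_pos hn hC hL hσ hε
  have hη0 : 0 < η := by rw [hη]; positivity
  have h1 : 200 * (η * invStep n C L σ ε) = 1 := by rw [hη]; field_simp
  unfold invStep at h1
  have h2 : 0 ≤ η * (σ ^ 2 / (n * ε)) := by positivity
  have h3 : 0 ≤ η * (C * √L * σ / √ε) := by positivity
  have h4 : 0 ≤ η * (C * L) := by positivity
  refine ⟨by linarith, ?_, ?_⟩
  · have h5 : η * σ ^ 2 / n = ε * (η * (σ ^ 2 / (n * ε))) := by field_simp
    have h6 : η * (σ ^ 2 / (n * ε)) ≤ 1 / 200 := by linarith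
    rw [h5]
    nlinarith
  · have h5 : L * η ^ 2 * C ^ 2 * σ ^ 2 = ε * (η * (C * √L * σ / √ε)) ^ 2 := by
      rw [mul_pow, div_pow, mul_pow, mul_pow, Real.sq_sqrt hL.le, Real.sq_sqrt hε.le]
      field_simp
    have h6 : (η * (C * √L * σ / √ε)) ^ 2 ≤ (1 / 200) ^ 2 := by gcongr; linarith
    rw [h5]
    nlinarith

omit hn hC hL hσ in
theorem rpow_three_halves : ε ^ (3 / 2 : ℝ) = ε * √ε := by
  rw [Real.sqrt_eq_rpow, show (3 / 2 : ℝ) = 1 + 1 / 2 by norm_num, Real.rpow_add hε, Real.rpow_one]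

omit hC hL hσ in
theorem invStep_div : σ ^ 2 / (n * ε ^ 2) + C * √L * σ / ε ^ (3 / 2 : ℝ) + C * L / ε
    = invStep n C L σ ε / ε := by
  rw [rpow_three_halves hε, invStep]
  field_simp

omit hC hσ in
-- The non-convex rate is the convex one with σ replaced by √L·σ, so a single step size analysis
-- serves both.
theorem invStep_sqrt_mul_div :
    (σ ^ 2 / (n * ε ^ 2) + C * σ / ε ^ (3 / 2 : ℝ) + C / ε) * L
      = invStep n C L (√L * σ) ε / ε := by
  have h1 : C * √L * (√L * σ) = C * L * σ := by
    rw [show C * √L * (√L * σ) = C * (√L * √L) * σ by ring, Real.mul_self_sqrt hL.le]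
  rw [rpow_three_halves hε, invStep, h1, mul_pow, Real.sq_sqrt hL.le]
  field_simp

omit hn hC hL hσ hε in
theorem exp_le_inv_pow {a : ℝ} (ha1 : a < 1) (T : ℕ) :
    Real.exp (a * T) ≤ ((1 - a) ^ T)⁻¹ := by
  have h1 : 1 - a ≤ Real.exp (-a) := by linarith [Real.add_one_le_exp (-a)]
  rw [← inv_inv (Real.exp _), ← Real.exp_neg]
  refine inv_anti₀ (pow_pos (by linarith) T) ?_
  calc (1 - a) ^ T ≤ Real.exp (-a) ^ T := by gcongr
    _ = _ := by rw [← Real.exp_nat_mul]; ring_nf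

omit hn hC hL hσ hε in
theorem one_add_mul_le_exp_mul_log {x q b : ℝ} (hx : 0 ≤ x) (k : ℕ) (hq : (k : ℝ) ≤ q)
    (hb : q * Real.log (1 + x) ≤ b) : 1 + k * x ≤ Real.exp b := by
  have h0 : 0 ≤ Real.log (1 + x) := Real.log_nonneg (by linarith)
  calc 1 + k * x ≤ (1 + x) ^ k := one_add_mul_le_pow (by linarith) k
    _ = Real.exp (k * Real.log (1 + x)) := by
        rw [Real.exp_nat_mul, Real.exp_log (by linarith)]
    _ ≤ _ := Real.exp_le_exp.2 ((mul_le_mul_of_nonneg_right hq h0).trans hb)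

/-- The exponential weights beat the initial error. -/
theorem initial_error_le {μ N R W : ℝ} {T : ℕ} (hμ : 0 < μ)
    (hN : N = σ ^ 2 / (μ * n * ε) + C * √L * σ / (μ * √ε))
    (hη : η = 1 / (200 * invStep n C L σ ε)) (ha1 : μ * η / 2 < 1)
    (hT : 2560000 * (N * Real.log (1 + μ * N * R ^ 2 / ε)
      + C * L / μ * Real.log (1 + C * L * R ^ 2 / ε)) ≤ (T : ℝ))
    (hW : ((1 - μ * η / 2) ^ T)⁻¹ ≤ W) : 4 * R ^ 2 ≤ ε / 2 * (η * W) := by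
  have hS := invStep_pos hn hC hL hσ hε
  have hS2 : invStep n C L σ ε = μ * N + μ * (C * L / μ) := by
    rw [invStep, hN]
    field_simp
  have hN0 : 0 ≤ N := by rw [hN]; positivity
  have hA0 : 0 < C * L / μ := by positivity
  have hlog : ∀ A : ℝ, 0 ≤ A → 0 ≤ A * Real.log (1 + μ * A * R ^ 2 / ε) := fun A hA =>
    mul_nonneg hA (Real.log_nonneg (by
      have : 0 ≤ μ * A * R ^ 2 / ε := by positivity
      linarith))
  have h1 : C * L * R ^ 2 / ε = μ * (C * L / μ) * R ^ 2 / ε := by field_simp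
  rw [h1] at hT
  -- M is the larger of N and CL/μ. It accounts for at least half of `invStep`, and the other
  -- logarithmic term is nonnegative and can be dropped.
  obtain ⟨M, hM0, hSM, hTM⟩ : ∃ M : ℝ, 0 < M ∧ invStep n C L σ ε ≤ 2 * (μ * M) ∧
      2560000 * (M * Real.log (1 + μ * M * R ^ 2 / ε)) ≤ T := by
    have hlN := hlog N hN0
    have hlA := hlog _ hA0.le
    rcases le_total N (C * L / μ) with hle | hle
    · exact ⟨_, hA0, by rw [hS2]; nlinarith, by linarith⟩
    · exact ⟨N, hA0.trans_le hle, by rw [hS2]; nlinarith, by linarith⟩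
  have hη0 : 0 < η := by rw [hη]; positivity
  have hηM : 1 ≤ 400 * (η * (μ * M)) := by
    rw [hη]
    field_simp
    linarith
  set x := μ * M * R ^ 2 / ε with hx
  have hx0 : 0 ≤ x := by positivity
  have hlog0 : 0 ≤ Real.log (1 + x) := Real.log_nonneg (by linarith)
  -- Bernoulli: 1 + 3200x ≤ (1+x)^3200, and T is large enough for the exponential to dominate. The
  -- constant 2560000 is 2·400·3200, with 400 from `hηM` and 2 from the exponent μη/2.
  have hexp : 1 + (3200 : ℕ) * x ≤ Real.exp (μ * η / 2 * T) := by
    refine one_add_mul_le_exp_mul_log hx0 3200 le_rfl ?_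
    calc ((3200 : ℕ) : ℝ) * Real.log (1 + x)
        ≤ 400 * (η * (μ * M)) * (3200 * Real.log (1 + x)) := by
          push_cast
          exact le_mul_of_one_le_left (by positivity) hηM
      _ = μ * η / 2 * (2560000 * (M * Real.log (1 + x))) := by ring
      _ ≤ _ := by gcongr
  have hW2 : 1 + 3200 * x ≤ W := by
    have := hexp.trans ((exp_le_inv_pow ha1 T).trans hW)
    push_cast at this
    exact this
  have h2 : 4 * R ^ 2 ≤ 1600 * (η * (ε * x)) := by
    have h3 : ε * x = μ * M * R ^ 2 := by rw [hx]; field_simp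
    rw [h3]
    nlinarith [mul_le_mul_of_nonneg_right hηM (sq_nonneg R)]
  calc 4 * R ^ 2 ≤ 1600 * (η * (ε * x)) := h2
    _ = ε / 2 * (η * (3200 * x)) := by ring
    _ ≤ _ := by gcongr; linarith

end StepSize

/-! ### Convergence rates for noisy trajectories -/

namespace NoisyRelay

variable {V : Type*} [Fintype V] [DecidableEq V] {d : ℕ} {Ω : Type*} [MeasurableSpace Ω]
  {G : SimpleGraph V} {P : Measure Ω} [IsProbabilityMeasure P]
  {f : V → EuclideanSpace ℝ (Fin d) → ℝ}
  {g : V → EuclideanSpace ℝ (Fin d) → EuclideanSpace ℝ (Fin d)}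
  {x₀ xs : EuclideanSpace ℝ (Fin d)} {γ σ ε L μ : ℝ} {past : ℤ → V → MeasurableSpace Ω}
  {X ζ : ℤ → V → Ω → EuclideanSpace ℝ (Fin d)} {π : Idx G → ℝ} {m : ℕ}
  (hG : G.Connected) (hπ : IsStationary (mixingMatrix G) π)
  (h : NoisyRelay G P g x₀ γ σ past X ζ) (hL : 0 < L) (hσ : 0 ≤ σ) (hε : 0 < ε)
  (hf : ∀ j x, HasGradientAt (f j) (g j x) x) (hg : ∀ j x y, ‖g j x - g j y‖ ≤ L * ‖x - y‖)
  (hxs : ∀ x, (1 / (Fintype.card V : ℝ)) * ∑ j, f j xs ≤ (1 / (Fintype.card V : ℝ)) * ∑ j, f j x)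
  (hm : IsMixingTime (mixingMatrix G) π m)
include hG hπ h hL hσ hε hf hg hxs hm

/-- With μ = 0 all weights are 1 and nothing needs to contract. The initial error and both noise
terms are small fractions of ηεT. -/
theorem convex_rate
    (hη : γ * headMass π = 1 / (200 * invStep (Fintype.card V) (relayConst G m) L σ ε))
    (hconv : ∀ j x y, f j x - f j y ≤ ⟪g j x, x - y⟫_ℝ) {T : ℕ}
    (hT : 2560000 * (invStep (Fintype.card V) (relayConst G m) L σ ε / ε * ‖x₀ - xs‖ ^ 2)
      ≤ (T : ℝ)) :
    ∑ t ∈ Finset.range T, ((∫ ω, (1 / (Fintype.card V : ℝ)) * ∑ j, f j (avgIter G π X t ω) ∂P)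
      - (1 / (Fintype.card V : ℝ)) * ∑ j, f j xs) ≤ ε * T := by
  have := hG.nonempty
  have hn : (0 : ℝ) < Fintype.card V := by positivity
  have hC : 0 < relayConst G m := one_pos.trans_le (one_le_relayConst hG hπ hm.1)
  have hS := invStep_pos hn hC hL hσ hε
  have hη0 : 0 < γ * headMass π := by rw [hη]; positivity
  obtain ⟨h1, h2, h3⟩ := step_bounds hn hC hL hσ hε hη
  have h4 := h.convex_sum_le hG hπ hL hf hg hxs hm
    (pos_of_mul_pos_left hη0 (headMass_pos hG hπ).le) h1 le_rfl hL.le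
    (fun j x y => by simpa using hconv j x y) T
  simp only [zero_mul, zero_div, sub_zero, one_pow, inv_one, one_mul, Finset.sum_const,
    Finset.card_range, nsmul_eq_mul, mul_one] at h4
  have h5 : 0 ≤ ∫ ω, ‖virtIter G π γ X ζ T ω - xs‖ ^ 2 ∂P := integral_nonneg fun ω => by positivity
  have hT2 : 2560000 * (invStep (Fintype.card V) (relayConst G m) L σ ε * ‖x₀ - xs‖ ^ 2)
      ≤ ε * T := by
    calc _ = ε * (2560000
          * (invStep (Fintype.card V) (relayConst G m) L σ ε / ε * ‖x₀ - xs‖ ^ 2)) := by field_simp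
      _ ≤ _ := by gcongr
  have h6 : 200 * (γ * headMass π * invStep (Fintype.card V) (relayConst G m) L σ ε) = 1 := by
    rw [hη]; field_simp
  set η := γ * headMass π
  set S := invStep (Fintype.card V) (relayConst G m) L σ ε
  set R := ‖x₀ - xs‖ ^ 2
  have h7 : R ≤ η * (ε * T) / 12800 := by
    have := mul_le_mul_of_nonneg_left hT2 hη0.le
    have h8 : η * (2560000 * (S * R)) = 12800 * (200 * (η * S)) * R := by ring
    rw [h8, h6] at this
    linarith
  have h8 : 2 * η ^ 2 * σ ^ 2 / (Fintype.card V : ℝ) ≤ 2 * η * (ε / 200) := by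
    calc _ = 2 * η * (η * σ ^ 2 / (Fintype.card V : ℝ)) := by ring
      _ ≤ _ := by gcongr
  have h9 : 1152 * L * η ^ 3 * relayConst G m ^ 2 * σ ^ 2 ≤ 1152 * η * (ε / 40000) := by
    calc _ = 1152 * η * (L * η ^ 2 * relayConst G m ^ 2 * σ ^ 2) := by ring
      _ ≤ _ := by gcongr
  have h10 := mul_le_mul_of_nonneg_right (add_le_add h8 h9) (Nat.cast_nonneg (α := ℝ) T)
  have h11 : 0 ≤ η * (ε * T) := by positivity
  refine le_of_mul_le_mul_left (a := η / 4) ?_ (by positivity)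
  linarith

theorem smooth_rate
    (hη : γ * headMass π
      = 1 / (200 * invStep (Fintype.card V) (relayConst G m) L (√L * σ) ε)) {T : ℕ}
    (hT : 2560000 * (invStep (Fintype.card V) (relayConst G m) L (√L * σ) ε / ε
      * ((1 / (Fintype.card V : ℝ)) * ∑ j, f j x₀ - (1 / (Fintype.card V : ℝ)) * ∑ j, f j xs))
      ≤ (T : ℝ)) :
    ∑ t ∈ Finset.range T,
      ∫ ω, ‖(1 / (Fintype.card V : ℝ)) • ∑ j, g j (avgIter G π X t ω)‖ ^ 2 ∂P ≤ ε * T := by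
  have := hG.nonempty
  have hn : (0 : ℝ) < Fintype.card V := by positivity
  have hC : 0 < relayConst G m := one_pos.trans_le (one_le_relayConst hG hπ hm.1)
  have hσ' : 0 ≤ √L * σ := by positivity
  have hS := invStep_pos hn hC hL hσ' hε
  have hη0 : 0 < γ * headMass π := by rw [hη]; positivity
  obtain ⟨h1, h2, h3⟩ := step_bounds hn hC hL hσ' hε hη
  have h4 := h.smooth_sum_le hG hπ hL hf hg hxs hm
    (pos_of_mul_pos_left hη0 (headMass_pos hG hπ).le) h1 T
  have hsq : (√L * σ) ^ 2 = L * σ ^ 2 := by rw [mul_pow, Real.sq_sqrt hL.le]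
  rw [hsq] at h2 h3
  set F₀ := (1 / (Fintype.card V : ℝ)) * ∑ j, f j x₀ - (1 / (Fintype.card V : ℝ)) * ∑ j, f j xs
  have h6 : 200 * (γ * headMass π * invStep (Fintype.card V) (relayConst G m) L (√L * σ) ε) = 1 := by
    rw [hη]; field_simp
  set η := γ * headMass π
  set S := invStep (Fintype.card V) (relayConst G m) L (√L * σ) ε
  have hT2 : 2560000 * (S * F₀) ≤ ε * T := by
    calc _ = ε * (2560000 * (S / ε * F₀)) := by field_simp
      _ ≤ _ := by gcongr
  have h7 : F₀ ≤ η * (ε * T) / 12800 := by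
    have := mul_le_mul_of_nonneg_left hT2 hη0.le
    have h8 : η * (2560000 * (S * F₀)) = 12800 * (200 * (η * S)) * F₀ := by ring
    rw [h8, h6] at this
    linarith
  have h8 : L * η ^ 2 * σ ^ 2 / (Fintype.card V : ℝ) ≤ η * (ε / 200) := by
    calc _ = η * (η * (L * σ ^ 2) / (Fintype.card V : ℝ)) := by ring
      _ ≤ _ := by gcongr
  have h9 : 192 * L ^ 2 * η ^ 3 * relayConst G m ^ 2 * σ ^ 2 ≤ 192 * η * (ε / 40000) := by
    calc _ = 192 * η * (L * η ^ 2 * relayConst G m ^ 2 * (L * σ ^ 2)) := by ring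
      _ ≤ _ := by gcongr
  have h10 := mul_le_mul_of_nonneg_right (add_le_add h8 h9) (Nat.cast_nonneg (α := ℝ) T)
  have h11 : 0 ≤ η * (ε * T) := by positivity
  refine le_of_mul_le_mul_left (a := η / 8) ?_ (by positivity)
  linarith

theorem strongly_convex_rate {N : ℝ}
    (hη : γ * headMass π = 1 / (200 * invStep (Fintype.card V) (relayConst G m) L σ ε))
    (hμ : 0 < μ) (hμL : μ ≤ L)
    (hconv : ∀ j x y, f j x - f j y + μ / 2 * ‖x - y‖ ^ 2 ≤ ⟪g j x, x - y⟫_ℝ)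
    (hN : N = σ ^ 2 / (μ * Fintype.card V * ε) + relayConst G m * √L * σ / (μ * √ε)) {T : ℕ}
    (hT : 2560000 * (N * Real.log (1 + μ * N * ‖x₀ - xs‖ ^ 2 / ε)
      + relayConst G m * L / μ * Real.log (1 + relayConst G m * L * ‖x₀ - xs‖ ^ 2 / ε))
      ≤ (T : ℝ) + 1) :
    μ * (γ * headMass π) / 2 < 1 ∧
    (1 / ∑ t ∈ Finset.range (T + 1), ((1 - μ * (γ * headMass π) / 2) ^ (t + 1))⁻¹)
        * ∑ t ∈ Finset.range (T + 1), ((1 - μ * (γ * headMass π) / 2) ^ (t + 1))⁻¹ *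
          ((∫ ω, (1 / (Fintype.card V : ℝ)) * ∑ j, f j (avgIter G π X t ω) ∂P)
            - (1 / (Fintype.card V : ℝ)) * ∑ j, f j xs)
      + μ * ∫ ω, ‖avgIter G π X (T + 1) ω - xs‖ ^ 2 ∂P ≤ ε := by
  have := hG.nonempty
  have hn : (0 : ℝ) < Fintype.card V := by positivity
  have hC1 := one_le_relayConst hG hπ hm.1
  have hC : 0 < relayConst G m := one_pos.trans_le hC1
  have hCd := diam_add_one_le_relayConst hG hπ hm.1
  have hS := invStep_pos hn hC hL hσ hε
  have hη0 : 0 < γ * headMass π := by rw [hη]; positivity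
  obtain ⟨h1, h2, h3⟩ := step_bounds hn hC hL hσ hε hη
  have h4 := h.convex_sum_le hG hπ hL hf hg hxs hm
    (pos_of_mul_pos_left hη0 (headMass_pos hG hπ).le) h1 hμ.le hμL hconv (T + 1)
  have hdist := h.integral_norm_sq_avgIter_sub_virtIter_le (π := π) hG (T + 1)
  set η := γ * headMass π
  have hLη : 0 < L * η := mul_pos hL hη0
  have hLηC : L * η ≤ L * η * relayConst G m := le_mul_of_one_le_right hLη.le hC1
  have hμη : μ * η ≤ L * η := by gcongr
  have ha1 : μ * η / 2 < 1 := by linarith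
  refine ⟨ha1, ?_⟩
  have hw0 := weight_pos ha1
  set W := ∑ t ∈ Finset.range (T + 1), ((1 - μ * η / 2) ^ (t + 1))⁻¹ with hWdef
  have hvW : ((1 - μ * η / 2) ^ (T + 1))⁻¹ ≤ W :=
    Finset.single_le_sum (f := fun t : ℕ => ((1 - μ * η / 2) ^ (t + 1))⁻¹)
      (fun t _ => (hw0 t).le) (Finset.self_mem_range_succ T)
  have hW0 : 0 < W := (hw0 T).trans_le hvW
  -- The weight of the final squared error is at least μηW/2. After division by ηW/4 it becomes 2μ,
  -- exactly what the last-iterate term requires.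
  have haW : μ * η / 2 * W ≤ ((1 - μ * η / 2) ^ (T + 1))⁻¹ := mul_sum_weight_le ha1 (T + 1)
  have hinit := initial_error_le (R := ‖x₀ - xs‖) (T := T + 1) hn hC hL hσ hε hμ hN hη ha1
    (by push_cast; exact hT) hvW
  set SΔ := ∑ t ∈ Finset.range (T + 1), ((1 - μ * η / 2) ^ (t + 1))⁻¹ *
          ((∫ ω, (1 / (Fintype.card V : ℝ)) * ∑ j, f j (avgIter G π X t ω) ∂P)
            - (1 / (Fintype.card V : ℝ)) * ∑ j, f j xs)
  set r := ∫ ω, ‖virtIter G π γ X ζ (T + 1) ω - xs‖ ^ 2 ∂P with hr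
  have hr0 : 0 ≤ r := integral_nonneg fun ω => by positivity
  have hlast : ∫ ω, ‖avgIter G π X (T + 1) ω - xs‖ ^ 2 ∂P
      ≤ 2 * (4 * η ^ 2 * G.diam * σ ^ 2 / Fintype.card V) + 2 * r := by
    have hi1 : Integrable (fun ω => ‖avgIter G π X (T + 1) ω - virtIter G π γ X ζ (T + 1) ω‖ ^ 2) P :=
      integrable_norm_sq ((h.memLp_avgIter π (T + 1)).sub (h.memLp_virtIter π (T + 1)))
    have hi2 : Integrable (fun ω => ‖virtIter G π γ X ζ (T + 1) ω - xs‖ ^ 2) P :=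
      integrable_norm_sq ((h.memLp_virtIter π (T + 1)).sub (memLp_const xs))
    have hi3 := integrable_norm_sq ((h.memLp_avgIter π (T + 1)).sub (memLp_const xs))
    calc _ ≤ ∫ ω, (2 * ‖avgIter G π X (T + 1) ω - virtIter G π γ X ζ (T + 1) ω‖ ^ 2
            + 2 * ‖virtIter G π γ X ζ (T + 1) ω - xs‖ ^ 2) ∂P := by
          refine integral_mono hi3 ((hi1.const_mul 2).add (hi2.const_mul 2)) fun ω => ?_
          have := norm_add_sq_le_two (avgIter G π X (T + 1) ω - virtIter G π γ X ζ (T + 1) ω)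
            (virtIter G π γ X ζ (T + 1) ω - xs)
          rw [sub_add_sub_cancel] at this
          exact this
      _ = 2 * (∫ ω, ‖avgIter G π X (T + 1) ω - virtIter G π γ X ζ (T + 1) ω‖ ^ 2 ∂P) + 2 * r := by
          rw [integral_add (hi1.const_mul 2) (hi2.const_mul 2), integral_const_mul,
            integral_const_mul]
      _ ≤ _ := by gcongr
  -- Passing from the virtual to the averaged last iterate costs only ε/5000.
  have h5 : 8 * μ * η ^ 2 * G.diam * σ ^ 2 / (Fintype.card V : ℝ) ≤ 8 * (1 / 200) * (ε / 200) := by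
    calc 8 * μ * η ^ 2 * G.diam * σ ^ 2 / (Fintype.card V : ℝ)
        = 8 * (μ * η * G.diam) * (η * σ ^ 2 / (Fintype.card V : ℝ)) := by ring
      _ ≤ 8 * (L * η * relayConst G m) * (ε / 200) := by gcongr; linarith
      _ ≤ _ := by gcongr; linarith
  have h6 : μ * ∫ ω, ‖avgIter G π X (T + 1) ω - xs‖ ^ 2 ∂P ≤ 2 * μ * r + ε / 5000 := by
    calc _ ≤ μ * (2 * (4 * η ^ 2 * G.diam * σ ^ 2 / Fintype.card V) + 2 * r) := by gcongr
      _ = 8 * μ * η ^ 2 * G.diam * σ ^ 2 / (Fintype.card V : ℝ) + 2 * μ * r := by ring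
      _ ≤ _ := by linarith
  have h8 : 2 * η ^ 2 * σ ^ 2 / (Fintype.card V : ℝ) ≤ 2 * η * (ε / 200) := by
    calc _ = 2 * η * (η * σ ^ 2 / (Fintype.card V : ℝ)) := by ring
      _ ≤ _ := by gcongr
  have h9 : 1152 * L * η ^ 3 * relayConst G m ^ 2 * σ ^ 2 ≤ 1152 * η * (ε / 40000) := by
    calc _ = 1152 * η * (L * η ^ 2 * relayConst G m ^ 2 * σ ^ 2) := by ring
      _ ≤ _ := by gcongr
  have h10 := mul_le_mul_of_nonneg_right (add_le_add h8 h9) hW0.le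
  have h11 := mul_le_mul_of_nonneg_right haW hr0
  have h12 : 0 < η * (ε * W) := by positivity
  have h13 : η / 4 * (SΔ + 2 * μ * r * W) ≤ η / 4 * ((ε - ε / 5000) * W) := by
    linarith
  have h14 := le_of_mul_le_mul_left h13 (by positivity)
  have h15 : 1 / W * SΔ + 2 * μ * r ≤ ε - ε / 5000 := by
    refine le_of_mul_le_mul_right ?_ hW0
    calc (1 / W * SΔ + 2 * μ * r) * W = SΔ + 2 * μ * r * W := by field_simp
      _ ≤ _ := h14
  linarith

end NoisyRelay

/-! ### Transfer to regular losses, and degenerate smoothness constants -/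

section Transfer

variable {V : Type*} [Fintype V] {d : ℕ} {Ξ : V → Type*} [∀ i, MeasurableSpace (Ξ i)]
  {Ω : Type*} [MeasurableSpace Ω] {P : Measure Ω} {G : SimpleGraph V}
  {D : ∀ i, Measure (Ξ i)} {F F' : ∀ i, EuclideanSpace ℝ (Fin d) → Ξ i → ℝ}
  {ξ : ∀ i, ℤ → Ω → Ξ i} {L σ μ : ℝ}

theorem obj_congr (h : ∀ i, ∀ᵐ ξ ∂(D i), ∀ x, F' i x ξ = F i x ξ) : obj D F' = obj D F := by
  ext x
  simp only [obj, localObj_congr h]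

omit [∀ i, MeasurableSpace (Ξ i)] in
theorem model_congr {x₀ : EuclideanSpace ℝ (Fin d)} {γ : ℝ} {u : ∀ i, ℤ → Ξ i}
    (h : ∀ i s x, F' i x (u i s) = F i x (u i s)) (s : ℤ) :
    ∀ i, model G F' x₀ γ u s i = model G F x₀ γ u s i := by
  refine model_induction G (p := fun s => ∀ i, model G F' x₀ γ u s i = model G F x₀ γ u s i)
    (fun s hs i => ?_) (fun s hs ih i => ?_) s
  · rw [model_nonpos _ _ _ hs, model_nonpos _ _ _ hs]
  · rw [model_pos _ _ _ hs, model_pos _ _ _ hs]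
    refine congrArg _ (Finset.sum_congr rfl fun j _ => ?_)
    rw [ih i j j]
    simp only [h]

/-- Changing the losses on null sets of samples does not change the iterates. -/
theorem xbar_ae_congr (h : ∀ i, ∀ᵐ ξ ∂(D i), ∀ x, F' i x ξ = F i x ξ) (hξ : IsSampling P D ξ)
    (π : Idx G → ℝ) (x₀ : EuclideanSpace ℝ (Fin d)) (γ : ℝ) (t : ℕ) :
    ∀ᵐ ω ∂P, xbar G π F' x₀ γ (fun i s => ξ i s ω) t = xbar G π F x₀ γ (fun i s => ξ i s ω) t := by
  -- There are only countably many samples, so one null set takes care of all of them.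
  have h1 : ∀ᵐ ω ∂P, ∀ i s x, F' i x (ξ i s ω) = F i x (ξ i s ω) := by
    refine ae_all_iff.2 fun i => ae_all_iff.2 fun s => ?_
    have h2 := h i
    rw [← hξ.2.1 i s] at h2
    exact ae_of_ae_map (hξ.1 i s).aemeasurable h2
  filter_upwards [h1] with ω hω
  simp only [xbar, stacked, model_congr hω]

variable [∀ i, IsProbabilityMeasure (D i)]

namespace IsRegular

variable [Nonempty V] (h : IsRegular D F L σ)
include h

omit [Nonempty V] in
theorem hasGradientAt_obj (x : EuclideanSpace ℝ (Fin d)) :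
    HasGradientAt (obj D F)
      ((1 / (Fintype.card V : ℝ)) • ∑ j, ∇ (localObj D F j) x) x :=
  hasGradientAt_mean h.hasGradientAt_localObj x

omit [Nonempty V] in
theorem gradient_obj (x : EuclideanSpace ℝ (Fin d)) :
    ∇ (obj D F) x = (1 / (Fintype.card V : ℝ)) • ∑ j, ∇ (localObj D F j) x :=
  (h.hasGradientAt_obj x).gradient

theorem norm_gradient_obj_sub_le (x y : EuclideanSpace ℝ (Fin d)) :
    ‖∇ (obj D F) x - ∇ (obj D F) y‖ ≤ L * ‖x - y‖ := by
  rw [h.gradient_obj, h.gradient_obj]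
  exact norm_mean_sub_le h.norm_gradient_localObj_sub_le x y

/-- For L = 0 the gradient is constant, and it vanishes at the minimizer. -/
theorem gradient_obj_eq_zero (hL : L = 0) {xs : EuclideanSpace ℝ (Fin d)}
    (hxs : ∀ x, obj D F xs ≤ obj D F x) (x : EuclideanSpace ℝ (Fin d)) : ∇ (obj D F) x = 0 := by
  have h1 := h.norm_gradient_obj_sub_le x xs
  rw [h.gradient_obj xs, gradient_eq_zero_of_forall_le h.hasGradientAt_obj hxs, hL, zero_mul,
    sub_zero] at h1
  exact norm_le_zero_iff.1 h1

theorem obj_eq_of_lipschitz_zero (hL : L = 0) {xs : EuclideanSpace ℝ (Fin d)}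
    (hxs : ∀ x, obj D F xs ≤ obj D F x) (x : EuclideanSpace ℝ (Fin d)) :
    obj D F x = obj D F xs := by
  refine is_const_of_fderiv_eq_zero (𝕜 := ℝ)
    (fun x => (h.hasGradientAt_obj x).differentiableAt) (fun x => ?_) x xs
  rw [(h.hasGradientAt_obj x).hasFDerivAt.fderiv, ← h.gradient_obj, h.gradient_obj_eq_zero hL hxs,
    map_zero]

omit [Fintype V] in
/-- An objective cannot be more convex than it is smooth, except in dimension zero. -/
theorem subsingleton_of_lt (hμ : MuConvex D F μ) (hL : L < μ) :
    Subsingleton (EuclideanSpace ℝ (Fin d)) := by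
  refine ⟨fun x y => ?_⟩
  obtain ⟨i⟩ := ‹Nonempty V›
  have h1 := hμ i x y
  have h2 := hμ i y x
  have h3 := h.norm_gradient_localObj_sub_le i x y
  have h4 := real_inner_le_norm (∇ (localObj D F i) x - ∇ (localObj D F i) y) (x - y)
  rw [← neg_sub x y, inner_neg_right, norm_neg] at h2
  rw [inner_sub_left] at h4
  have h5 := mul_le_mul_of_nonneg_right h3 (norm_nonneg (x - y))
  have h6 : (μ - L) * ‖x - y‖ ^ 2 ≤ 0 := by nlinarith
  have h7 : ‖x - y‖ ^ 2 ≤ 0 := nonpos_of_mul_nonpos_right h6 (by linarith)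
  have h8 : ‖x - y‖ = 0 := pow_eq_zero_iff two_ne_zero |>.1 (le_antisymm h7 (sq_nonneg _))
  exact sub_eq_zero.1 (norm_eq_zero.1 h8)

end IsRegular

end Transfer

/-! ### Rates for RelaySGD -/

section Rates

variable {V : Type*} [Fintype V] [DecidableEq V] {d : ℕ} {Ξ : V → Type*}
  [∀ i, MeasurableSpace (Ξ i)] {Ω : Type*} [MeasurableSpace Ω] {P : Measure Ω}
  [IsProbabilityMeasure P] {G : SimpleGraph V} {π : Idx G → ℝ} {m : ℕ}
  {D : ∀ i, Measure (Ξ i)} [∀ i, IsProbabilityMeasure (D i)]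
  {F : ∀ i, EuclideanSpace ℝ (Fin d) → Ξ i → ℝ} {ξ : ∀ i, ℤ → Ω → Ξ i} {L σ ε : ℝ}
  {x₀ xs : EuclideanSpace ℝ (Fin d)}

omit [DecidableEq V] [IsProbabilityMeasure P] [∀ i, IsProbabilityMeasure (D i)] in
/-- Integrals along the averaged iterates can be computed with regularized losses. -/
theorem integral_xbar_congr {F' : ∀ i, EuclideanSpace ℝ (Fin d) → Ξ i → ℝ}
    (h : ∀ i, ∀ᵐ ξ ∂(D i), ∀ x, F' i x ξ = F i x ξ) (hξ : IsSampling P D ξ) (γ : ℝ)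
    (φ : EuclideanSpace ℝ (Fin d) → ℝ) (t : ℕ) :
    ∫ ω, φ (xbar G π F x₀ γ (fun i s => ξ i s ω) t) ∂P
      = ∫ ω, φ (xbar G π F' x₀ γ (fun i s => ξ i s ω) t) ∂P :=
  integral_congr_ae ((xbar_ae_congr h hξ π x₀ γ t).mono fun _ hω => congrArg φ hω.symm)

omit [DecidableEq V] [IsProbabilityMeasure P] [∀ i, IsProbabilityMeasure (D i)] in
theorem integrable_xbar_congr {F' : ∀ i, EuclideanSpace ℝ (Fin d) → Ξ i → ℝ}
    (h : ∀ i, ∀ᵐ ξ ∂(D i), ∀ x, F' i x ξ = F i x ξ) (hξ : IsSampling P D ξ) (γ : ℝ)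
    (φ : EuclideanSpace ℝ (Fin d) → ℝ) (t : ℕ)
    (hi : Integrable (fun ω => φ (xbar G π F' x₀ γ (fun i s => ξ i s ω) t)) P) :
    Integrable (fun ω => φ (xbar G π F x₀ γ (fun i s => ξ i s ω) t)) P :=
  hi.congr ((xbar_ae_congr h hξ π x₀ γ t).mono fun _ hω => congrArg φ hω)

variable (hG : G.Connected) (hπ : IsStationary (mixingMatrix G) π)
  (hm : IsMixingTime (mixingMatrix G) π m) (hF : ∀ i x, Integrable (F i x) (D i))
  (hL : LSmooth D F L) (hσ : BoundedNoise D F σ) (hξ : IsSampling P D ξ)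
  (hxs : ∀ x, obj D F xs ≤ obj D F x) (hε : 0 < ε)
include hG hπ hm hF hL hσ hξ hxs hε

theorem exists_stepSize_convex (hconv : MuConvex D F 0) :
    ∃ γ : ℝ, 0 < γ ∧ ∀ T : ℕ,
      2560000 * ((σ ^ 2 / (Fintype.card V * ε ^ 2) + relayConst G m * √L * σ / ε ^ (3 / 2 : ℝ)
          + relayConst G m * L / ε) * ‖x₀ - xs‖ ^ 2) ≤ (T : ℝ) + 1 →
      (∀ t ≤ T, Integrable (fun ω => obj D F (xbar G π F x₀ γ (fun i s => ξ i s ω) t)) P) ∧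
      (1 / ((T : ℝ) + 1)) * ∑ t ∈ Finset.range (T + 1),
        ((∫ ω, obj D F (xbar G π F x₀ γ (fun i s => ξ i s ω) t) ∂P) - obj D F xs) ≤ ε := by
  have := hG.nonempty
  have hn : (0 : ℝ) < Fintype.card V := by positivity
  have hC : 0 < relayConst G m := one_pos.trans_le (one_le_relayConst hG hπ hm.1)
  obtain ⟨F', hF', hae⟩ := exists_isRegular hF hL hσ
  have hobj := obj_congr hae
  rcases hL.1.eq_or_lt' with hL0 | hL0
  -- For L = 0 the objective is constant, so every step size works.
  · refine ⟨1, one_pos, fun T _ => ?_⟩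
    have hc : ∀ x, obj D F x = obj D F xs := by
      rw [← hobj] at hxs ⊢
      exact hF'.obj_eq_of_lipschitz_zero hL0 hxs
    simp [hc, hε.le]
  · have hS := invStep_pos hn hC hL0 hσ.1 hε
    have hh := headMass_pos hG hπ
    -- Dividing by nπ₀ gives the effective step γnπ₀ its prescribed value.
    refine ⟨1 / (200 * invStep (Fintype.card V) (relayConst G m) L σ ε) / headMass π,
      by positivity, fun T hT => ?_⟩
    set γ := 1 / (200 * invStep (Fintype.card V) (relayConst G m) L σ ε) / headMass π with hγ
    have hη : γ * headMass π = 1 / (200 * invStep (Fintype.card V) (relayConst G m) L σ ε) := by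
      rw [hγ]
      field_simp
    have hX := noisyRelay_model (G := G) hF' hξ x₀ γ
    rw [invStep_div hn hε] at hT
    have hrate := hX.convex_rate hG hπ hL0 hσ.1 hε hF'.hasGradientAt_localObj
      hF'.norm_gradient_localObj_sub_le (xs := xs) (by rw [← hobj] at hxs; exact hxs) hm hη
      (fun j x y => by
        have := hconv j x y
        rw [← localObj_congr hae] at this
        simpa using this) (T := T + 1) (by push_cast; exact hT)
    refine ⟨fun t _ => integrable_xbar_congr hae hξ γ (obj D F) t ?_, ?_⟩
    · rw [← hobj]
      exact hX.integrable_obj_avgIter hG hL0 hF'.hasGradientAt_localObj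
        hF'.norm_gradient_localObj_sub_le t
    · simp only [integral_xbar_congr hae hξ γ (obj D F)]
      rw [← hobj, one_div, inv_mul_le_iff₀ (by positivity), mul_comm]
      push_cast at hrate
      exact hrate

theorem exists_stepSize_smooth :
    ∃ γ : ℝ, 0 < γ ∧ ∀ T : ℕ,
      2560000 * ((σ ^ 2 / (Fintype.card V * ε ^ 2) + relayConst G m * σ / ε ^ (3 / 2 : ℝ)
          + relayConst G m / ε) * (L * (obj D F x₀ - obj D F xs))) ≤ (T : ℝ) + 1 →
      (∀ t ≤ T, Integrable (fun ω => ‖∇ (obj D F)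
          (xbar G π F x₀ γ (fun i s => ξ i s ω) t)‖ ^ 2) P) ∧
      (1 / ((T : ℝ) + 1)) * ∑ t ∈ Finset.range (T + 1),
        (∫ ω, ‖∇ (obj D F) (xbar G π F x₀ γ (fun i s => ξ i s ω) t)‖ ^ 2 ∂P) ≤ ε := by
  have := hG.nonempty
  have hn : (0 : ℝ) < Fintype.card V := by positivity
  have hC : 0 < relayConst G m := one_pos.trans_le (one_le_relayConst hG hπ hm.1)
  obtain ⟨F', hF', hae⟩ := exists_isRegular hF hL hσ
  have hobj := obj_congr hae
  rcases hL.1.eq_or_lt' with hL0 | hL0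
  · refine ⟨1, one_pos, fun T _ => ?_⟩
    have hc : ∀ x, ∇ (obj D F) x = 0 := by
      rw [← hobj] at hxs ⊢
      exact hF'.gradient_obj_eq_zero hL0 hxs
    simp [hc, hε.le]
  · have hS := invStep_pos hn hC hL0 (mul_nonneg (Real.sqrt_nonneg L) hσ.1) hε
    have hh := headMass_pos hG hπ
    refine ⟨1 / (200 * invStep (Fintype.card V) (relayConst G m) L (√L * σ) ε) / headMass π,
      by positivity, fun T hT => ?_⟩
    set γ := 1 / (200 * invStep (Fintype.card V) (relayConst G m) L (√L * σ) ε) / headMass π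
      with hγ
    have hη : γ * headMass π
        = 1 / (200 * invStep (Fintype.card V) (relayConst G m) L (√L * σ) ε) := by
      rw [hγ]
      field_simp
    have hX := noisyRelay_model (G := G) hF' hξ x₀ γ
    rw [← mul_assoc _ L, invStep_sqrt_mul_div hn hL0 hε, ← hobj] at hT
    have hrate := hX.smooth_rate hG hπ hL0 hσ.1 hε hF'.hasGradientAt_localObj
      hF'.norm_gradient_localObj_sub_le (xs := xs) (by rw [← hobj] at hxs; exact hxs) hm hη
      (T := T + 1) (by push_cast; exact hT)
    have hgrad : ∀ x, ∇ (obj D F) x = (1 / (Fintype.card V : ℝ)) • ∑ j, ∇ (localObj D F' j) x := by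
      intro x
      rw [← hobj, hF'.gradient_obj]
    refine ⟨fun t _ => integrable_xbar_congr hae hξ γ (fun x => ‖∇ (obj D F) x‖ ^ 2) t ?_, ?_⟩
    · simp only [hgrad]
      exact hX.integrable_grad_avgIter hG hF'.norm_gradient_localObj_sub_le hL0.le t
    · simp only [integral_xbar_congr hae hξ γ (fun x => ‖∇ (obj D F) x‖ ^ 2)]
      simp only [hgrad]
      rw [one_div, inv_mul_le_iff₀ (by positivity), mul_comm]
      push_cast at hrate
      exact hrate

theorem exists_stepSize_strongly_convex {μ N : ℝ} (hμ : 0 < μ) (hconv : MuConvex D F μ)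
    (hN : N = σ ^ 2 / (μ * Fintype.card V * ε) + relayConst G m * √L * σ / (μ * √ε)) :
    ∃ γ : ℝ, 0 < γ ∧ μ * γ * headMass π / 2 < 1 ∧ ∀ T : ℕ,
      2560000 * (N * Real.log (1 + μ * N * ‖x₀ - xs‖ ^ 2 / ε)
          + relayConst G m * L / μ * Real.log (1 + relayConst G m * L * ‖x₀ - xs‖ ^ 2 / ε))
        ≤ (T : ℝ) + 1 →
      (∀ t ≤ T, Integrable (fun ω => obj D F (xbar G π F x₀ γ (fun i s => ξ i s ω) t)) P) ∧
      Integrable (fun ω => ‖xbar G π F x₀ γ (fun i s => ξ i s ω) (T + 1) - xs‖ ^ 2) P ∧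
      (1 / ∑ t ∈ Finset.range (T + 1), weight π μ γ t)
          * ∑ t ∈ Finset.range (T + 1), weight π μ γ t *
            ((∫ ω, obj D F (xbar G π F x₀ γ (fun i s => ξ i s ω) t) ∂P) - obj D F xs)
        + μ * (∫ ω, ‖xbar G π F x₀ γ (fun i s => ξ i s ω) (T + 1) - xs‖ ^ 2 ∂P) ≤ ε := by
  have := hG.nonempty
  have hn : (0 : ℝ) < Fintype.card V := by positivity
  have hC : 0 < relayConst G m := one_pos.trans_le (one_le_relayConst hG hπ hm.1)
  have hh := headMass_pos hG hπ
  obtain ⟨F', hF', hae⟩ := exists_isRegular hF hL hσ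
  have hobj := obj_congr hae
  have hconv' : MuConvex D F' μ := by
    unfold MuConvex at hconv ⊢
    rw [localObj_congr hae]
    exact hconv
  rcases lt_or_ge L μ with hLμ | hLμ
  · have := hF'.subsingleton_of_lt hconv' hLμ
    -- For L < μ the space has a single point, so only μγnπ₀/2 < 1 matters; this γ makes it 1/2.
    refine ⟨1 / (μ * headMass π), by positivity, ?_, fun T _ => ?_⟩
    · rw [show μ * (1 / (μ * headMass π)) * headMass π / 2 = 1 / 2 by field_simp]
      norm_num
    · have hx : ∀ x, x = xs := fun x => Subsingleton.elim x xs
      have hxb : ∀ ω t, xbar G π F x₀ (1 / (μ * headMass π)) (fun i s => ξ i s ω) t = xs :=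
        fun ω t => hx _
      simp only [hxb, integral_const, probReal_univ, one_smul, sub_self, norm_zero, mul_zero,
        Finset.sum_const_zero, ne_eq, OfNat.ofNat_ne_zero, not_false_eq_true, zero_pow, add_zero]
      exact ⟨fun _ _ => integrable_const _, integrable_const _, hε.le⟩
  · have hL0 := hμ.trans_le hLμ
    have hS := invStep_pos hn hC hL0 hσ.1 hε
    refine ⟨1 / (200 * invStep (Fintype.card V) (relayConst G m) L σ ε) / headMass π,
      by positivity, ?_⟩
    set γ := 1 / (200 * invStep (Fintype.card V) (relayConst G m) L σ ε) / headMass π with hγ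
    have hη : γ * headMass π = 1 / (200 * invStep (Fintype.card V) (relayConst G m) L σ ε) := by
      rw [hγ]
      field_simp
    have hX := noisyRelay_model (G := G) hF' hξ x₀ γ
    refine ⟨?_, fun T hT => ⟨fun t _ => integrable_xbar_congr hae hξ γ (obj D F) t ?_,
      integrable_xbar_congr hae hξ γ (fun x => ‖x - xs‖ ^ 2) (T + 1) ?_, ?_⟩⟩
    · have h1 := (step_bounds hn hC hL0 hσ.1 hε hη).1
      have h2 : 0 ≤ γ * headMass π := by rw [hη]; positivity
      have h3 : μ * (γ * headMass π) ≤ L * (γ * headMass π) * relayConst G m := by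
        calc μ * (γ * headMass π) ≤ L * (γ * headMass π) := by gcongr
          _ ≤ _ := le_mul_of_one_le_right (by positivity) (one_le_relayConst hG hπ hm.1)
      rw [mul_assoc]
      linarith
    · rw [← hobj]
      exact hX.integrable_obj_avgIter hG hL0 hF'.hasGradientAt_localObj
        hF'.norm_gradient_localObj_sub_le t
    · exact integrable_norm_sq ((hX.memLp_avgIter π (T + 1)).sub (memLp_const xs))
    · have hrate := (hX.strongly_convex_rate hG hπ hL0 hσ.1 hε hF'.hasGradientAt_localObj
        hF'.norm_gradient_localObj_sub_le (xs := xs) (by rw [← hobj] at hxs; exact hxs) hm hη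
        hμ hLμ hconv' hN hT).2
      simp only [integral_xbar_congr hae hξ γ (obj D F),
        integral_xbar_congr hae hξ γ (fun x => ‖x - xs‖ ^ 2), weight, mul_assoc μ γ]
      rw [← hobj]
      exact hrate

end Rates

end RelaySGD

end

/-! ### Main theorem -/

theorem theorem1 :
    ∃ K : ℝ, 0 < K ∧
    ∀ (V : Type*) [Fintype V] [DecidableEq V] (G : SimpleGraph V), G.IsTree →
    (∃! π : RelaySGD.Idx G → ℝ, RelaySGD.IsStationary (RelaySGD.mixingMatrix G) π) ∧
    0 < RelaySGD.gap (RelaySGD.mixingMatrix G) ∧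
    ∀ π : RelaySGD.Idx G → ℝ, RelaySGD.IsStationary (RelaySGD.mixingMatrix G) π →
    (∃ m : ℕ, RelaySGD.IsMixingTime (RelaySGD.mixingMatrix G) π m) ∧
    ∀ m : ℕ, RelaySGD.IsMixingTime (RelaySGD.mixingMatrix G) π m →
    ∀ (d : ℕ) (Ξ : V → Type*) [∀ i, MeasurableSpace (Ξ i)]
      (D : ∀ i, Measure (Ξ i)) [∀ i, IsProbabilityMeasure (D i)]
      (F : ∀ i, EuclideanSpace ℝ (Fin d) → Ξ i → ℝ)
      (Ω : Type*) [MeasurableSpace Ω] (P : Measure Ω) [IsProbabilityMeasure P]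
      (ξ : ∀ i, ℤ → Ω → Ξ i) (L σ ε : ℝ) (x₀ xs : EuclideanSpace ℝ (Fin d)),
      (∀ i x, Integrable (F i x) (D i)) →
      RelaySGD.LSmooth D F L →
      RelaySGD.BoundedNoise D F σ →
      RelaySGD.IsSampling P D ξ →
      (∀ x, RelaySGD.obj D F xs ≤ RelaySGD.obj D F x) →
      0 < ε →
      -- convex case
      (∀ μ : ℝ, 0 ≤ μ → RelaySGD.MuConvex D F μ →
        ∃ γ : ℝ, 0 < γ ∧ ∀ T : ℕ,
          K * ((σ ^ 2 / (Fintype.card V * ε ^ 2)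
              + RelaySGD.relayConst G m * √L * σ / ε ^ (3 / 2 : ℝ)
              + RelaySGD.relayConst G m * L / ε) * ‖x₀ - xs‖ ^ 2) ≤ (T : ℝ) + 1 →
          (∀ t ≤ T, Integrable (fun ω => RelaySGD.obj D F
              (RelaySGD.xbar G π F x₀ γ (fun i s => ξ i s ω) t)) P) ∧
          (1 / ((T : ℝ) + 1)) * ∑ t ∈ Finset.range (T + 1),
            ((∫ ω, RelaySGD.obj D F (RelaySGD.xbar G π F x₀ γ (fun i s => ξ i s ω) t) ∂P)
              - RelaySGD.obj D F xs) ≤ ε) ∧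
      -- non-convex case
      (∃ γ : ℝ, 0 < γ ∧ ∀ T : ℕ,
          K * ((σ ^ 2 / (Fintype.card V * ε ^ 2)
              + RelaySGD.relayConst G m * σ / ε ^ (3 / 2 : ℝ)
              + RelaySGD.relayConst G m / ε)
            * (L * (RelaySGD.obj D F x₀ - RelaySGD.obj D F xs))) ≤ (T : ℝ) + 1 →
          (∀ t ≤ T, Integrable (fun ω => ‖∇ (RelaySGD.obj D F)
              (RelaySGD.xbar G π F x₀ γ (fun i s => ξ i s ω) t)‖ ^ 2) P) ∧
          (1 / ((T : ℝ) + 1)) * ∑ t ∈ Finset.range (T + 1),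
            (∫ ω, ‖∇ (RelaySGD.obj D F)
              (RelaySGD.xbar G π F x₀ γ (fun i s => ξ i s ω) t)‖ ^ 2 ∂P) ≤ ε) ∧
      -- strongly convex case
      (∀ μ N : ℝ, 0 < μ → RelaySGD.MuConvex D F μ →
        N = σ ^ 2 / (μ * Fintype.card V * ε)
            + RelaySGD.relayConst G m * √L * σ / (μ * √ε) →
        ∃ γ : ℝ, 0 < γ ∧ μ * γ * RelaySGD.headMass π / 2 < 1 ∧ ∀ T : ℕ,
          K * (N * Real.log (1 + μ * N * ‖x₀ - xs‖ ^ 2 / ε)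
              + RelaySGD.relayConst G m * L / μ
                * Real.log (1 + RelaySGD.relayConst G m * L * ‖x₀ - xs‖ ^ 2 / ε))
            ≤ (T : ℝ) + 1 →
          (∀ t ≤ T, Integrable (fun ω => RelaySGD.obj D F
              (RelaySGD.xbar G π F x₀ γ (fun i s => ξ i s ω) t)) P) ∧
          Integrable (fun ω =>
            ‖RelaySGD.xbar G π F x₀ γ (fun i s => ξ i s ω) (T + 1) - xs‖ ^ 2) P ∧
          (1 / ∑ t ∈ Finset.range (T + 1), RelaySGD.weight π μ γ t)
              * ∑ t ∈ Finset.range (T + 1), RelaySGD.weight π μ γ t *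
                ((∫ ω, RelaySGD.obj D F (RelaySGD.xbar G π F x₀ γ (fun i s => ξ i s ω) t) ∂P)
                  - RelaySGD.obj D F xs)
            + μ * (∫ ω, ‖RelaySGD.xbar G π F x₀ γ (fun i s => ξ i s ω) (T + 1) - xs‖ ^ 2 ∂P)
            ≤ ε) := by
  refine ⟨2560000, by norm_num, fun V _ _ G hT => ?_⟩
  have hG := hT.connected
  obtain ⟨ρ, hρ, huniq⟩ := RelaySGD.existsUnique_stationary hG
  refine ⟨⟨ρ, hρ, huniq⟩, RelaySGD.gap_pos hG hρ, fun π hπ =>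
    ⟨RelaySGD.exists_mixingTime hG hπ, ?_⟩⟩
  intro m hm d Ξ _ D _ F Ω _ P _ ξ L σ ε x₀ xs hF hL hσ hξ hxs hε
  refine ⟨fun μ hμ hconv => ?_,
    RelaySGD.exists_stepSize_smooth hG hπ hm hF hL hσ hξ hxs hε, fun μ N hμ hconv hN =>
    RelaySGD.exists_stepSize_strongly_convex hG hπ hm hF hL hσ hξ hxs hε hμ hconv hN⟩
  -- The convex rate does not involve μ, so μ-convexity is weakened to 0-convexity.
  refine RelaySGD.exists_stepSize_convex hG hπ hm hF hL hσ hξ hxs hε fun i x y => ?_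
  have h1 := hconv i x y
  have h2 : 0 ≤ μ / 2 * ‖x - y‖ ^ 2 := by positivity
  linarith
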